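/- Let $X$ be a complex Banach space and $A$ a sectorial operator in $X$, i.e. $A$ is closed and densely defined, and there are $\omega\in\mathbb{R}$, $\tfrac{\pi}{2}<\varphi<\pi$ and $M$ such that every $z\neq\omega$ with $|\arg(z-\omega)|\le\varphi$ lies in the resolvent set of $A$ and satisfies $\|(z-A)^{-1}\|\le M/|z-\omega|$. Fix a real $c>\omega$ and $0\le\alpha<1$, and let $X^\alpha$ be the domain of $(c-A)^\alpha$ with norm $\|w\|_\alpha=\|(c-A)^\alpha w\|_X$. Let $f:X^\alpha\to X$ be complex Fréchet differentiable on all of $X^\alpha$, with $f'$ bounded on bounded subsets of $X^\alpha$. Consider $$\dot w=Aw+f(w). \qquad (*)$$ An equilibrium is a $W\in D(A)$ with $AW+f(W)=0$. It is hyperbolic if the spectrum of $L=A+f'(W)$ does not meet the imaginary axis, and linearly asymptotically stable if $\operatorname{spec}L\subset\{\operatorname{Re}z<0\}$. For hyperbolic $W$, let $E^u$ denote the range of the spectral (Riesz) projection of $L$ for the part of the spectrum in $\{\operatorname{Re}z>0\}$; it is the tangent space at $W$ of the local unstable manifold $W^u$. **Theorem.** Let $W_\pm$ be hyperbolic equilibria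 of $(*)$, and let $\Gamma:\mathbb{R}\to X^\alpha$ be a nonconstant solution of $(*)$ for all real times (continuous in $X^\alpha$, with values in $D(A)$, differentiable in $X$), such that $\Gamma(r)\to W_\pm$ in $X^\alpha$ as $r\to\pm\infty$; the case $W_+=W_-$ is not excluded. Assume that 1. $W_+$ is linearly asymptotically stable; 2. the local unstable manifold of $W_-$ is finite-dimensional, i.e. $\dim E^u<\infty$ at $W_-$; 3. the restriction of $A+f'(W_-)$ to $E^u$ is diagonalizable, with real eigenvalues $\mu_0,\dots,\mu_k$ that are non-resonant: $\mu_j\neq m_0\mu_0+\dots+m_k\mu_k$ for all $j$ and all nonnegative integers $m_0,\dots,m_k$ with $m_0+\dots+m_k\ge 2$. Then $\Gamma$ has no complex entire time extension: there is no complex differentiable map $G:\mathbb{C}\to X^\alpha$ with $G(r)=\Gamma(r)$ for all $r\in\mathbb{R}$. -/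

import Mathlib

open Filter Topology MeasureTheory

noncomputable section

namespace AnalyticSemigroup

variable {X : Type*} [NormedAddCommGroup X] [NormedSpace ℂ X]

/-- `R` is the bounded two-sided inverse `(z - A)⁻¹` of the unbounded operator `z - A`. -/
def IsResolventAt (A : X →ₗ.[ℂ] X) (z : ℂ) (R : X →L[ℂ] X) : Prop :=
  (∀ y : X, ∃ h : R y ∈ A.domain, z • R y - A ⟨R y, h⟩ = y) ∧
    ∀ x : A.domain, R (z • (x : X) - A x) = x

/-- The resolvent set of an unbounded operator. -/
def resolventSet (A : X →ₗ.[ℂ] X) : Set ℂ :=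
  {z | ∃ R : X →L[ℂ] X, IsResolventAt A z R}

/-- The spectrum of an unbounded operator. -/
def spec (A : X →ₗ.[ℂ] X) : Set ℂ := (resolventSet A)ᶜ

open Classical in
/-- The resolvent `(z - A)⁻¹` for `z` in the resolvent set (and `0` elsewhere). -/
def resolvent (A : X →ₗ.[ℂ] X) (z : ℂ) : X →L[ℂ] X :=
  if h : ∃ R : X →L[ℂ] X, IsResolventAt A z R then h.choose else 0

/-- `A` is sectorial with vertex `ω` (so that `A` generates an analytic semigroup): `A` is closed
and densely defined, and for some angle `π/2 < φ < π` the sector `|arg (z - ω)| ≤ φ`, `z ≠ ω`,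
lies in the resolvent set, with `‖(z - A)⁻¹‖ ≤ M / |z - ω|` there. -/
def IsSectorial (A : X →ₗ.[ℂ] X) (ω : ℝ) : Prop :=
  Dense (A.domain : Set X) ∧ A.IsClosed ∧
    ∃ φ M : ℝ, Real.pi / 2 < φ ∧ φ < Real.pi ∧
      ∀ z : ℂ, z ≠ (ω : ℂ) → |Complex.arg (z - ω)| ≤ φ →
        z ∈ resolventSet A ∧ ‖resolvent A z‖ ≤ M / ‖z - ω‖

/-- The bounded operator `(c - A)^(-α)`, for `0 ≤ α < 1` and `c` larger than the vertex of the
sectorial operator `A`, given for `0 < α < 1` by the classical formula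
`(sin (π α) / π) ∫₀^∞ s^(-α) (s + (c - A))⁻¹ ds`. -/
def negFracPower (A : X →ₗ.[ℂ] X) (c α : ℝ) : X →L[ℂ] X :=
  if α = 0 then ContinuousLinearMap.id ℂ X
  else (Real.sin (Real.pi * α) / Real.pi) •
    ∫ s in Set.Ioi (0 : ℝ), s ^ (-α) • resolvent A ((s + c : ℝ) : ℂ)

/-- The domain of `(c - A)^α`, that is, the range of `(c - A)^(-α)`. -/
def fracDomain (A : X →ₗ.[ℂ] X) (c α : ℝ) : Submodule ℂ X :=
  LinearMap.range (negFracPower A c α : X →ₗ[ℂ] X)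

/-- The fractional power space `X^α`: as a vector space, the domain of `(c - A)^α`. Its norm is
defined below. -/
def FracSpace (A : X →ₗ.[ℂ] X) (c α : ℝ) : Type _ := fracDomain A c α

instance (A : X →ₗ.[ℂ] X) (c α : ℝ) : AddCommGroup (FracSpace A c α) :=
  inferInstanceAs (AddCommGroup (fracDomain A c α))

instance (A : X →ₗ.[ℂ] X) (c α : ℝ) : Module ℂ (FracSpace A c α) :=
  inferInstanceAs (Module ℂ (fracDomain A c α))

instance isClosed_ker_negFracPower (A : X →ₗ.[ℂ] X) (c α : ℝ) :
    IsClosed (LinearMap.ker (negFracPower A c α : X →ₗ[ℂ] X) : Set X) :=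
  ContinuousLinearMap.isClosed_ker (negFracPower A c α)

/-- The map `x ↦ (c - A)^α x` on `X^α`, as the inverse of `(c - A)^(-α)`. It is written with values
in `X ⧸ ker (c - A)^(-α)`; for sectorial `A` this kernel is zero, so that this is `X` itself. -/
def fracPower (A : X →ₗ.[ℂ] X) (c α : ℝ) :
    FracSpace A c α ≃ₗ[ℂ] X ⧸ LinearMap.ker (negFracPower A c α : X →ₗ[ℂ] X) :=
  (LinearMap.quotKerEquivRange (negFracPower A c α : X →ₗ[ℂ] X)).symm

/-- The norm `‖x‖_α = ‖(c - A)^α x‖` of `X^α`. -/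
instance (A : X →ₗ.[ℂ] X) (c α : ℝ) : NormedAddCommGroup (FracSpace A c α) :=
  NormedAddCommGroup.induced (FracSpace A c α)
    (X ⧸ LinearMap.ker (negFracPower A c α : X →ₗ[ℂ] X))
    (fracPower A c α) (fracPower A c α).injective

instance (A : X →ₗ.[ℂ] X) (c α : ℝ) : NormedSpace ℂ (FracSpace A c α) :=
  NormedSpace.induced ℂ (FracSpace A c α)
    (X ⧸ LinearMap.ker (negFracPower A c α : X →ₗ[ℂ] X)) (fracPower A c α)

/-- The inclusion of `X^α` in `X`. -/
def FracSpace.toBase {A : X →ₗ.[ℂ] X} {c α : ℝ} : FracSpace A c α →ₗ[ℂ] X :=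
  (fracDomain A c α).subtype

variable {A : X →ₗ.[ℂ] X} {c α : ℝ}

/-- The operator `A + T` in `X`, for a bounded operator `T : X^α → X`. Its domain is
`D(A) ∩ X^α`, which is `D(A)` for sectorial `A` and `0 ≤ α < 1`. -/
def addFrac (A : X →ₗ.[ℂ] X) (T : FracSpace A c α →L[ℂ] X) : X →ₗ.[ℂ] X :=
  A + ⟨fracDomain A c α, (T : FracSpace A c α →ₗ[ℂ] X)⟩

/-- The linearization `L = A + f'(W)`. -/
def linearization (f : FracSpace A c α → X) (W : FracSpace A c α) : X →ₗ.[ℂ] X :=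
  addFrac A (fderiv ℂ f W)

/-- `W` is an equilibrium: `A W + f(W) = 0`. -/
def IsEquilibrium (f : FracSpace A c α → X) (W : FracSpace A c α) : Prop :=
  ∃ h : W.toBase ∈ A.domain, A ⟨W.toBase, h⟩ + f W = 0

/-- `W` is a hyperbolic equilibrium: the spectrum of the linearization at `W` does not meet the
imaginary axis. -/
def IsHyperbolicEquilibrium (f : FracSpace A c α → X) (W : FracSpace A c α) : Prop :=
  IsEquilibrium f W ∧ ∀ z ∈ spec (linearization f W), z.re ≠ 0

/-- `W` is linearly asymptotically stable: the spectrum of the linearization at `W` lies in the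
open left half plane. -/
def IsLinearlyAsymptoticallyStable (f : FracSpace A c α → X) (W : FracSpace A c α) : Prop :=
  ∀ z ∈ spec (linearization f W), z.re < 0

/-- `Γ` solves `w' = A w + f(w)` for all real times: it is continuous in `X^α`, takes values in
`D(A)`, and satisfies the equation with the derivative taken in `X`. -/
def IsEternalSolution (f : FracSpace A c α → X) (Γ : ℝ → FracSpace A c α) : Prop :=
  Continuous Γ ∧ ∀ r : ℝ, ∃ h : (Γ r).toBase ∈ A.domain,
    HasDerivAt (fun t : ℝ => (Γ t).toBase) (A ⟨(Γ r).toBase, h⟩ + f (Γ r)) r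

/-- `Γ : Wm ⇝ Wp` is a heteroclinic solution in real time. The homoclinic case `Wm = Wp` of
nonconstant `Γ` is included. -/
def IsHeteroclinic (f : FracSpace A c α → X) (Γ : ℝ → FracSpace A c α)
    (Wm Wp : FracSpace A c α) : Prop :=
  IsEternalSolution f Γ ∧ Tendsto Γ atBot (𝓝 Wm) ∧ Tendsto Γ atTop (𝓝 Wp) ∧
    ∃ r₁ r₂ : ℝ, Γ r₁ ≠ Γ r₂

/-- The spectral projection of `L` for the part of the spectrum in the open right half plane: the
Riesz integral `(2πi)⁻¹ ∮ (z - L)⁻¹ dz` over the circle of centre `ρ` and radius `ρ`, for all large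
real `ρ`. If `L` is sectorial with no spectrum on the imaginary axis, the unstable spectrum is
compact, so these circles enclose exactly that part for large `ρ`, and the integral no longer
depends on `ρ`. -/
def unstableProjection (L : X →ₗ.[ℂ] X) : X →L[ℂ] X :=
  limUnder atTop fun ρ : ℝ =>
    (2 * Real.pi * Complex.I : ℂ)⁻¹ • circleIntegral (resolvent L) (ρ : ℂ) ρ

/-- The unstable subspace `E^u` of `L`, the range of the unstable spectral projection. For the
linearization at a hyperbolic equilibrium `W` it is the tangent space at `W` of the local unstable
manifold, which is a graph over it. -/
def unstableSpace (L : X →ₗ.[ℂ] X) : Submodule ℂ X :=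
  LinearMap.range (unstableProjection L : X →ₗ[ℂ] X)

/-- Non-resonance: `μ j = ∑ i, m i * μ i` fails for every `j` and every nonnegative integer
multi-index `m` of order at least two. -/
def IsNonResonant {N : ℕ} (μ : Fin N → ℝ) : Prop :=
  ∀ (j : Fin N) (m : Fin N → ℕ), 2 ≤ ∑ i, m i → μ j ≠ ∑ i, (m i : ℝ) * μ i

/-- The restriction of `L` to its unstable subspace is diagonalizable (there is a basis of
eigenvectors), with real and non-resonant eigenvalues. -/
def HasDiagonalRealNonResonantUnstablePart (L : X →ₗ.[ℂ] X) : Prop :=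
  ∃ (N : ℕ) (b : Module.Basis (Fin N) ℂ (unstableSpace L)) (μ : Fin N → ℝ),
    (∀ j, ∃ h : (b j : X) ∈ L.domain, L ⟨(b j : X), h⟩ = (μ j : ℂ) • (b j : X)) ∧
      IsNonResonant μ

end AnalyticSemigroup

end

open AnalyticSemigroup

noncomputable section

namespace AnalyticSemigroup

set_option linter.unusedSectionVars false

section

/-! ### Integrals over hyperbolic contours -/

/-! Suppose `G` is an entire extension of `Γ`. It is shown that `G` is bounded; Liouville's theorem
then makes it constant, whereas `Γ` is not.

On the left, `Γ` leaves `Wm` along the unstable manifold. The unstable eigenvalues are positive and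
non-resonant, so orbits in it are absolutely convergent series `∑ exp (freq μ m * t) • a m` over
multi-indices (`UnstableSplitting.exists_expSeries_orbit`). Small divisors do not occur, because
only finitely many frequencies lie below any bound. Small backward orbits are determined by their
unstable coordinates at one time (`UnstableSplitting.exists_unique_radius`), hence `G` is such a
series on a left half plane. So it is bounded there and almost periodic in the imaginary direction
(`UnstableSplitting.almostPeriodic_of_tendsto`). The common almost periods `σ` of the modes are
relatively dense (`exists_almostPeriods`).

For such `σ`, `G (S + iσ)` is close to `Γ S`. Continuous dependence carries this closeness along the
segment to `T + iσ`, where `G` is close to `Γ T` and thus to `Wp`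
(`SectorLift.exists_continuous_dependence`). Stability of `Wp` survives small rotations of the time
direction, so `G` is bounded on a sector with vertex `T + iσ` and opening independent of `σ`
(`SectorLift.exists_sector_bound`). Since the vertices are relatively dense, these sectors cover a
right half plane. The remaining vertical strip is cut into rectangles by horizontal lines at almost
periods, where `G` is bounded too, and the maximum principle finishes (`eq_of_bounded_on_ladder`).

No semigroup is constructed. The equation is used in the form `R z (z • u - u' + h) = u`, with `R`
the resolvent of the linear part and `h` the nonlinearity. The identity theorem extends this form to
complex times (`IsLift.entire_relation`), and `DecayFamily.representation` turns it into a variation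
of constants formula with a contour integral over a hyperbola. All estimates rest on the decay of
resolvents as maps from `X` to `X^α` (`IsSectorial.exists_sectorLift`), applied after rotating,
after shifting to the right, or after splitting off the unstable modes
(`SectorLift.exists_unstableSplitting`). -/

/-- The Japanese bracket `√(1 + y²)`. -/
def jap (y : ℝ) : ℝ := Real.sqrt (1 + y ^ 2)

lemma jap_sq (y : ℝ) : jap y ^ 2 = 1 + y ^ 2 := Real.sq_sqrt (by positivity)

lemma jap_pos (y : ℝ) : 0 < jap y := Real.sqrt_pos.2 (by positivity)

lemma one_le_jap (y : ℝ) : 1 ≤ jap y := by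
  have := jap_sq y; have := jap_pos y; nlinarith [sq_nonneg y]

lemma abs_le_jap (y : ℝ) : |y| ≤ jap y :=
  abs_le_of_sq_le_sq (by have := jap_sq y; nlinarith) (jap_pos y).le

lemma jap_le (y : ℝ) : jap y ≤ 1 + |y| := by
  have := jap_sq y; have := jap_pos y
  have := sq_abs y; have := abs_nonneg y; nlinarith

lemma le_two_mul_jap (y : ℝ) : 1 + |y| ≤ 2 * jap y := by
  linarith [one_le_jap y, abs_le_jap y]

lemma hasDerivAt_jap (y : ℝ) : HasDerivAt jap (y / jap y) y := by
  have h : HasDerivAt (fun y : ℝ => 1 + y ^ 2) (2 * y) y := by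
    simpa using (hasDerivAt_pow 2 y).const_add 1
  have := h.sqrt (by positivity)
  rw [mul_div_mul_left _ _ two_ne_zero] at this
  exact this

lemma continuous_jap : Continuous jap := by unfold jap; fun_prop

/-- The left branch of a hyperbola, opening to the left and crossing the real axis at `-ε`. -/
def hyp (ε y : ℝ) : ℂ := (-(ε * jap y) : ℝ) + y * Complex.I

/-- The derivative of `hyp ε`. -/
def hypDeriv (ε y : ℝ) : ℂ := (-(ε * (y / jap y)) : ℝ) + Complex.I

@[simp] lemma hyp_re (ε y : ℝ) : (hyp ε y).re = -(ε * jap y) := by simp [hyp]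
@[simp] lemma hyp_im (ε y : ℝ) : (hyp ε y).im = y := by simp [hyp]

lemma hasDerivAt_hyp (ε y : ℝ) : HasDerivAt (hyp ε) (hypDeriv ε y) y := by
  have h1 := (((hasDerivAt_jap y).const_mul ε).neg).ofReal_comp
  have h2 := (Complex.ofRealCLM.hasDerivAt (x := y)).mul_const Complex.I
  refine (h1.add h2).congr_deriv ?_
  simp [hypDeriv]

lemma continuous_hyp (ε : ℝ) : Continuous (hyp ε) := by
  have := continuous_jap; unfold hyp; fun_prop

lemma continuous_hypDeriv (ε : ℝ) : Continuous (hypDeriv ε) := by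
  have := continuous_jap
  have h : ∀ y, jap y ≠ 0 := fun y => (jap_pos y).ne'
  unfold hypDeriv; fun_prop (disch := exact h _)

lemma norm_hypDeriv_le {ε : ℝ} (h0 : 0 ≤ ε) (h1 : ε ≤ 1) (y : ℝ) : ‖hypDeriv ε y‖ ≤ 2 := by
  have h : |y / jap y| ≤ 1 := by
    rw [abs_div, abs_of_pos (jap_pos y)]
    exact div_le_one_of_le₀ (abs_le_jap y) (jap_pos y).le
  have hI : ‖Complex.I‖ = 1 := Complex.norm_I
  refine (norm_add_le _ _).trans ?_
  rw [hI, Complex.norm_real, Real.norm_eq_abs, abs_neg, abs_mul, abs_of_nonneg h0]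
  nlinarith [abs_nonneg (y / jap y)]

lemma le_norm_hyp {ε : ℝ} (h0 : 0 ≤ ε) (y : ℝ) : ε * jap y ≤ ‖hyp ε y‖ := by
  have := Complex.abs_re_le_norm (hyp ε y)
  rw [hyp_re, abs_neg, abs_of_nonneg (mul_nonneg h0 (jap_pos y).le)] at this
  exact this

lemma hyp_ne_zero {ε : ℝ} (h0 : 0 < ε) (y : ℝ) : hyp ε y ≠ 0 := by
  have := le_norm_hyp h0.le y
  have h2 := mul_pos h0 (jap_pos y)
  exact norm_pos_iff.1 (h2.trans_le this)

lemma integrable_one_add_abs_rpow {r : ℝ} (hr : 1 < r) :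
    Integrable (fun y : ℝ => (1 + |y|) ^ (-r)) := by
  simpa using integrable_one_add_norm (E := ℝ) (μ := volume) (r := r) (by simpa using hr)

lemma integrable_one_add_abs_inv_sq : Integrable (fun y : ℝ => ((1 + |y|) ^ 2)⁻¹) := by
  have := integrable_one_add_abs_rpow (r := 2) (by norm_num)
  refine this.congr (Eventually.of_forall fun y => ?_)
  have h : 0 ≤ 1 + |y| := by positivity
  simp only [Real.rpow_neg h]
  norm_num

lemma exp_neg_le_inv_sq {x : ℝ} (hx : 0 < x) : Real.exp (-x) ≤ 2 * (x ^ 2)⁻¹ := by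
  have := Real.quadratic_le_exp_of_nonneg hx.le
  rw [Real.exp_neg, ← div_eq_mul_inv, inv_eq_one_div, div_le_div_iff₀ (Real.exp_pos _) (by positivity)]
  nlinarith

lemma exp_neg_mul_jap_le {c : ℝ} (hc : 0 < c) (y : ℝ) :
    Real.exp (-(c * jap y)) ≤ 8 / c ^ 2 * ((1 + |y|) ^ 2)⁻¹ := by
  refine (exp_neg_le_inv_sq (mul_pos hc (jap_pos y))).trans ?_
  have h1 := le_two_mul_jap y
  have h2 := jap_pos y
  have h3 : 0 < 1 + |y| := by positivity
  rw [← div_eq_mul_inv, ← div_eq_mul_inv, div_div, div_le_div_iff₀ (by positivity) (by positivity)]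
  have : (1 + |y|) ^ 2 ≤ (2 * jap y) ^ 2 := by gcongr
  nlinarith [sq_nonneg c]

lemma integrable_exp_neg_mul_jap {c : ℝ} (hc : 0 < c) :
    Integrable (fun y : ℝ => Real.exp (-(c * jap y))) := by
  refine (integrable_one_add_abs_inv_sq.const_mul (8 / c ^ 2)).mono' ?_ ?_
  · have := continuous_jap
    exact Continuous.aestronglyMeasurable (by fun_prop)
  · refine Eventually.of_forall fun y => ?_
    rw [Real.norm_eq_abs, abs_of_pos (Real.exp_pos _)]
    exact exp_neg_mul_jap_le hc y

variable {E : Type*} [NormedAddCommGroup E] [NormedSpace ℂ E]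

/-- The integral of `F` along the hyperbola `hyp ε` shifted by `s`. -/
def hypIntegral (ε : ℝ) (F : ℂ → E) : E := ∫ y : ℝ, hypDeriv ε y • F (hyp ε y)

/-- Sufficient domination of `F` near shifts of the hyperbola. -/
structure HypDominated (ε r : ℝ) (U : Set ℂ) (F : ℂ → E) (bound : ℝ → ℝ) (s : ℝ) : Prop where
  subset : ∀ y, Metric.closedBall (hyp ε y + s) r ⊆ U
  le : ∀ y, ∀ w ∈ Metric.closedBall (hyp ε y + s) r, ‖F w‖ ≤ bound y

/-- Cauchy's theorem without closing the contour: the `s`-derivative of the integrand is `τ` times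
the `y`-derivative of `F` along the shifted contour, and a total derivative integrates to zero.
Cauchy estimates on discs of radius `r / 2` turn the bound on `F` into one on `deriv F`, which is
why domination is required on balls of radius `r`. -/
lemma hypIntegral_shift_hasDerivAt {ε r : ℝ} (hε : 0 ≤ ε) (hε1 : ε ≤ 1) (hr : 0 < r) {U : Set ℂ}
    (hU : IsOpen U) {F : ℂ → E} (hF : DifferentiableOn ℂ F U) {bound : ℝ → ℝ}
    (hb : Integrable bound) {s₀ τ : ℝ} (hτ : |τ| ≤ 1)
    (h : HypDominated ε r U F bound (τ * s₀)) [CompleteSpace E] :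
    HasDerivAt (fun s : ℝ => ∫ y : ℝ, hypDeriv ε y • F (hyp ε y + (τ * s : ℝ))) 0 s₀ := by
  have hcont := continuous_hyp ε
  have hcont' := continuous_hypDeriv ε
  have hmem : ∀ y, ∀ s : ℝ, |s - s₀| < r / 2 →
      Metric.closedBall (hyp ε y + (τ * s : ℝ)) (r / 2) ⊆
        Metric.closedBall (hyp ε y + (τ * s₀ : ℝ)) r := by
    intro y s hs
    apply Metric.closedBall_subset_closedBall'
    rw [dist_add_left, Complex.dist_eq, ← Complex.ofReal_sub, Complex.norm_real,
      Real.norm_eq_abs, ← mul_sub, abs_mul]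
    nlinarith [abs_nonneg (s - s₀), abs_nonneg τ]
  have hd : ∀ y, ∀ s : ℝ, |s - s₀| < r / 2 →
      DifferentiableAt ℂ F (hyp ε y + (τ * s : ℝ)) := fun y s hs =>
    hF.differentiableAt (hU.mem_nhds (h.subset y (hmem y s hs
      (Metric.mem_closedBall_self (by positivity)))))
  have hderivb : ∀ y, ∀ s : ℝ, |s - s₀| < r / 2 →
      ‖deriv F (hyp ε y + (τ * s : ℝ))‖ ≤ bound y / (r / 2) := by
    intro y s hs
    apply Complex.norm_deriv_le_of_forall_mem_sphere_norm_le (by positivity)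
    · refine DifferentiableOn.diffContOnCl ?_
      rw [closure_ball _ (by positivity)]
      exact hF.mono ((hmem y s hs).trans (h.subset y))
    · intro z hz
      exact h.le y z (hmem y s hs (Metric.sphere_subset_closedBall hz))
  have hFc : ∀ s : ℝ, |s - s₀| < r / 2 →
      Continuous fun y : ℝ => F (hyp ε y + (τ * s : ℝ)) := by
    intro s hs
    rw [continuous_iff_continuousAt]
    intro y
    exact ContinuousAt.comp (f := fun y : ℝ => hyp ε y + ((τ * s : ℝ) : ℂ))
      (hd y s hs).continuousAt (by fun_prop)
  have hF'c : ∀ s : ℝ, |s - s₀| < r / 2 →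
      Continuous fun y : ℝ => deriv F (hyp ε y + (τ * s : ℝ)) := by
    intro s hs
    rw [continuous_iff_continuousAt]
    intro y
    have := ((hF.analyticOnNhd hU) _ (h.subset y (hmem y s hs
      (Metric.mem_closedBall_self (by positivity))))).deriv.continuousAt
    exact ContinuousAt.comp (f := fun y : ℝ => hyp ε y + ((τ * s : ℝ) : ℂ)) this (by fun_prop)
  have hs₀ : |s₀ - s₀| < r / 2 := by simpa using hr
  have hball : Metric.ball s₀ (r / 2) ∈ 𝓝 s₀ := Metric.ball_mem_nhds _ (by positivity)
  have hFb : ∀ y, ∀ s : ℝ, |s - s₀| < r / 2 → ‖F (hyp ε y + (τ * s : ℝ))‖ ≤ bound y :=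
    fun y s hs => h.le y _ (hmem y s hs (Metric.mem_closedBall_self (by positivity)))
  have hFint : Integrable (fun y : ℝ => F (hyp ε y + (τ * s₀ : ℝ))) :=
    hb.mono' (hFc s₀ hs₀).aestronglyMeasurable (Eventually.of_forall fun y => hFb y s₀ hs₀)
  have key := hasDerivAt_integral_of_dominated_loc_of_deriv_le (μ := volume)
    (F := fun (s y : ℝ) => hypDeriv ε y • F (hyp ε y + (τ * s : ℝ)))
    (F' := fun (s y : ℝ) => hypDeriv ε y • ((τ : ℂ) • deriv F (hyp ε y + (τ * s : ℝ))))
    (bound := fun y => 2 * (1 * (bound y / (r / 2)))) hball ?_ ?_ ?_ ?_ ?_ ?_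
  · have hzero : ∫ y : ℝ, hypDeriv ε y • deriv F (hyp ε y + (τ * s₀ : ℝ)) = 0 := by
      apply integral_eq_zero_of_hasDerivAt_of_integrable
        (f := fun y => F (hyp ε y + (τ * s₀ : ℝ))) _ _ hFint
      · intro y
        have := (hd y s₀ hs₀).hasDerivAt.scomp y
          ((hasDerivAt_hyp ε y).add_const ((τ * s₀ : ℝ) : ℂ))
        exact this
      · refine ((hb.div_const (r / 2)).const_mul 2).mono'
          (hcont'.smul (hF'c s₀ hs₀)).aestronglyMeasurable (Eventually.of_forall fun y => ?_)
        rw [norm_smul]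
        exact mul_le_mul (norm_hypDeriv_le hε hε1 y) (hderivb y s₀ hs₀) (norm_nonneg _)
          (by norm_num)
    have h0 : ∫ y : ℝ, hypDeriv ε y • ((τ : ℂ) • deriv F (hyp ε y + (τ * s₀ : ℝ))) = 0 := by
      simp_rw [smul_comm _ (τ : ℂ)]
      rw [integral_smul, hzero, smul_zero]
    rw [← h0]
    exact key.2
  · filter_upwards [hball] with s hs
    exact (hcont'.smul (hFc s hs)).aestronglyMeasurable
  · refine (hb.const_mul 2).mono' (hcont'.smul (hFc s₀ hs₀)).aestronglyMeasurable
      (Eventually.of_forall fun y => ?_)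
    rw [norm_smul]
    exact mul_le_mul (norm_hypDeriv_le hε hε1 y) (hFb y s₀ hs₀) (norm_nonneg _) (by norm_num)
  · exact (hcont'.smul ((hF'c s₀ hs₀).const_smul (τ : ℂ))).aestronglyMeasurable
  · refine Eventually.of_forall fun y s hs => ?_
    rw [norm_smul, norm_smul, Complex.norm_real]
    exact mul_le_mul (norm_hypDeriv_le hε hε1 y) (mul_le_mul hτ (hderivb y s hs)
      (norm_nonneg _) zero_le_one) (by positivity) (by norm_num)
  · exact ((hb.div_const (r / 2)).const_mul 1).const_mul 2
  · refine Eventually.of_forall fun y s hs => ?_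
    have h1 : HasDerivAt (fun s : ℝ => hyp ε y + ((τ * s : ℝ) : ℂ)) (τ : ℂ) s := by
      have := (((hasDerivAt_id s).const_mul τ).ofReal_comp).const_add (hyp ε y)
      simpa using this
    have := ((hd y s hs).hasDerivAt.scomp s h1).const_smul (hypDeriv ε y)
    exact this

lemma hypIntegral_shift {ε r : ℝ} (hε : 0 ≤ ε) (hε1 : ε ≤ 1) (hr : 0 < r) {U : Set ℂ}
    (hU : IsOpen U) {F : ℂ → E} (hF : DifferentiableOn ℂ F U) {bound : ℝ → ℝ}
    (hb : Integrable bound) {τ S : ℝ} (hτ : |τ| ≤ 1) (hS : 0 ≤ S)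
    (h : ∀ s, 0 ≤ s → s ≤ S → HypDominated ε r U F bound (τ * s)) [CompleteSpace E] :
    hypIntegral ε F = ∫ y : ℝ, hypDeriv ε y • F (hyp ε y + (τ * S : ℝ)) := by
  have := Convex.norm_image_sub_le_of_norm_hasDerivWithin_le (𝕜 := ℝ)
    (f := fun s : ℝ => ∫ y : ℝ, hypDeriv ε y • F (hyp ε y + (τ * s : ℝ)))
    (f' := fun _ => 0) (s := Set.Icc 0 S) (x := 0) (y := S) (C := 0)
    (fun s hs => (hypIntegral_shift_hasDerivAt hε hε1 hr hU hF hb hτ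
      (h s hs.1 hs.2)).hasDerivWithinAt) (fun _ _ => by simp) (convex_Icc _ _)
    ⟨le_rfl, hS⟩ ⟨hS, le_rfl⟩
  rw [zero_mul, norm_le_zero_iff, sub_eq_zero] at this
  rw [this]
  simp [hypIntegral]

/-- The contour is pushed to infinity, to the right for `τ = 1` and to the left for `τ = -1`;
dominated convergence gives the limit zero. -/
lemma hypIntegral_eq_zero {ε r : ℝ} (hε : 0 ≤ ε) (hε1 : ε ≤ 1) (hr : 0 < r) {U : Set ℂ}
    (hU : IsOpen U) {F : ℂ → E} (hF : DifferentiableOn ℂ F U) {bound : ℝ → ℝ}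
    (hb : Integrable bound) {τ : ℝ} (hτ : |τ| ≤ 1)
    (h : ∀ s, 0 ≤ s → HypDominated ε r U F bound (τ * s))
    (hlim : ∀ y, Tendsto (fun s : ℝ => F (hyp ε y + (τ * s : ℝ))) atTop (𝓝 0))
    [CompleteSpace E] : hypIntegral ε F = 0 := by
  have hcont := continuous_hyp ε
  have hcont' := continuous_hypDeriv ε
  have key := tendsto_integral_filter_of_dominated_convergence (μ := volume) (l := atTop)
    (F := fun (s y : ℝ) => hypDeriv ε y • F (hyp ε y + (τ * s : ℝ))) (f := fun _ => (0 : E))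
    (fun y => 2 * bound y) ?_ ?_ (hb.const_mul 2) ?_
  · rw [integral_zero] at key
    refine tendsto_nhds_unique (tendsto_const_nhds.congr' ?_) key
    filter_upwards [eventually_ge_atTop 0] with S hS
    exact hypIntegral_shift hε hε1 hr hU hF hb hτ hS fun s h0 _ => h s h0
  · filter_upwards [eventually_ge_atTop 0] with s hs
    refine (hcont'.smul ?_).aestronglyMeasurable
    rw [continuous_iff_continuousAt]
    intro y
    exact ContinuousAt.comp (f := fun y : ℝ => hyp ε y + ((τ * s : ℝ) : ℂ))
      (hF.continuousOn.continuousAt (hU.mem_nhds ((h s hs).subset y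
        (Metric.mem_closedBall_self hr.le)))) (by fun_prop)
  · filter_upwards [eventually_ge_atTop 0] with s hs
    refine Eventually.of_forall fun y => ?_
    rw [norm_smul]
    exact mul_le_mul (norm_hypDeriv_le hε hε1 y) ((h s hs).le y _
      (Metric.mem_closedBall_self hr.le)) (norm_nonneg _) (by norm_num)
  · refine Eventually.of_forall fun y => ?_
    simpa using (hlim y).const_smul (hypDeriv ε y)

end

/-! ### Cauchy integrals with a pole at the origin, over hyperbolas passing to its left -/

section

/-- The region to the right of a slightly bent imaginary axis. -/
def region (k : ℝ) : Set ℂ := {z | -(k * (1 + ‖z‖)) < z.re}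

lemma isOpen_region (k : ℝ) : IsOpen (region k) :=
  isOpen_lt (by fun_prop) Complex.continuous_re

lemma zero_mem_region {k : ℝ} (hk : 0 < k) : (0 : ℂ) ∈ region k := by simp [region, hk]

lemma mem_region_of_re_nonneg {k : ℝ} (hk : 0 < k) {z : ℂ} (hz : 0 ≤ z.re) : z ∈ region k := by
  have : 0 < k * (1 + ‖z‖) := by positivity
  simp only [region, Set.mem_ofPred_eq]; linarith

/-- The contour uses half of the opening `k` and the ball another quarter, so all right shifts of
the thickened contour remain in the region. The second conclusion trades decay in `‖w‖` for decay in
`y`, uniformly in the shift. -/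
lemma mem_region_of_dist {k y s : ℝ} (hk : 0 < k) (hk1 : k ≤ 1) (hs : 0 ≤ s) {w : ℂ}
    (hw : w ∈ Metric.closedBall (hyp (k / 2) y + s) (k / 4)) :
    w ∈ region k ∧ 1 + |y| ≤ 2 * (1 + ‖w‖) := by
  rw [Metric.mem_closedBall, Complex.dist_eq] at hw
  have h1 := (Complex.abs_re_le_norm _).trans hw
  have h2 := (Complex.abs_im_le_norm _).trans hw
  simp only [Complex.sub_re, Complex.add_re, hyp_re, Complex.ofReal_re, Complex.sub_im,
    Complex.add_im, hyp_im, Complex.ofReal_im, add_zero] at h1 h2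
  have h3 := Complex.abs_im_le_norm w
  have h4 : |y| ≤ ‖w‖ + k / 4 := by
    have := abs_sub_abs_le_abs_sub y w.im
    rw [abs_sub_comm] at this
    linarith
  have h5 := jap_le y
  have h6 := (abs_le.1 h1).1
  constructor
  · simp only [region, Set.mem_ofPred_eq]
    nlinarith [norm_nonneg w, mul_le_mul_of_nonneg_left h5 hk.le,
      mul_le_mul_of_nonneg_left h4 hk.le]
  · linarith [norm_nonneg w]

lemma hyp_mem_region {k : ℝ} (hk : 0 < k) (hk1 : k ≤ 1) (y : ℝ) : hyp (k / 2) y ∈ region k := by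
  have := mem_region_of_dist (y := y) hk hk1 le_rfl
    (w := hyp (k / 2) y) (by simp; positivity)
  exact this.1

lemma one_add_abs_le_norm_hyp (ε y : ℝ) : 1 + |y| ≤ 1 + ‖hyp ε y‖ := by
  have := Complex.abs_im_le_norm (hyp ε y)
  rw [hyp_im] at this
  linarith

variable {E : Type*} [NormedAddCommGroup E] [NormedSpace ℂ E]

/-- The pole lies to the right of the contour, and pushing the contour to the left makes the
exponential decay. -/
lemma hypIntegral_exp_div {ε σ : ℝ} (hε : 0 < ε) (hε1 : ε ≤ 1) (hσ : 0 < σ) :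
    hypIntegral ε (fun z : ℂ => Complex.exp (σ * z) / z) = 0 := by
  have hre : ∀ y s : ℝ, 0 ≤ s → ∀ w ∈ Metric.closedBall (hyp ε y + ((-1 * s : ℝ) : ℂ)) (ε / 2),
      w.re ≤ -(ε * jap y) - s + ε / 2 := by
    intro y s hs w hw
    rw [Metric.mem_closedBall, Complex.dist_eq] at hw
    have h1 := (abs_le.1 ((Complex.abs_re_le_norm _).trans hw)).2
    simp only [Complex.sub_re, Complex.add_re, hyp_re, Complex.ofReal_re] at h1
    linarith
  refine hypIntegral_eq_zero (τ := -1) (r := ε / 2) hε.le hε1 (by positivity)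
    (U := {z | z.re < 0}) (isOpen_lt Complex.continuous_re continuous_const) ?_
    (bound := fun y => Real.exp (σ * (ε / 2)) * Real.exp (-((σ * ε) * jap y)) / (ε / 2))
    (((integrable_exp_neg_mul_jap (mul_pos hσ hε)).const_mul _).div_const _) (by norm_num) ?_ ?_
  · intro z hz
    have : z ≠ 0 := by rintro rfl; simp at hz
    exact DifferentiableAt.differentiableWithinAt (by fun_prop (disch := assumption))
  · intro s hs
    constructor
    · intro y w hw
      have := hre y s hs w hw
      have h2 := mul_le_mul_of_nonneg_left (one_le_jap y) hε.le
      simp only [Set.mem_ofPred_eq]; linarith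
    · intro y w hw
      have h1 := hre y s hs w hw
      have h2 := mul_le_mul_of_nonneg_left (one_le_jap y) hε.le
      have h3 : ε / 2 ≤ ‖w‖ := by
        have := Complex.abs_re_le_norm w
        rw [abs_of_neg (by linarith)] at this
        linarith
      rw [norm_div, Complex.norm_exp, ← Real.exp_add]
      gcongr
      simp only [Complex.mul_re, Complex.ofReal_re, Complex.ofReal_im, zero_mul, sub_zero]
      nlinarith
  · intro y
    rw [tendsto_zero_iff_norm_tendsto_zero]
    have hl : Tendsto (fun s : ℝ => Real.exp (-(σ * s)) * ε⁻¹) atTop (𝓝 0) := by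
      rw [← zero_mul ε⁻¹]
      refine Tendsto.mul_const _ (Real.tendsto_exp_neg_atTop_nhds_zero.comp ?_)
      exact tendsto_id.const_mul_atTop hσ
    refine squeeze_zero' (Eventually.of_forall fun _ => norm_nonneg _) ?_ hl
    filter_upwards [eventually_ge_atTop 0] with s hs
    have h2 := mul_le_mul_of_nonneg_left (one_le_jap y) hε.le
    have hr : (hyp ε y + ((-1 * s : ℝ) : ℂ)).re = -(ε * jap y) - s := by
      simp only [Complex.add_re, hyp_re, Complex.ofReal_re]; ring
    have h3 : ε ≤ ‖hyp ε y + ((-1 * s : ℝ) : ℂ)‖ := by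
      have := Complex.abs_re_le_norm (hyp ε y + ((-1 * s : ℝ) : ℂ))
      rw [hr, abs_of_neg (by linarith)] at this
      linarith
    rw [norm_div, Complex.norm_exp, div_eq_mul_inv]
    gcongr
    simp only [Complex.mul_re, Complex.ofReal_re, Complex.ofReal_im, zero_mul, sub_zero, hr]
    nlinarith

lemma le_norm_hyp_add_one {ε : ℝ} (hε : 0 < ε) (hε1 : ε < 1) (y : ℝ) :
    (1 - ε) * jap y ≤ ‖hyp ε y + 1‖ := by
  have h1 : ‖hyp ε y + 1‖ ^ 2 = (1 - ε * jap y) ^ 2 + y ^ 2 := by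
    rw [← Complex.normSq_eq_norm_sq, Complex.normSq_apply]
    simp; ring
  refine le_of_sq_le_sq ?_ (norm_nonneg _)
  rw [h1]
  nlinarith [jap_sq y, one_le_jap y, mul_le_mul_of_nonneg_left (one_le_jap y) hε.le]

lemma integrable_hyp_inv_mul_inv {ε : ℝ} (hε : 0 < ε) (hε1 : ε < 1) :
    Integrable fun y : ℝ => hypDeriv ε y * ((hyp ε y)⁻¹ * (hyp ε y + 1)⁻¹) := by
  have hc := continuous_hyp ε
  have hc' := continuous_hypDeriv ε
  have h0 := hyp_ne_zero hε
  have h1 : ∀ y, hyp ε y + 1 ≠ 0 := fun y => norm_pos_iff.1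
    ((mul_pos (by linarith) (jap_pos y)).trans_le (le_norm_hyp_add_one hε hε1 y))
  refine (integrable_one_add_abs_inv_sq.const_mul (2 * (4 * (ε * (1 - ε))⁻¹))).mono'
    (Continuous.aestronglyMeasurable ?_) (Eventually.of_forall fun y => ?_)
  · exact hc'.mul ((hc.inv₀ h0).mul ((hc.add continuous_const).inv₀ h1))
  · rw [norm_mul, norm_mul, norm_inv, norm_inv, mul_assoc]
    refine mul_le_mul (norm_hypDeriv_le hε.le hε1.le y) ?_ (by positivity) (by norm_num)
    have ha := le_norm_hyp hε.le y
    have hb := le_norm_hyp_add_one hε hε1 y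
    have hj := jap_pos y
    have h2 := le_two_mul_jap y
    have h3 : 0 < 1 - ε := by linarith
    have h5 : 0 < 1 + |y| := by positivity
    calc ‖hyp ε y‖⁻¹ * ‖hyp ε y + 1‖⁻¹ ≤ (ε * jap y)⁻¹ * ((1 - ε) * jap y)⁻¹ := by gcongr
      _ = (ε * (1 - ε))⁻¹ * (jap y ^ 2)⁻¹ := by field_simp
      _ ≤ (ε * (1 - ε))⁻¹ * (((1 + |y|) / 2) ^ 2)⁻¹ := by gcongr; linarith
      _ = _ := by field_simp; norm_num

/-- A primitive is `log (-z / (z + 1))`, written with `-1 + (z + 1)⁻¹`. Along the contour its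
argument stays in the slit plane and tends to `-1` at both ends, from opposite sides of the cut, so
the logarithm runs from `πi` to `-πi`. -/
lemma hypIntegral_inv_mul_inv {ε : ℝ} (hε : 0 < ε) (hε1 : ε < 1) :
    hypIntegral ε (fun z : ℂ => z⁻¹ * (z + 1)⁻¹) = -(2 * Real.pi * Complex.I) := by
  have h0 := hyp_ne_zero hε
  have h1 : ∀ y, hyp ε y + 1 ≠ 0 := fun y => norm_pos_iff.1
    ((mul_pos (by linarith) (jap_pos y)).trans_le (le_norm_hyp_add_one hε hε1 y))
  have him : ∀ y, (-1 + (hyp ε y + 1)⁻¹).im = -y / Complex.normSq (hyp ε y + 1) := by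
    intro y; simp [Complex.inv_im]
  have hns : ∀ y, 0 < Complex.normSq (hyp ε y + 1) := fun y => Complex.normSq_pos.2 (h1 y)
  have hslit : ∀ y, -1 + (hyp ε y + 1)⁻¹ ∈ Complex.slitPlane := by
    intro y
    by_cases hy : y = 0
    · left
      subst hy
      have : hyp ε 0 = ((-ε : ℝ) : ℂ) := by simp [hyp, jap]
      rw [this]
      have : (-1 + (((-ε : ℝ) : ℂ) + 1)⁻¹) = ((-1 + (-ε + 1)⁻¹ : ℝ) : ℂ) := by push_cast; ring
      rw [this, Complex.ofReal_re]
      have : 1 < (-ε + 1)⁻¹ := (one_lt_inv₀ (by linarith)).2 (by linarith)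
      linarith
    · right
      rw [him]
      exact div_ne_zero (neg_ne_zero.2 hy) (hns y).ne'
  have hd : ∀ y, HasDerivAt (fun y => Complex.log (-1 + (hyp ε y + 1)⁻¹))
      (hypDeriv ε y * ((hyp ε y)⁻¹ * (hyp ε y + 1)⁻¹)) y := by
    intro y
    have h2 := (((hasDerivAt_hyp ε y).add_const (1 : ℂ)).fun_inv (h1 y)).const_add (-1)
    refine (h2.clog_real (hslit y)).congr_deriv ?_
    have h3 : -1 + (hyp ε y + 1)⁻¹ = -(hyp ε y) * (hyp ε y + 1)⁻¹ := by
      field_simp [h1 y]; ring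
    rw [h3]
    field_simp [h1 y, h0 y]
  have hinv : ∀ l : Filter ℝ, Tendsto (fun y : ℝ => |y|) l atTop →
      Tendsto (fun y => -1 + (hyp ε y + 1)⁻¹) l (𝓝 (-1)) := by
    intro l hl
    have : Tendsto (fun y => ‖hyp ε y + 1‖) l atTop := by
      refine tendsto_atTop_mono (fun y => ?_) hl
      have := Complex.abs_im_le_norm (hyp ε y + 1)
      simpa using this
    have h3 := tendsto_inv₀_cobounded.comp (tendsto_norm_atTop_iff_cobounded.1 this)
    simpa using h3.const_add (-1)
  have e1 := Complex.tendsto_log_nhdsWithin_im_neg_of_re_neg_of_im_zero (z := -1) (by simp) (by simp)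
  have e2 := Complex.tendsto_log_nhdsWithin_im_nonneg_of_re_neg_of_im_zero (z := -1) (by simp)
    (by simp)
  have top : Tendsto (fun y => Complex.log (-1 + (hyp ε y + 1)⁻¹)) atTop
      (𝓝 (-(Real.pi * Complex.I))) := by
    have h := e1.comp (tendsto_nhdsWithin_iff.2 ⟨hinv atTop tendsto_abs_atTop_atTop, ?_⟩)
    · simpa [Function.comp_def] using h
    · filter_upwards [eventually_gt_atTop 0] with y hy
      rw [him]
      exact div_neg_of_neg_of_pos (by linarith) (hns y)
  have bot : Tendsto (fun y => Complex.log (-1 + (hyp ε y + 1)⁻¹)) atBot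
      (𝓝 (Real.pi * Complex.I)) := by
    have h := e2.comp (tendsto_nhdsWithin_iff.2 ⟨hinv atBot tendsto_abs_atBot_atTop, ?_⟩)
    · simpa [Function.comp_def] using h
    · filter_upwards [eventually_le_atBot 0] with y hy
      rw [him]
      exact div_nonneg (by linarith) (hns y).le
  have := integral_of_hasDerivAt_of_tendsto hd (integrable_hyp_inv_mul_inv hε hε1) bot top
  rw [hypIntegral]
  simp only [smul_eq_mul]
  rw [this]; ring

lemma norm_add_one_ge_of_mem_region {k : ℝ} (hk1 : k ≤ 1 / 4) {w : ℂ}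
    (hw : w ∈ region k) : (1 + ‖w‖) / 3 ≤ ‖w + 1‖ := by
  have h1 : ‖w + 1‖ ^ 2 = ‖w‖ ^ 2 + 2 * w.re + 1 := by
    rw [← Complex.normSq_eq_norm_sq, ← Complex.normSq_eq_norm_sq, Complex.normSq_apply,
      Complex.normSq_apply]
    simp; ring
  refine le_of_sq_le_sq ?_ (norm_nonneg _)
  simp only [region, Set.mem_ofPred_eq] at hw
  rw [h1]
  have hn := norm_nonneg w
  nlinarith [sq_nonneg (‖w‖ - 1 / 2)]

lemma one_add_norm_rpow_le {y a : ℝ} (ha : 0 ≤ a) {w : ℂ} (h : 1 + |y| ≤ 2 * (1 + ‖w‖)) :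
    (1 + ‖w‖) ^ (-a) ≤ 2 ^ a * (1 + |y|) ^ (-a) := by
  have h1 : 0 < 1 + |y| := by positivity
  have h2 : (0 : ℝ) < 1 + ‖w‖ := by positivity
  rw [Real.rpow_neg h2.le, Real.rpow_neg h1.le, ← div_eq_mul_inv, inv_eq_one_div,
    div_le_div_iff₀ (by positivity) (by positivity), one_mul, ← Real.mul_rpow (by norm_num) h2.le]
  exact Real.rpow_le_rpow h1.le h ha

/-- A residue computation in which the slow decay of `Q` must be respected. Subtracting `(z + 1)⁻¹ •
Q 0`, rather than the constant `Q 0`, cancels the pole at the origin and keeps the decay; the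
quotient by `z` then decays with exponent `1 + γ > 1` and its integral vanishes by a push to the
right. The subtracted part is `hypIntegral_inv_mul_inv`. -/
lemma hypIntegral_inv_smul [CompleteSpace E] {k γ M : ℝ} (hk : 0 < k) (hk1 : k ≤ 1 / 4)
    (hγ : 0 < γ) (hγ1 : γ ≤ 1) {Q : ℂ → E} (hQ : DifferentiableOn ℂ Q (region k))
    (hM : ∀ z ∈ region k, ‖Q z‖ ≤ M * (1 + ‖z‖) ^ (-γ)) :
    Integrable (fun y => hypDeriv (k / 2) y • (hyp (k / 2) y)⁻¹ • Q (hyp (k / 2) y)) ∧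
    hypIntegral (k / 2) (fun z => z⁻¹ • Q z) = -(2 * Real.pi * Complex.I) • Q 0 := by
  have hε : 0 < k / 2 := by positivity
  have hε1 : k / 2 < 1 := by linarith
  have hM0 : 0 ≤ M := by
    have := (norm_nonneg _).trans (hM 0 (zero_mem_region hk))
    simpa using this
  have hne : ∀ z ∈ region k, z + 1 ≠ 0 := fun z hz => norm_pos_iff.1
    (lt_of_lt_of_le (by positivity) (norm_add_one_ge_of_mem_region hk1 hz))
  set H : ℂ → E := fun z => Q z - (z + 1)⁻¹ • Q 0 with hH
  have hHd : DifferentiableOn ℂ H (region k) := by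
    refine hQ.sub (DifferentiableOn.smul_const ?_ _)
    exact DifferentiableOn.inv (by fun_prop) hne
  -- `dslope H 0` is `H z / z` with the removable singularity at the origin filled in.
  have hFd : DifferentiableOn ℂ (dslope H 0) (region k) :=
    (Complex.differentiableOn_dslope ((isOpen_region k).mem_nhds (zero_mem_region hk))).2 hHd
  have hH0 : H 0 = 0 := by simp [hH]
  have hF : ∀ z, z ≠ 0 → dslope H 0 z = z⁻¹ • H z := by
    intro z hz
    rw [dslope_of_ne _ hz, slope_def_module, hH0]; simp
  have hsmall : Metric.closedBall (0 : ℂ) (k / 2) ⊆ region k := by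
    intro w hw
    have h1 : ‖w‖ ≤ k / 2 := by simpa using hw
    have h2 := (abs_le.1 ((Complex.abs_re_le_norm w).trans h1)).1
    simp only [region, Set.mem_ofPred_eq]
    nlinarith [norm_nonneg w]
  obtain ⟨C₀, hC₀⟩ := (isCompact_closedBall (0 : ℂ) (k / 2)).exists_bound_of_continuousOn
    (hFd.continuousOn.mono hsmall)
  have hHb : ∀ w ∈ region k, ‖H w‖ ≤ (M + 3 * ‖Q 0‖) * (1 + ‖w‖) ^ (-γ) := by
    intro w hw
    have h1 := norm_add_one_ge_of_mem_region hk1 hw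
    have h2 : (0 : ℝ) < 1 + ‖w‖ := by positivity
    have h3 : ‖w + 1‖⁻¹ ≤ 3 * (1 + ‖w‖) ^ (-γ) := by
      calc ‖w + 1‖⁻¹ ≤ ((1 + ‖w‖) / 3)⁻¹ := by gcongr
        _ = 3 * (1 + ‖w‖) ^ (-1 : ℝ) := by rw [Real.rpow_neg_one]; field_simp
        _ ≤ _ := by
          gcongr
          linarith [norm_nonneg w]
    calc ‖H w‖ ≤ ‖Q w‖ + ‖(w + 1)⁻¹ • Q 0‖ := norm_sub_le _ _
      _ ≤ M * (1 + ‖w‖) ^ (-γ) + 3 * (1 + ‖w‖) ^ (-γ) * ‖Q 0‖ := by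
        rw [norm_smul, norm_inv]
        gcongr
        exact hM w hw
      _ = _ := by ring
  obtain ⟨C, hC0, hC⟩ : ∃ C, 0 ≤ C ∧ ∀ w ∈ region k,
      ‖dslope H 0 w‖ ≤ C * (1 + ‖w‖) ^ (-(1 + γ)) := by
    refine ⟨|C₀| * 2 ^ (1 + γ) + (M + 3 * ‖Q 0‖) * (2 / k + 1), by positivity, fun w hw => ?_⟩
    have h2 : (0 : ℝ) < 1 + ‖w‖ := by positivity
    have hp : 0 < (1 + ‖w‖) ^ (-(1 + γ)) := by positivity
    rw [add_mul]
    by_cases hwk : ‖w‖ ≤ k / 2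
    · refine le_add_of_le_of_nonneg ?_ (by positivity)
      refine (hC₀ w (by simpa using hwk)).trans ((le_abs_self _).trans ?_)
      rw [mul_assoc]
      refine le_mul_of_one_le_right (abs_nonneg _) ?_
      rw [Real.rpow_neg h2.le, ← div_eq_mul_inv, one_le_div (by positivity)]
      exact Real.rpow_le_rpow h2.le (by linarith) (by linarith)
    · push Not at hwk
      refine le_add_of_nonneg_of_le (by positivity) ?_
      have hw0 : w ≠ 0 := norm_pos_iff.1 (hε.trans hwk)
      rw [hF w hw0, norm_smul, norm_inv]
      have h3 : ‖w‖⁻¹ ≤ (2 / k + 1) * (1 + ‖w‖) ^ (-1 : ℝ) := by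
        rw [Real.rpow_neg_one, ← div_eq_mul_inv, inv_eq_one_div,
          div_le_div_iff₀ (by linarith) h2]
        have h4 : 1 ≤ 2 / k * ‖w‖ := by
          rw [div_mul_eq_mul_div, one_le_div hk]; linarith
        linarith
      calc ‖w‖⁻¹ * ‖H w‖ ≤ ((2 / k + 1) * (1 + ‖w‖) ^ (-1 : ℝ)) *
            ((M + 3 * ‖Q 0‖) * (1 + ‖w‖) ^ (-γ)) := by
              gcongr
              exact hHb w hw
        _ = (M + 3 * ‖Q 0‖) * (2 / k + 1) * ((1 + ‖w‖) ^ (-1 : ℝ) * (1 + ‖w‖) ^ (-γ)) := by ring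
        _ = _ := by rw [← Real.rpow_add h2]; congr 2; ring
  have hbi : Integrable fun y : ℝ => C * (2 ^ (1 + γ) * (1 + |y|) ^ (-(1 + γ))) :=
    ((integrable_one_add_abs_rpow (by linarith)).const_mul _).const_mul _
  have hdom : ∀ s, 0 ≤ s → HypDominated (k / 2) (k / 4) (region k) (dslope H 0)
      (fun y : ℝ => C * (2 ^ (1 + γ) * (1 + |y|) ^ (-(1 + γ)))) (1 * s) := by
    intro s hs
    rw [one_mul]
    refine ⟨fun y w hw => (mem_region_of_dist hk (by linarith) hs hw).1, fun y w hw => ?_⟩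
    obtain ⟨h1, h2⟩ := mem_region_of_dist hk (by linarith) hs hw
    refine (hC w h1).trans ?_
    gcongr
    exact one_add_norm_rpow_le (by linarith) h2
  have hzero : hypIntegral (k / 2) (dslope H 0) = 0 := by
    refine hypIntegral_eq_zero (τ := 1) hε.le hε1.le (by positivity) (isOpen_region k) hFd hbi
      (by norm_num) hdom ?_
    intro y
    have hn : Tendsto (fun s : ℝ => 1 + ‖hyp (k / 2) y + ((1 * s : ℝ) : ℂ)‖) atTop atTop := by
      have : Tendsto (fun s : ℝ => s - (k / 2 * jap y)) atTop atTop :=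
        tendsto_atTop_add_const_right _ _ tendsto_id
      refine tendsto_atTop_mono (fun s => ?_) this
      have := (le_abs_self _).trans (Complex.abs_re_le_norm (hyp (k / 2) y + ((1 * s : ℝ) : ℂ)))
      simp only [Complex.add_re, hyp_re, Complex.ofReal_re] at this
      linarith
    have h1 := ((tendsto_rpow_neg_atTop (y := 1 + γ) (by linarith)).comp hn).const_mul C
    rw [mul_zero] at h1
    refine squeeze_zero_norm' ?_ h1
    filter_upwards [eventually_ge_atTop 0] with s hs
    exact hC _ ((hdom s hs).subset y (Metric.mem_closedBall_self (by positivity)))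
  have hcH : Continuous fun y => dslope H 0 (hyp (k / 2) y) := by
    rw [continuous_iff_continuousAt]
    intro y
    exact ContinuousAt.comp (f := hyp (k / 2))
      (hFd.continuousOn.continuousAt ((isOpen_region k).mem_nhds
        (hyp_mem_region hk (by linarith) y))) (continuous_hyp _).continuousAt
  have hint1 : Integrable fun y => hypDeriv (k / 2) y • dslope H 0 (hyp (k / 2) y) := by
    refine (hbi.const_mul 2).mono' ((continuous_hypDeriv _).smul hcH).aestronglyMeasurable
      (Eventually.of_forall fun y => ?_)
    rw [norm_smul]
    refine mul_le_mul (norm_hypDeriv_le hε.le hε1.le y) ?_ (norm_nonneg _) (by norm_num)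
    exact (hdom 0 le_rfl).le y _ (by simp; positivity)
  have hint2 := (integrable_hyp_inv_mul_inv hε hε1).smul_const (Q 0)
  have heq : ∀ y, hypDeriv (k / 2) y • (hyp (k / 2) y)⁻¹ • Q (hyp (k / 2) y) =
      hypDeriv (k / 2) y • dslope H 0 (hyp (k / 2) y) +
      (hypDeriv (k / 2) y * ((hyp (k / 2) y)⁻¹ * (hyp (k / 2) y + 1)⁻¹)) • Q 0 := by
    intro y
    rw [hF _ (hyp_ne_zero hε y), hH]
    simp only [smul_sub, smul_smul]
    abel
  constructor
  · simp_rw [heq]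
    exact hint1.add hint2
  · rw [hypIntegral]
    simp_rw [heq]
    rw [integral_add hint1 hint2, integral_smul_const]
    have h1 := hypIntegral_inv_mul_inv hε hε1
    rw [hypIntegral] at h1 hzero
    simp only [smul_eq_mul] at h1
    rw [hzero, h1, zero_add]

end

/-! ### Exponential convolutions and the variation of constants formula -/

section

variable {E : Type*} [NormedAddCommGroup E] [NormedSpace ℂ E]

lemma norm_cexp_mul_hyp (ε σ y : ℝ) :
    ‖Complex.exp (σ * hyp ε y)‖ = Real.exp (-(σ * ε * jap y)) := by
  rw [Complex.norm_exp]
  simp only [Complex.mul_re, Complex.ofReal_re, Complex.ofReal_im, zero_mul, sub_zero, hyp_re]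
  congr 1; ring

lemma integral_exp_neg_mul_sub_le {a t : ℝ} (ha : 0 < a) :
    ∫ s in (0 : ℝ)..t, Real.exp (-(a * (t - s))) ≤ a⁻¹ := by
  have hd : ∀ s ∈ Set.uIcc 0 t, HasDerivAt (fun s => a⁻¹ * Real.exp (-(a * (t - s))))
      (Real.exp (-(a * (t - s)))) s := by
    intro s _
    have h1 : HasDerivAt (fun s : ℝ => -(a * (t - s))) a s := by
      have := (((hasDerivAt_id s).const_sub t).const_mul a).fun_neg
      simpa using this
    refine (h1.exp.const_mul a⁻¹).congr_deriv ?_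
    field_simp
  rw [intervalIntegral.integral_eq_sub_of_hasDerivAt hd
    (Continuous.intervalIntegrable (by fun_prop) _ _)]
  have : 0 < a⁻¹ * Real.exp (-(a * (t - 0))) := by positivity
  simp only [sub_self, mul_zero, neg_zero, Real.exp_zero, mul_one] at this ⊢
  linarith

/-- The exponential convolution `∫₀ᵗ exp ((t - s) z) h(s) ds`. -/
def expConv (h : ℝ → E) (t : ℝ) (z : ℂ) : E :=
  ∫ s in (0 : ℝ)..t, Complex.exp ((t - s : ℝ) * z) • h s

/-- Integrating the exponential in time gains a factor `1 / jap y`, uniformly in `t`. Together with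
the decay `γ > 0` of the resolvent this makes the contour integral of a convolution converge. -/
lemma norm_expConv_hyp_le {ε t H : ℝ} (hε : 0 < ε) (ht : 0 ≤ t) {h : ℝ → E}
    (hH : ∀ s ∈ Set.Icc 0 t, ‖h s‖ ≤ H) (y : ℝ) :
    ‖expConv h t (hyp ε y)‖ ≤ (ε * jap y)⁻¹ * H := by
  have hH0 : 0 ≤ H := (norm_nonneg _).trans (hH 0 ⟨le_rfl, ht⟩)
  have h1 : ‖expConv h t (hyp ε y)‖ ≤
      ∫ s in (0 : ℝ)..t, Real.exp (-(ε * jap y * (t - s))) * H := by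
    refine intervalIntegral.norm_integral_le_of_norm_le ht ?_
      (Continuous.intervalIntegrable (by fun_prop) _ _)
    refine Eventually.of_forall fun s hs => ?_
    rw [norm_smul, norm_cexp_mul_hyp]
    refine mul_le_mul (le_of_eq (by congr 1; ring)) (hH s ⟨hs.1.le, hs.2⟩) (norm_nonneg _)
      (Real.exp_pos _).le
  refine h1.trans ?_
  rw [intervalIntegral.integral_mul_const]
  gcongr
  exact integral_exp_neg_mul_sub_le (mul_pos hε (jap_pos y))

lemma intervalIntegrable_fun_smul {g : ℝ → E} {a b : ℝ} (h : IntervalIntegrable g volume a b)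
    (z : ℂ) : IntervalIntegrable (fun s => z • g s) volume a b := h.smul z

/-- Integration by parts in time. -/
lemma mul_expConv [CompleteSpace E] {t : ℝ} (ht : 0 ≤ t) {p p' : ℝ → E}
    (hp : ∀ s ∈ Set.Icc 0 t, HasDerivAt p (p' s) s) (hp' : ContinuousOn p' (Set.Icc 0 t)) (z : ℂ) :
    z • expConv p t z = -p t + Complex.exp (t * z) • p 0 + expConv p' t z := by
  have hpc : ContinuousOn p (Set.Icc 0 t) := fun s hs => (hp s hs).continuousAt.continuousWithinAt
  have he : Continuous fun s : ℝ => Complex.exp ((t - s : ℝ) * z) := by fun_prop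
  have i1 : IntervalIntegrable (fun s : ℝ => Complex.exp ((t - s : ℝ) * z) • p s) volume 0 t :=
    ContinuousOn.intervalIntegrable (by rw [Set.uIcc_of_le ht]; exact he.continuousOn.smul hpc)
  have i2 : IntervalIntegrable (fun s : ℝ => Complex.exp ((t - s : ℝ) * z) • p' s) volume 0 t :=
    ContinuousOn.intervalIntegrable (by rw [Set.uIcc_of_le ht]; exact he.continuousOn.smul hp')
  have hd : ∀ s ∈ Set.uIcc 0 t, HasDerivAt (fun s : ℝ => Complex.exp ((t - s : ℝ) * z) • p s)
      (Complex.exp ((t - s : ℝ) * z) • p' s - z • Complex.exp ((t - s : ℝ) * z) • p s) s := by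
    intro s hs
    rw [Set.uIcc_of_le ht] at hs
    have h1 : HasDerivAt (fun s : ℝ => ((t - s : ℝ) : ℂ) * z) (-z) s := by
      have := (((hasDerivAt_id s).const_sub t).ofReal_comp).mul_const z
      simpa using this
    refine (h1.cexp.smul (hp s hs)).congr_deriv ?_
    rw [smul_smul, mul_neg, neg_smul, mul_comm z (Complex.exp _), ← sub_eq_add_neg]
  have := intervalIntegral.integral_eq_sub_of_hasDerivAt hd (i2.sub (intervalIntegrable_fun_smul i1 z))
  rw [intervalIntegral.integral_sub i2 (intervalIntegrable_fun_smul i1 z), intervalIntegral.integral_smul] at this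
  simp only [sub_self, Complex.ofReal_zero, zero_mul, Complex.exp_zero, one_smul, sub_zero] at this
  rw [expConv, expConv]
  rw [sub_eq_iff_eq_add] at this
  rw [this]; abel

lemma continuous_expConv_hyp {ε t : ℝ} (ht : 0 ≤ t) {h : ℝ → E}
    (hh : ContinuousOn h (Set.Icc 0 t)) : Continuous fun y => expConv h t (hyp ε y) := by
  set g : ℝ → E := Set.IccExtend ht ((Set.Icc 0 t).domRestrict h) with hg
  have hgc : Continuous g := (continuousOn_iff_continuous_domRestrict.1 hh).Icc_extend'
  have : (fun y => expConv h t (hyp ε y)) = fun y => ∫ s in (0 : ℝ)..t,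
      Complex.exp ((t - s : ℝ) * hyp ε y) • g s := by
    funext y
    refine intervalIntegral.integral_congr fun s hs => ?_
    rw [Set.uIcc_of_le ht] at hs
    simp only [hg, Set.IccExtend_of_mem ht _ hs, Set.domRestrict_apply]
  rw [this]
  have hc := continuous_hyp ε
  exact intervalIntegral.continuous_parametric_intervalIntegral_of_continuous' (by fun_prop) 0 t

/-- By Fubini, the inner contour integral at a time `s < t` is `hypIntegral_exp_div` with `σ = t -
s`, and `s = t` is a null set. Absolute integrability comes from one factor `1 / jap y` of the time
integral and one of `z⁻¹`. -/
lemma hypIntegral_inv_smul_expConv [CompleteSpace E] {ε t : ℝ} (hε : 0 < ε) (hε1 : ε ≤ 1)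
    (ht : 0 < t) {q : ℝ → E} (hq : ContinuousOn q (Set.Icc 0 t)) :
    Integrable (fun y => hypDeriv ε y • (hyp ε y)⁻¹ • expConv q t (hyp ε y)) ∧
    hypIntegral ε (fun z => z⁻¹ • expConv q t z) = 0 := by
  obtain ⟨B, hB⟩ := isCompact_Icc.exists_bound_of_continuousOn hq
  have hB0 : 0 ≤ B := (norm_nonneg _).trans (hB 0 ⟨le_rfl, ht.le⟩)
  have hc := continuous_hyp ε
  have hc' := continuous_hypDeriv ε
  have hinv : Continuous fun y => (hyp ε y)⁻¹ := hc.inv₀ (hyp_ne_zero hε)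
  set K : ℝ → ℝ → E := fun y s =>
    hypDeriv ε y • (hyp ε y)⁻¹ • Complex.exp ((t - s : ℝ) * hyp ε y) • q s with hK
  have hpt : ∀ y s, s ∈ Set.Icc 0 t →
      ‖K y s‖ ≤ (2 * (ε * jap y)⁻¹ * B) * Real.exp (-(ε * jap y * (t - s))) := by
    intro y s hs
    have h1 := le_norm_hyp hε.le y
    have h2 := mul_pos hε (jap_pos y)
    rw [hK]
    simp only [norm_smul, norm_inv]
    rw [norm_cexp_mul_hyp]
    calc _ ≤ 2 * ((ε * jap y)⁻¹ * (Real.exp (-((t - s) * ε * jap y)) * B)) := by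
          gcongr
          · exact norm_hypDeriv_le hε.le hε1 y
          · exact hB s hs
      _ = _ := by rw [show (t - s) * ε * jap y = ε * jap y * (t - s) by ring]; ring
  have hmeas : AEStronglyMeasurable (Function.uncurry K)
      (volume.prod (volume.restrict (Set.Ioc 0 t))) := by
    have : (volume.prod (volume.restrict (Set.Ioc 0 t)) : Measure (ℝ × ℝ)) =
        (volume.prod volume).restrict (Set.univ ×ˢ Set.Ioc 0 t) := by
      rw [← Measure.prod_restrict, Measure.restrict_univ]
    rw [this]
    refine ContinuousOn.aestronglyMeasurable ?_ (MeasurableSet.univ.prod measurableSet_Ioc)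
    have hqq : ContinuousOn (fun x : ℝ × ℝ => q x.2) (Set.univ ×ˢ Set.Ioc 0 t) :=
      hq.comp continuousOn_snd fun x hx => Set.Ioc_subset_Icc_self hx.2
    have c1 : Continuous fun x : ℝ × ℝ => hypDeriv ε x.1 := by fun_prop
    have c2 : Continuous fun x : ℝ × ℝ => (hyp ε x.1)⁻¹ := hinv.comp continuous_fst
    have c3 : Continuous fun x : ℝ × ℝ => Complex.exp ((t - x.2 : ℝ) * hyp ε x.1) := by fun_prop
    exact c1.continuousOn.smul (c2.continuousOn.smul (c3.continuousOn.smul hqq))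
  have hKint : ∀ y, IntegrableOn (K y) (Set.Ioc 0 t) := by
    intro y
    refine IntegrableOn.mono_set (ContinuousOn.integrableOn_Icc ?_) Set.Ioc_subset_Icc_self
    have : Continuous fun s : ℝ => Complex.exp ((t - s : ℝ) * hyp ε y) := by fun_prop
    exact continuousOn_const.smul (continuousOn_const.smul (this.continuousOn.smul hq))
  have hprod : Integrable (Function.uncurry K) (volume.prod (volume.restrict (Set.Ioc 0 t))) := by
    rw [integrable_prod_iff hmeas]
    refine ⟨Eventually.of_forall hKint, ?_⟩
    refine (integrable_one_add_abs_inv_sq.const_mul (8 * B * (ε ^ 2)⁻¹)).mono'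
      hmeas.norm.integral_prod_right' (Eventually.of_forall fun y => ?_)
    rw [Real.norm_of_nonneg (integral_nonneg fun _ => norm_nonneg _)]
    have h1 : ∫ s in Set.Ioc 0 t, ‖K y s‖ ≤
        ∫ s in Set.Ioc 0 t, (2 * (ε * jap y)⁻¹ * B) * Real.exp (-(ε * jap y * (t - s))) := by
      refine setIntegral_mono_on (hKint y).norm ?_ measurableSet_Ioc
        fun s hs => hpt y s (Set.Ioc_subset_Icc_self hs)
      exact (Continuous.integrableOn_Icc (by fun_prop)).mono_set Set.Ioc_subset_Icc_self
    rw [← intervalIntegral.integral_of_le ht.le, ← intervalIntegral.integral_of_le ht.le,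
      intervalIntegral.integral_const_mul] at h1
    simp only [Function.uncurry_apply_pair]
    rw [← intervalIntegral.integral_of_le ht.le]
    have hj := jap_pos y
    have h2 := integral_exp_neg_mul_sub_le (t := t) (mul_pos hε hj)
    have h3 := le_two_mul_jap y
    have h4 : 0 < 1 + |y| := by positivity
    calc _ ≤ _ := h1
      _ ≤ 2 * (ε * jap y)⁻¹ * B * (ε * jap y)⁻¹ := by gcongr
      _ = 2 * B * (ε ^ 2)⁻¹ * (jap y ^ 2)⁻¹ := by field_simp
      _ ≤ 2 * B * (ε ^ 2)⁻¹ * (((1 + |y|) / 2) ^ 2)⁻¹ := by gcongr; linarith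
      _ = _ := by field_simp; ring
  have hin : ∀ y, hypDeriv ε y • (hyp ε y)⁻¹ • expConv q t (hyp ε y) =
      ∫ s in Set.Ioc 0 t, K y s := by
    intro y
    rw [expConv, intervalIntegral.integral_of_le ht.le, hK, integral_smul, integral_smul]
  constructor
  · simp_rw [hin]
    exact hprod.integral_prod_left
  · rw [hypIntegral]
    simp_rw [hin]
    rw [integral_integral_swap hprod]
    refine (integral_congr_ae ?_).trans (integral_zero _ _)
    have hae : ∀ᵐ s ∂(volume.restrict (Set.Ioc (0 : ℝ) t)), s ≠ t :=
      ae_restrict_of_ae (by simp [ae_iff])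
    filter_upwards [hae, ae_restrict_mem measurableSet_Ioc] with s hs hs'
    have hst : 0 < t - s := sub_pos.2 (lt_of_le_of_ne hs'.2 hs)
    have h0 := hypIntegral_exp_div hε hε1 hst
    rw [hypIntegral] at h0
    have : ∀ y, K y s = (hypDeriv ε y • (Complex.exp (((t - s : ℝ) : ℂ) * hyp ε y) / hyp ε y)) • q s := by
      intro y
      simp only [hK, smul_smul, smul_eq_mul]
      congr 1
      rw [div_eq_mul_inv]; ring
    simp_rw [this]
    rw [integral_smul_const, h0, zero_smul]

variable {X Y : Type*} [NormedAddCommGroup X] [NormedSpace ℂ X] [CompleteSpace X]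
  [NormedAddCommGroup Y] [NormedSpace ℂ Y] [CompleteSpace Y]

/-- An operator family, analytic in a region around the closed right half plane and decaying there
with a given rate. -/
structure DecayFamily (k γ M : ℝ) (Q : ℂ → X →L[ℂ] Y) : Prop where
  pos : 0 < k
  le : k ≤ 1 / 4
  rate_pos : 0 < γ
  rate_le : γ ≤ 1
  diff : DifferentiableOn ℂ Q (region k)
  bound : ∀ z ∈ region k, ‖Q z‖ ≤ M * (1 + ‖z‖) ^ (-γ)

omit [CompleteSpace X] [CompleteSpace Y] in
lemma DecayFamily.nonneg {k γ M : ℝ} {Q : ℂ → X →L[ℂ] Y} (hQ : DecayFamily k γ M Q) : 0 ≤ M := by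
  have := (norm_nonneg _).trans (hQ.bound 0 (zero_mem_region hQ.pos))
  simpa using this

/-- The variation of constants formula, with the semigroup written as a contour integral. -/
lemma DecayFamily.representation {k γ M : ℝ} {Q : ℂ → X →L[ℂ] Y} (hQ : DecayFamily k γ M Q)
    {t : ℝ} (ht : 0 < t) {d d' h : ℝ → X} {p p' : ℝ → Y}
    (hd : ∀ s ∈ Set.Icc 0 t, HasDerivAt d (d' s) s) (hd' : ContinuousOn d' (Set.Icc 0 t))
    (hh : ContinuousOn h (Set.Icc 0 t))
    (hp : ∀ s ∈ Set.Icc 0 t, HasDerivAt p (p' s) s) (hp' : ContinuousOn p' (Set.Icc 0 t))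
    (hrel : ∀ z ∈ region k, ∀ s ∈ Set.Icc 0 t, Q z (z • d s - d' s + h s) = p s) :
    (2 * Real.pi * Complex.I : ℂ) • p t =
      hypIntegral (k / 2) (fun z => Q z (Complex.exp (t * z) • d 0 + expConv h t z)) := by
  have hk := hQ.pos
  have hε : 0 < k / 2 := by positivity
  have hε1 : k / 2 ≤ 1 := by linarith [hQ.le]
  have htt : t ∈ Set.Icc 0 t := ⟨ht.le, le_rfl⟩
  have h00 : (0 : ℝ) ∈ Set.Icc 0 t := ⟨le_rfl, ht.le⟩
  have hpc : ContinuousOn p (Set.Icc 0 t) := fun s hs => (hp s hs).continuousAt.continuousWithinAt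
  have hdc : ContinuousOn d (Set.Icc 0 t) := fun s hs => (hd s hs).continuousAt.continuousWithinAt
  have hint : ∀ {F : Type _} [NormedAddCommGroup F] [NormedSpace ℂ F] [CompleteSpace F]
      (g : ℝ → F) (z : ℂ), ContinuousOn g (Set.Icc 0 t) →
      IntervalIntegrable (fun s : ℝ => Complex.exp ((t - s : ℝ) * z) • g s) volume 0 t := by
    intro F _ _ _ g z hg
    have he : Continuous fun s : ℝ => Complex.exp ((t - s : ℝ) * z) := by fun_prop
    exact ContinuousOn.intervalIntegrable (by rw [Set.uIcc_of_le ht.le]; exact he.continuousOn.smul hg)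
  set w : X := d' t - h t with hw
  -- Integrating by parts for both `d` and `p` and dividing by `z` leaves three terms with a factor
  -- `1 / z`. Only the first one, the residue at the origin, has a nonzero contour integral.
  have key : ∀ z ∈ region k, z ≠ 0 → Q z (Complex.exp (t * z) • d 0 + expConv h t z) =
      z⁻¹ • Q z w + (Complex.exp (t * z) / z) • p 0 + z⁻¹ • expConv p' t z := by
    intro z hz hz0
    have e1 := mul_expConv ht.le hd hd' z
    have e2 := mul_expConv ht.le hp hp' z
    have e3 : expConv p t z = z • Q z (expConv d t z) - Q z (expConv d' t z) +
        Q z (expConv h t z) := by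
      have : ∀ s ∈ Set.uIcc 0 t, Complex.exp ((t - s : ℝ) * z) • p s = Q z
          (z • (Complex.exp ((t - s : ℝ) * z) • d s) - Complex.exp ((t - s : ℝ) * z) • d' s +
            Complex.exp ((t - s : ℝ) * z) • h s) := by
        intro s hs
        rw [Set.uIcc_of_le ht.le] at hs
        rw [← hrel z hz s hs, ← map_smul]
        congr 1
        rw [smul_add, smul_sub, smul_comm z]
      rw [expConv, intervalIntegral.integral_congr this,
        ContinuousLinearMap.intervalIntegral_comp_comm (Q z)
          (((intervalIntegrable_fun_smul (hint d z hdc) z).sub (hint d' z hd')).add (hint h z hh)),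
        intervalIntegral.integral_add ((intervalIntegrable_fun_smul (hint d z hdc) z).sub (hint d' z hd')) (hint h z hh),
        intervalIntegral.integral_sub (intervalIntegrable_fun_smul (hint d z hdc) z) (hint d' z hd'),
        intervalIntegral.integral_smul]
      simp only [map_add, map_sub, map_smul, expConv]
    have e4 : z • Q z (d t) = p t + Q z w := by
      rw [← hrel z hz t htt, hw, ← map_smul, ← map_add]
      congr 1; abel
    have e5 : Q z (Complex.exp (t * z) • d 0) =
        z • Q z (expConv d t z) + Q z (d t) - Q z (expConv d' t z) := by
      rw [← map_smul, e1]
      simp only [map_add, map_neg]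
      abel
    have e6 : Q z (Complex.exp (t * z) • d 0 + expConv h t z) = Q z (d t) + expConv p t z := by
      rw [map_add, e5, e3]; abel
    have e7 : z • (Q z (d t) + expConv p t z) =
        Q z w + Complex.exp (t * z) • p 0 + expConv p' t z := by
      rw [smul_add, e4, e2]; abel
    rw [e6, ← inv_smul_smul₀ hz0 (Q z (d t) + expConv p t z), e7, smul_add, smul_add, smul_smul,
      div_eq_inv_mul]
  obtain ⟨i1, v1⟩ := hypIntegral_inv_smul (Q := fun z => Q z w) (M := M * ‖w‖) hk hQ.le
    hQ.rate_pos hQ.rate_le (hQ.diff.clm_apply (differentiableOn_const _)) (by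
      intro z hz
      refine ((Q z).le_opNorm w).trans ?_
      rw [mul_right_comm]
      gcongr
      exact hQ.bound z hz)
  obtain ⟨i3, v3⟩ := hypIntegral_inv_smul_expConv hε hε1 ht hp'
  have v2 := hypIntegral_exp_div hε hε1 ht
  have hc := continuous_hyp (k / 2)
  have i2 : Integrable fun y => hypDeriv (k / 2) y •
      (Complex.exp (t * hyp (k / 2) y) / hyp (k / 2) y) := by
    refine ((integrable_exp_neg_mul_jap (mul_pos ht hε)).const_mul (2 * (k / 2)⁻¹)).mono'
      (Continuous.aestronglyMeasurable ?_) (Eventually.of_forall fun y => ?_)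
    · have : Continuous fun y : ℝ => Complex.exp (t * hyp (k / 2) y) := by fun_prop
      exact (continuous_hypDeriv _).smul (this.div hc (hyp_ne_zero hε))
    · rw [norm_smul, norm_div, norm_cexp_mul_hyp, mul_assoc 2]
      have h1 := le_norm_hyp hε.le y
      have h2 := mul_le_mul_of_nonneg_left (one_le_jap y) hε.le
      refine mul_le_mul (norm_hypDeriv_le hε.le hε1 y) ?_ (by positivity) (by norm_num)
      rw [div_eq_inv_mul]
      refine mul_le_mul_of_nonneg_right (inv_anti₀ hε (by linarith only [h1, h2])) (Real.exp_pos _).le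
  -- At `z = 0` the relation evaluates the residue: `w = d' t - h t` is the negative of its argument
  -- there.
  have hrel0 : Q 0 w = -p t := by
    rw [← hrel 0 (zero_mem_region hk) t htt, hw, ← map_neg]
    congr 1; rw [zero_smul]; abel
  rw [hypIntegral]
  have : ∀ y, hypDeriv (k / 2) y • Q (hyp (k / 2) y)
      (Complex.exp (t * hyp (k / 2) y) • d 0 + expConv h t (hyp (k / 2) y)) =
      (hypDeriv (k / 2) y • (hyp (k / 2) y)⁻¹ • Q (hyp (k / 2) y) w +
      (hypDeriv (k / 2) y • (Complex.exp (t * hyp (k / 2) y) / hyp (k / 2) y)) • p 0) +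
      hypDeriv (k / 2) y • (hyp (k / 2) y)⁻¹ • expConv p' t (hyp (k / 2) y) := by
    intro y
    rw [key _ (hyp_mem_region hk (by linarith [hQ.le]) y) (hyp_ne_zero hε y), smul_add, smul_add,
      smul_assoc]
  simp_rw [this]
  rw [integral_add (i1.fun_add (i2.smul_const _)) i3, integral_add i1 (i2.smul_const _),
    integral_smul_const]
  rw [hypIntegral] at v1 v2 v3
  rw [v1, v2, v3, hrel0]
  simp

end

/-! ### A priori bounds and nonlinear stability from resolvent decay -/

section

variable {X Y : Type*} [NormedAddCommGroup X] [NormedSpace ℂ X] [CompleteSpace X]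
  [NormedAddCommGroup Y] [NormedSpace ℂ Y] [CompleteSpace Y]

/-- The constant in the bound for convolutions with a decaying family. -/
def convConst (k γ : ℝ) : ℝ := 8 / k * ∫ y : ℝ, (1 + |y|) ^ (-(1 + γ))

lemma convConst_nonneg {k γ : ℝ} (hk : 0 < k) : 0 ≤ convConst k γ :=
  mul_nonneg (by positivity) (integral_nonneg fun y => by positivity)

lemma DecayFamily.continuous_hyp {k γ M : ℝ} {Q : ℂ → X →L[ℂ] Y} (hQ : DecayFamily k γ M Q) :
    Continuous fun y => Q (hyp (k / 2) y) := by
  rw [continuous_iff_continuousAt]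
  intro y
  exact ContinuousAt.comp (f := hyp (k / 2)) (hQ.diff.continuousOn.continuousAt
    ((isOpen_region k).mem_nhds (hyp_mem_region hQ.pos (by linarith [hQ.le]) y)))
    (AnalyticSemigroup.continuous_hyp _).continuousAt

lemma DecayFamily.norm_hyp_le {k γ M : ℝ} {Q : ℂ → X →L[ℂ] Y} (hQ : DecayFamily k γ M Q) (y : ℝ) :
    ‖Q (hyp (k / 2) y)‖ ≤ M * (1 + |y|) ^ (-γ) := by
  refine (hQ.bound _ (hyp_mem_region hQ.pos (by linarith [hQ.le]) y)).trans ?_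
  have := hQ.nonneg
  have h1 : 0 < 1 + |y| := by positivity
  gcongr ?_ * ?_
  exact Real.rpow_le_rpow_of_nonpos h1 (one_add_abs_le_norm_hyp _ y) (by linarith [hQ.rate_pos])

/-- The factor `1 / jap y` from the time integral and the decay `γ` of `Q` multiply to the
integrable weight `(1 + |y|) ^ (-(1 + γ))`. The bound does not depend on `t`. -/
lemma DecayFamily.conv_bound {k γ M : ℝ} {Q : ℂ → X →L[ℂ] Y} (hQ : DecayFamily k γ M Q)
    {t H : ℝ} (ht : 0 ≤ t) {h : ℝ → X} (hh : ContinuousOn h (Set.Icc 0 t))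
    (hH : ∀ s ∈ Set.Icc 0 t, ‖h s‖ ≤ H) :
    Integrable (fun y => hypDeriv (k / 2) y • Q (hyp (k / 2) y) (expConv h t (hyp (k / 2) y))) ∧
    ‖hypIntegral (k / 2) (fun z => Q z (expConv h t z))‖ ≤ convConst k γ * M * H := by
  have hk := hQ.pos
  have hε : 0 < k / 2 := by positivity
  have hM := hQ.nonneg
  have hH0 : 0 ≤ H := (norm_nonneg _).trans (hH 0 ⟨le_rfl, ht⟩)
  have hb : ∀ y, ‖hypDeriv (k / 2) y • Q (hyp (k / 2) y) (expConv h t (hyp (k / 2) y))‖ ≤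
      8 / k * M * H * (1 + |y|) ^ (-(1 + γ)) := by
    intro y
    have h1 : 0 < 1 + |y| := by positivity
    have hj := jap_pos y
    have h2 := le_two_mul_jap y
    have h3 : ‖expConv h t (hyp (k / 2) y)‖ ≤ 4 / k * (1 + |y|) ^ (-1 : ℝ) * H := by
      refine (norm_expConv_hyp_le hε ht hH y).trans ?_
      gcongr
      rw [Real.rpow_neg_one, ← div_eq_mul_inv, div_div, inv_eq_one_div,
        div_le_div_iff₀ (by positivity) (by positivity)]
      nlinarith
    rw [norm_smul]
    calc _ ≤ 2 * ((M * (1 + |y|) ^ (-γ)) * (4 / k * (1 + |y|) ^ (-1 : ℝ) * H)) := by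
          refine mul_le_mul (norm_hypDeriv_le hε.le (by linarith [hQ.le]) y) ?_ (norm_nonneg _)
            (by norm_num)
          refine ((Q _).le_opNorm _).trans ?_
          gcongr
          exact hQ.norm_hyp_le y
      _ = 8 / k * M * H * ((1 + |y|) ^ (-1 : ℝ) * (1 + |y|) ^ (-γ)) := by ring
      _ = _ := by rw [← Real.rpow_add h1]; congr 2; ring
  have hi := (integrable_one_add_abs_rpow (r := 1 + γ) (by linarith [hQ.rate_pos])).const_mul
    (8 / k * M * H)
  refine ⟨hi.mono' (Continuous.aestronglyMeasurable ?_) (Eventually.of_forall hb), ?_⟩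
  · exact (continuous_hypDeriv _).smul (hQ.continuous_hyp.clm_apply (continuous_expConv_hyp ht hh))
  · refine (norm_integral_le_of_norm_le hi (Eventually.of_forall hb)).trans (le_of_eq ?_)
    rw [integral_const_mul, convConst]; ring

/-- A crude estimate by the exponential alone, singular as `t → 0`. It serves for integrability and
for the limit `t → ∞`. -/
lemma DecayFamily.init_bound {k γ M : ℝ} {Q : ℂ → X →L[ℂ] Y} (hQ : DecayFamily k γ M Q)
    {t : ℝ} (ht : 0 < t) (x : X) :
    Integrable (fun y => hypDeriv (k / 2) y •
      Q (hyp (k / 2) y) (Complex.exp (t * hyp (k / 2) y) • x)) ∧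
    ‖hypIntegral (k / 2) (fun z => Q z (Complex.exp (t * z) • x))‖ ≤
      (64 / k ^ 2 * ∫ y : ℝ, ((1 + |y|) ^ 2)⁻¹) * M * ‖x‖ / t ^ 2 := by
  have hk := hQ.pos
  have hε : 0 < k / 2 := by positivity
  have hM := hQ.nonneg
  have hb : ∀ y, ‖hypDeriv (k / 2) y • Q (hyp (k / 2) y) (Complex.exp (t * hyp (k / 2) y) • x)‖ ≤
      64 / k ^ 2 * M * ‖x‖ / t ^ 2 * ((1 + |y|) ^ 2)⁻¹ := by
    intro y
    have h1 : 0 < 1 + |y| := by positivity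
    have h4 : ‖Q (hyp (k / 2) y)‖ ≤ M := by
      refine (hQ.norm_hyp_le y).trans (mul_le_of_le_one_right hM ?_)
      exact Real.rpow_le_one_of_one_le_of_nonpos (by simp) (by linarith [hQ.rate_pos])
    rw [norm_smul]
    calc _ ≤ 2 * (M * (8 / (t * (k / 2)) ^ 2 * ((1 + |y|) ^ 2)⁻¹ * ‖x‖)) := by
          refine mul_le_mul (norm_hypDeriv_le hε.le (by linarith [hQ.le]) y) ?_ (norm_nonneg _)
            (by norm_num)
          refine ((Q _).le_opNorm _).trans ?_
          rw [norm_smul, norm_cexp_mul_hyp]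
          gcongr
          exact exp_neg_mul_jap_le (mul_pos ht hε) y
      _ = _ := by field_simp; ring
  have hi := integrable_one_add_abs_inv_sq.const_mul (64 / k ^ 2 * M * ‖x‖ / t ^ 2)
  refine ⟨hi.mono' (Continuous.aestronglyMeasurable ?_) (Eventually.of_forall hb), ?_⟩
  · have := AnalyticSemigroup.continuous_hyp (k / 2)
    exact (continuous_hypDeriv _).smul (hQ.continuous_hyp.clm_apply (by fun_prop))
  · refine (norm_integral_le_of_norm_le hi (Eventually.of_forall hb)).trans (le_of_eq ?_)
    rw [integral_const_mul]; ring

lemma norm_le_norm_two_pi_smul (y : Y) : ‖y‖ ≤ ‖(2 * Real.pi * Complex.I : ℂ) • y‖ := by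
  rw [norm_smul]
  refine le_mul_of_one_le_left (norm_nonneg _) ?_
  have := Real.pi_gt_three
  simp [abs_of_pos Real.pi_pos]
  linarith

/-- Bound for the mild solution in terms of the initial value in the large space. -/
lemma DecayFamily.norm_le {k γ M : ℝ} {Q : ℂ → X →L[ℂ] Y} (hQ : DecayFamily k γ M Q)
    {t : ℝ} (ht : 0 < t) {d d' h : ℝ → X} {p p' : ℝ → Y} {H : ℝ}
    (hd : ∀ s ∈ Set.Icc 0 t, HasDerivAt d (d' s) s) (hd' : ContinuousOn d' (Set.Icc 0 t))
    (hh : ContinuousOn h (Set.Icc 0 t)) (hH : ∀ s ∈ Set.Icc 0 t, ‖h s‖ ≤ H)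
    (hp : ∀ s ∈ Set.Icc 0 t, HasDerivAt p (p' s) s) (hp' : ContinuousOn p' (Set.Icc 0 t))
    (hrel : ∀ z ∈ region k, ∀ s ∈ Set.Icc 0 t, Q z (z • d s - d' s + h s) = p s) :
    ‖p t‖ ≤ (64 / k ^ 2 * ∫ y : ℝ, ((1 + |y|) ^ 2)⁻¹) * M * ‖d 0‖ / t ^ 2 +
      convConst k γ * M * H := by
  obtain ⟨i1, b1⟩ := hQ.init_bound ht (d 0)
  obtain ⟨i2, b2⟩ := hQ.conv_bound ht.le hh hH
  refine (norm_le_norm_two_pi_smul _).trans ?_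
  rw [hQ.representation ht hd hd' hh hp hp' hrel, hypIntegral]
  simp only [map_add, smul_add]
  rw [integral_add i1 i2]
  exact (norm_add_le _ _).trans (add_le_add b1 b2)

/-- Uniformity in `t` comes from shifting the contour to the right by `t⁻¹`: there the exponential
is at most `e` in modulus, and `1 + ‖z‖` is bounded below by a multiple of `t⁻¹ + |y|`. Rescaling
`y` by `t` then removes `t` from the integral. -/
lemma hypIntegral_exp_smul_bound {k M : ℝ} (hk : 0 < k) (hk1 : k ≤ 1 / 4) {B : ℂ → Y}
    (hB : DifferentiableOn ℂ B (region k))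
    (hM : ∀ z ∈ region k, ‖B z‖ ≤ M * (1 + ‖z‖)⁻¹) {t : ℝ} (ht : 0 < t) :
    ‖hypIntegral (k / 2) (fun z => Complex.exp (t * z) • B z)‖ ≤
      (Real.exp 1 * (16 / k) * ∫ y : ℝ, ((1 + |y|) ^ 2)⁻¹) * M := by
  have hε : 0 < k / 2 := by positivity
  have hε1 : k / 2 ≤ 1 := by linarith
  have hM0 : 0 ≤ M := by
    have := (norm_nonneg _).trans (hM 0 (zero_mem_region hk))
    simpa using this
  have hFd : DifferentiableOn ℂ (fun z : ℂ => Complex.exp (t * z) • B z) (region k) :=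
    DifferentiableOn.smul (by fun_prop) hB
  have hdom : ∀ s, 0 ≤ s → s ≤ t⁻¹ → HypDominated (k / 2) (k / 4) (region k)
      (fun z : ℂ => Complex.exp (t * z) • B z)
      (fun y => Real.exp (1 + t) * M * Real.exp (-(t * (k / 2) * jap y))) (1 * s) := by
    intro s hs hs1
    rw [one_mul]
    refine ⟨fun y w hw => (mem_region_of_dist hk (by linarith) hs hw).1, fun y w hw => ?_⟩
    obtain ⟨h1, -⟩ := mem_region_of_dist hk (by linarith) hs hw
    rw [Metric.mem_closedBall, Complex.dist_eq] at hw
    have h2 := (abs_le.1 ((Complex.abs_re_le_norm _).trans hw)).2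
    simp only [Complex.sub_re, Complex.add_re, hyp_re, Complex.ofReal_re] at h2
    have h3 : ‖B w‖ ≤ M := by
      refine (hM w h1).trans (mul_le_of_le_one_right hM0 (inv_le_one_of_one_le₀ (by simp)))
    have h5 : t * s ≤ 1 := by
      calc t * s ≤ t * t⁻¹ := by gcongr
        _ = 1 := mul_inv_cancel₀ ht.ne'
    rw [norm_smul, Complex.norm_exp, mul_right_comm, ← Real.exp_add]
    gcongr
    simp only [Complex.mul_re, Complex.ofReal_re, Complex.ofReal_im, zero_mul, sub_zero]
    nlinarith
  rw [hypIntegral_shift hε.le hε1 (by positivity) (isOpen_region k) hFd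
    ((integrable_exp_neg_mul_jap (mul_pos ht hε)).const_mul _) (τ := 1) (by norm_num)
    (inv_nonneg.2 ht.le) hdom]
  have hb : ∀ y : ℝ, ‖hypDeriv (k / 2) y • (Complex.exp (t * (hyp (k / 2) y + ((1 * t⁻¹ : ℝ) : ℂ))) •
      B (hyp (k / 2) y + ((1 * t⁻¹ : ℝ) : ℂ)))‖ ≤
      Real.exp 1 * (16 / k) * M * (t * ((1 + |t * y|) ^ 2)⁻¹) := by
    intro y
    set w : ℂ := hyp (k / 2) y + ((1 * t⁻¹ : ℝ) : ℂ) with hw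
    have hwm : w ∈ region k := (hdom t⁻¹ (inv_nonneg.2 ht.le) le_rfl).subset y
      (Metric.mem_closedBall_self (by positivity))
    have hre : w.re = -(k / 2 * jap y) + t⁻¹ := by
      simp only [hw, Complex.add_re, hyp_re, Complex.ofReal_re]; ring
    have him : w.im = y := by simp [hw]
    have n1 : |y| ≤ ‖w‖ := by simpa [him] using Complex.abs_im_le_norm w
    have n2 : -(k / 2 * jap y) + t⁻¹ ≤ ‖w‖ := by
      simpa [hre] using (le_abs_self _).trans (Complex.abs_re_le_norm w)
    have hj := jap_le y
    have n3 : t⁻¹ + |y| ≤ 4 * (1 + ‖w‖) := by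
      nlinarith [norm_nonneg w, abs_nonneg y]
    have hty : |t * y| = t * |y| := by rw [abs_mul, abs_of_pos ht]
    have n4 : 1 + |t * y| ≤ 4 * t * (1 + ‖w‖) := by
      rw [hty]
      calc 1 + t * |y| = t * (t⁻¹ + |y|) := by field_simp
        _ ≤ t * (4 * (1 + ‖w‖)) := by gcongr
        _ = _ := by ring
    have e1 : ‖Complex.exp (t * w)‖ ≤ Real.exp 1 * (2 / k * (1 + |t * y|)⁻¹) := by
      rw [Complex.norm_exp]
      have : ((t : ℂ) * w).re = 1 + -(t * (k / 2) * jap y) := by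
        simp only [Complex.mul_re, Complex.ofReal_re, Complex.ofReal_im, zero_mul, sub_zero, hre]
        field_simp; ring
      rw [this, Real.exp_add]
      gcongr
      have h6 := Real.add_one_le_exp (t * (k / 2) * jap y)
      have h7 : k / 2 * (1 + |t * y|) ≤ Real.exp (t * (k / 2) * jap y) := by
        refine le_trans ?_ h6
        rw [hty]
        have := abs_le_jap y
        have h8 : t * (k / 2) * |y| ≤ t * (k / 2) * jap y := by gcongr
        nlinarith
      rw [Real.exp_neg, ← div_eq_mul_inv, div_div, inv_eq_one_div,
        div_le_div_iff₀ (Real.exp_pos _) (by positivity)]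
      linarith
    have e2 : ‖B w‖ ≤ M * (4 * t * (1 + |t * y|)⁻¹) := by
      refine (hM w hwm).trans ?_
      gcongr
      rw [← div_eq_mul_inv, inv_eq_one_div, div_le_div_iff₀ (by positivity) (by positivity)]
      linarith
    rw [norm_smul, norm_smul]
    calc _ ≤ 2 * ((Real.exp 1 * (2 / k * (1 + |t * y|)⁻¹)) * (M * (4 * t * (1 + |t * y|)⁻¹))) := by
          gcongr
          exact norm_hypDeriv_le hε.le hε1 y
      _ = _ := by field_simp; ring
  have hi : Integrable fun y : ℝ => Real.exp 1 * (16 / k) * M * (t * ((1 + |t * y|) ^ 2)⁻¹) :=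
    ((integrable_one_add_abs_inv_sq.comp_mul_left' ht.ne').const_mul t).const_mul _
  refine (norm_integral_le_of_norm_le hi (Eventually.of_forall hb)).trans (le_of_eq ?_)
  rw [integral_const_mul, integral_const_mul,
    Measure.integral_comp_mul_left (fun u : ℝ => ((1 + |u|) ^ 2)⁻¹), abs_of_pos (inv_pos.2 ht),
    smul_eq_mul, mul_inv_cancel_left₀ ht.ne']
  ring

/-- The constant in the bound for the semigroup on the small space. -/
def initConst (k : ℝ) : ℝ := Real.exp 1 * (16 / k) * ∫ y : ℝ, ((1 + |y|) ^ 2)⁻¹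

/-- Bound for the mild solution in terms of the initial value in the small space. -/
lemma DecayFamily.norm_le_of_init {k γ M M₀ : ℝ} {Q : ℂ → X →L[ℂ] Y} (hQ : DecayFamily k γ M Q)
    {J : Y →L[ℂ] X} (hJ : ∀ z ∈ region k, ‖Q z ∘L J‖ ≤ M₀ * (1 + ‖z‖)⁻¹)
    {t : ℝ} (ht : 0 < t) {h : ℝ → X} {p p' : ℝ → Y} {H : ℝ}
    (hh : ContinuousOn h (Set.Icc 0 t)) (hH : ∀ s ∈ Set.Icc 0 t, ‖h s‖ ≤ H)
    (hp : ∀ s ∈ Set.Icc 0 t, HasDerivAt p (p' s) s) (hp' : ContinuousOn p' (Set.Icc 0 t))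
    (hrel : ∀ z ∈ region k, ∀ s ∈ Set.Icc 0 t, Q z (z • J (p s) - J (p' s) + h s) = p s) :
    ‖p t‖ ≤ initConst k * M₀ * ‖p 0‖ + convConst k γ * M * H := by
  obtain ⟨i1, -⟩ := hQ.init_bound ht (J (p 0))
  obtain ⟨i2, b2⟩ := hQ.conv_bound ht.le hh hH
  have b1 := hypIntegral_exp_smul_bound (M := M₀ * ‖p 0‖) (B := fun z => Q z (J (p 0))) hQ.pos hQ.le
    (hQ.diff.clm_apply (differentiableOn_const _)) (fun z hz => by
      refine ((Q z ∘L J).le_opNorm (p 0)).trans ?_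
      rw [mul_right_comm]
      gcongr
      exact hJ z hz) ht
  refine (norm_le_norm_two_pi_smul _).trans ?_
  rw [hQ.representation (d := fun s => J (p s)) (d' := fun s => J (p' s)) ht
    (fun s hs => (J.restrictScalars ℝ).hasFDerivAt.comp_hasDerivAt s (hp s hs))
    (J.continuous.comp_continuousOn hp') hh hp hp' hrel, hypIntegral]
  simp only [map_add, smul_add]
  rw [integral_add i1 i2]
  refine (norm_add_le _ _).trans (add_le_add ?_ b2)
  simp only [map_smul]
  rw [hypIntegral] at b1
  refine b1.trans (le_of_eq ?_)
  rw [initConst]; ring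

/-- Nonlinear stability: small solutions stay small. -/
lemma DecayFamily.stable {k γ M M₀ : ℝ} {Q : ℂ → X →L[ℂ] Y} (hQ : DecayFamily k γ M Q)
    {J : Y →L[ℂ] X} (hJ : ∀ z ∈ region k, ‖Q z ∘L J‖ ≤ M₀ * (1 + ‖z‖)⁻¹)
    {T η δ : ℝ} (hη : 0 ≤ η) (hη1 : convConst k γ * M * η ≤ 1 / 2) {h : ℝ → X} {p p' : ℝ → Y}
    (hh : ContinuousOn h (Set.Icc 0 T))
    (hH : ∀ s ∈ Set.Icc 0 T, ‖p s‖ ≤ δ → ‖h s‖ ≤ η * ‖p s‖)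
    (hp : ∀ s ∈ Set.Icc 0 T, HasDerivAt p (p' s) s) (hp' : ContinuousOn p' (Set.Icc 0 T))
    (hrel : ∀ z ∈ region k, ∀ s ∈ Set.Icc 0 T, Q z (z • J (p s) - J (p' s) + h s) = p s)
    (hδ : ‖p 0‖ < δ) (hδ' : 2 * (initConst k * M₀ * ‖p 0‖) < δ) :
    ∀ t ∈ Set.Icc 0 T, ‖p t‖ ≤ max ‖p 0‖ (2 * (initConst k * M₀ * ‖p 0‖)) := by
  have hM := hQ.nonneg
  have hKM : 0 ≤ convConst k γ * M := mul_nonneg (convConst_nonneg hQ.pos) hM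
  have hpc : ContinuousOn p (Set.Icc 0 T) := fun s hs => (hp s hs).continuousAt.continuousWithinAt
  have main : ∀ t ∈ Set.Icc 0 T, (∀ s ∈ Set.Icc 0 t, ‖p s‖ ≤ δ) →
      ‖p t‖ ≤ max ‖p 0‖ (2 * (initConst k * M₀ * ‖p 0‖)) := by
    intro t ht hs
    have hsub : Set.Icc 0 t ⊆ Set.Icc 0 T := Set.Icc_subset_Icc_right ht.2
    -- At the time `u` of maximal norm the nonlinear term contributes at most half of `‖p u‖`, which
    -- is absorbed on the left.
    obtain ⟨u, hu, hmax⟩ := isCompact_Icc.exists_isMaxOn ⟨(0 : ℝ), le_rfl, ht.1⟩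
      (hpc.mono hsub).norm
    have hmax' : ∀ s ∈ Set.Icc 0 t, ‖p s‖ ≤ ‖p u‖ := fun s hs => hmax hs
    refine (hmax' t ⟨ht.1, le_rfl⟩).trans ?_
    rcases eq_or_lt_of_le hu.1 with h0 | h0
    · rw [← h0]; exact le_max_left _ _
    · refine le_trans ?_ (le_max_right _ _)
      have hsu : Set.Icc 0 u ⊆ Set.Icc 0 t := Set.Icc_subset_Icc_right hu.2
      have := hQ.norm_le_of_init hJ h0 (H := η * ‖p u‖) (hh.mono (hsu.trans hsub))
        (fun s hs' => (hH s (hsub (hsu hs')) (hs s (hsu hs'))).trans (by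
          gcongr; exact hmax' s (hsu hs')))
        (fun s hs => hp s (hsub (hsu hs))) (hp'.mono (hsu.trans hsub))
        (fun z hz s hs => hrel z hz s (hsub (hsu hs)))
      have h2 : convConst k γ * M * (η * ‖p u‖) ≤ 1 / 2 * ‖p u‖ := by
        rw [← mul_assoc]; gcongr
      linarith
  have hlt : max ‖p 0‖ (2 * (initConst k * M₀ * ‖p 0‖)) < δ := max_lt hδ hδ'
  intro t ht
  refine main t ht ?_
  by_contra! hcon
  obtain ⟨s₁, hs₁, hs₁'⟩ := hcon
  -- Continuation argument: up to and including the first time `v` at which the norm reaches `δ` the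
  -- bound `main` applies, and it is strictly below `δ`.
  set S : Set ℝ := Set.Icc 0 t ∩ (fun s => ‖p s‖) ⁻¹' Set.Ici δ with hS
  have hsub : Set.Icc 0 t ⊆ Set.Icc 0 T := Set.Icc_subset_Icc_right ht.2
  have hScl : IsClosed S := (hpc.mono hsub).norm.preimage_isClosed_of_isClosed isClosed_Icc
    isClosed_Ici
  have hSc : IsCompact S := isCompact_Icc.of_isClosed_subset hScl Set.inter_subset_left
  obtain ⟨v, hv, hvmin⟩ := hSc.exists_isLeast ⟨s₁, hs₁, hs₁'.le⟩
  have hv1 : ∀ s ∈ Set.Icc 0 v, s ≠ v → ‖p s‖ < δ := by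
    intro s hs hsv
    by_contra! hc
    exact hsv (le_antisymm hs.2 (hvmin ⟨⟨hs.1, hs.2.trans hv.1.2⟩, hc⟩))
  have hv0 : 0 < v := by
    rcases eq_or_lt_of_le hv.1.1 with h0 | h0
    · have := hv.2
      rw [← h0] at this
      exact absurd hδ (not_lt.2 this)
    · exact h0
  have hvδ : ‖p v‖ ≤ δ := by
    have hcw : ContinuousWithinAt (fun s => ‖p s‖) (Set.Ioo 0 v) v :=
      ((hp v (hsub hv.1)).continuousAt.norm).continuousWithinAt
    have hne : (𝓝[Set.Ioo 0 v] v).NeBot := by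
      rw [← mem_closure_iff_nhdsWithin_neBot, closure_Ioo hv0.ne]
      exact ⟨hv0.le, le_rfl⟩
    refine le_of_tendsto hcw.tendsto ?_
    filter_upwards [self_mem_nhdsWithin] with s hs
    exact (hv1 s ⟨hs.1.le, hs.2.le⟩ hs.2.ne).le
  have := main v (hsub hv.1) (fun s hs => by
    by_cases hsv : s = v
    · rw [hsv]; exact hvδ
    · exact (hv1 s hs hsv).le)
  exact absurd (this.trans_lt hlt) (not_lt.2 hv.2)

end

section

/-! ### Resolvents of unbounded operators -/

variable {X Y : Type*} [NormedAddCommGroup X] [NormedSpace ℂ X]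
  [NormedAddCommGroup Y] [NormedSpace ℂ Y]

lemma IsResolventAt.left {A : X →ₗ.[ℂ] X} {z : ℂ} {R : X →L[ℂ] X} (h : IsResolventAt A z R)
    {x : X} (hx : x ∈ A.domain) : R (z • x - A ⟨x, hx⟩) = x := h.2 ⟨x, hx⟩

lemma IsResolventAt.unique {A : X →ₗ.[ℂ] X} {z : ℂ} {R S : X →L[ℂ] X}
    (hR : IsResolventAt A z R) (hS : IsResolventAt A z S) : R = S := by
  ext y
  obtain ⟨h, hy⟩ := hR.1 y
  have := hS.left h
  rw [hy] at this
  exact this.symm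

lemma isResolventAt_resolvent {A : X →ₗ.[ℂ] X} {z : ℂ} (hz : z ∈ resolventSet A) :
    IsResolventAt A z (resolvent A z) := by
  have h : ∃ R : X →L[ℂ] X, IsResolventAt A z R := hz
  rw [resolvent, dif_pos h]
  exact h.choose_spec

lemma IsResolventAt.mem {A : X →ₗ.[ℂ] X} {z : ℂ} {R : X →L[ℂ] X} (h : IsResolventAt A z R) :
    z ∈ resolventSet A := ⟨R, h⟩

lemma IsResolventAt.resolvent_eq {A : X →ₗ.[ℂ] X} {z : ℂ} {R : X →L[ℂ] X}
    (h : IsResolventAt A z R) : resolvent A z = R :=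
  (isResolventAt_resolvent h.mem).unique h

/-- The resolvent identity. -/
lemma resolvent_identity {A : X →ₗ.[ℂ] X} {z w : ℂ} (hz : z ∈ resolventSet A)
    (hw : w ∈ resolventSet A) (y : X) :
    resolvent A z y = resolvent A w y + (w - z) • resolvent A w (resolvent A z y) := by
  obtain ⟨h, hy⟩ := (isResolventAt_resolvent hz).1 y
  have := (isResolventAt_resolvent hw).left h
  have hA : A ⟨_, h⟩ = z • resolvent A z y - y := by
    have h1 := hy
    rw [sub_eq_iff_eq_add] at h1
    rw [h1, add_sub_cancel_left]
  rw [hA] at this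
  rw [← map_smul, ← map_add]
  conv_lhs => rw [← this]
  congr 1
  rw [sub_smul]
  abel

/-- The resolvent identity is combined with the one where `z` and `w` are exchanged. -/
lemma resolvent_comm {A : X →ₗ.[ℂ] X} {z w : ℂ} (hz : z ∈ resolventSet A)
    (hw : w ∈ resolventSet A) (y : X) :
    resolvent A w (resolvent A z y) = resolvent A z (resolvent A w y) := by
  by_cases hzw : w = z
  · rw [hzw]
  · have h1 := resolvent_identity hz hw y
    have h2 := resolvent_identity hw hz y
    rw [h1, add_assoc, left_eq_add, ← neg_sub w z, neg_smul, ← sub_eq_add_neg, ← smul_sub,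
      smul_eq_zero] at h2
    exact sub_eq_zero.1 (h2.resolve_left (sub_ne_zero.2 hzw))

variable [CompleteSpace X]

lemma inverse_one_sub_mul {T : X →L[ℂ] X} (hT : ‖T‖ < 1) (y : X) :
    Ring.inverse (1 - T) y - T (Ring.inverse (1 - T) y) = y ∧
    Ring.inverse (1 - T) (y - T y) = y := by
  have hu : IsUnit (1 - T) := isUnit_one_sub_of_norm_lt_one hT
  have h1 := congrArg (fun S : X →L[ℂ] X => S y) (Ring.mul_inverse_cancel _ hu)
  have h2 := congrArg (fun S : X →L[ℂ] X => S y) (Ring.inverse_mul_cancel _ hu)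
  exact ⟨by simpa using h1, by simpa using h2⟩

lemma norm_inverse_one_sub_le {T : X →L[ℂ] X} (hT : ‖T‖ ≤ 1 / 2) :
    ‖Ring.inverse (1 - T)‖ ≤ 2 := by
  refine ContinuousLinearMap.opNorm_le_bound _ (by norm_num) fun y => ?_
  have h1 := (inverse_one_sub_mul (hT.trans_lt (by norm_num)) y).1
  set x := Ring.inverse (1 - T) y
  have h2 : ‖T x‖ ≤ 1 / 2 * ‖x‖ := (T.le_opNorm x).trans (by gcongr)
  have h3 : ‖x‖ ≤ ‖y‖ + ‖T x‖ := by
    rw [← h1]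
    have := norm_add_le (x - T x) (T x)
    simpa using this
  linarith

/-- Perturbation of resolvents: if `z - L = w - A - K` on the common domain and `K (w - A)⁻¹` is
small, then `z - L` is invertible. -/
lemma IsResolventAt.perturb {A L : X →ₗ.[ℂ] X} (hdom : L.domain = A.domain) {J : Y →L[ℂ] X}
    {R : X →L[ℂ] Y} {w z : ℂ} (hR : IsResolventAt A w (J ∘L R)) (K : Y →L[ℂ] X)
    (hK : ∀ y (hL : J y ∈ L.domain) (hA : J y ∈ A.domain),
      z • J y - L ⟨J y, hL⟩ = w • J y - A ⟨J y, hA⟩ - K y) (h1 : ‖K ∘L R‖ < 1) :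
    IsResolventAt L z (J ∘L (R ∘L Ring.inverse (1 - K ∘L R))) := by
  constructor
  · intro y
    obtain ⟨h, hy⟩ := hR.1 (Ring.inverse (1 - K ∘L R) y)
    have h' : J (R (Ring.inverse (1 - K ∘L R) y)) ∈ L.domain := by rw [hdom]; exact h
    refine ⟨h', ?_⟩
    have e1 := hK _ h' h
    have e2 := (inverse_one_sub_mul h1 y).1
    simp only [ContinuousLinearMap.comp_apply] at hy e1 e2 ⊢
    rw [e1, hy, e2]
  · intro x
    have hx : (x : X) ∈ A.domain := by rw [← hdom]; exact x.2
    set v := w • (x : X) - A ⟨x, hx⟩ with hv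
    have e1 : J (R v) = x := hR.left hx
    have e3 : z • (x : X) - L x = v - K (R v) := by
      have h' : J (R v) ∈ L.domain := by rw [e1]; exact x.2
      have h'' : J (R v) ∈ A.domain := by rw [e1]; exact hx
      have := hK (R v) h' h''
      have a1 : (⟨J (R v), h'⟩ : L.domain) = x := Subtype.ext e1
      have a2 : (⟨J (R v), h''⟩ : A.domain) = ⟨x, hx⟩ := Subtype.ext e1
      rw [a1, a2, e1] at this
      exact this
    simp only [ContinuousLinearMap.comp_apply]
    rw [e3, ← ContinuousLinearMap.comp_apply K R, (inverse_one_sub_mul h1 v).2, e1]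

/-- The case of `IsResolventAt.perturb` in which the perturbation is the multiple `w - z` of the
identity. -/
lemma resolvent_near {A : X →ₗ.[ℂ] X} {w : ℂ} (hw : w ∈ resolventSet A) {z : ℂ}
    (hz : ‖(w - z) • resolvent A w‖ < 1) :
    IsResolventAt A z (resolvent A w ∘L Ring.inverse (1 - (w - z) • resolvent A w)) := by
  have h := isResolventAt_resolvent hw
  have := IsResolventAt.perturb (L := A) rfl (J := ContinuousLinearMap.id ℂ X)
    (R := resolvent A w) (w := w) (z := z) h ((w - z) • ContinuousLinearMap.id ℂ X)
    (fun y _ _ => by simp [sub_smul]) (by simpa using hz)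
  simpa using this

lemma eventually_resolvent_near {A : X →ₗ.[ℂ] X} {w : ℂ} (hw : w ∈ resolventSet A) :
    ∀ᶠ z in 𝓝 w, IsResolventAt A z
      (resolvent A w ∘L Ring.inverse (1 - (w - z) • resolvent A w)) := by
  have hc : Continuous fun z : ℂ => ‖(w - z) • resolvent A w‖ := by fun_prop
  have : ∀ᶠ z in 𝓝 w, ‖(w - z) • resolvent A w‖ < 1 :=
    hc.continuousAt.eventually_lt continuousAt_const (by simp)
  exact this.mono fun z hz => resolvent_near hw hz

lemma isOpen_resolventSet (A : X →ₗ.[ℂ] X) : IsOpen (resolventSet A) :=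
  isOpen_iff_mem_nhds.2 fun _ hw => (eventually_resolvent_near hw).mono fun _ h => h.mem

lemma differentiableAt_resolvent {A : X →ₗ.[ℂ] X} {w : ℂ} (hw : w ∈ resolventSet A) :
    DifferentiableAt ℂ (resolvent A) w := by
  have h1 : resolvent A =ᶠ[𝓝 w] fun z =>
      resolvent A w * Ring.inverse (1 - (w - z) • resolvent A w) :=
    (eventually_resolvent_near hw).mono fun z hz => hz.resolvent_eq
  refine DifferentiableAt.congr_of_eventuallyEq ?_ h1
  refine (differentiableAt_const _).mul ?_
  have h2 : DifferentiableAt ℂ (fun z : ℂ => 1 - (w - z) • resolvent A w) w := by fun_prop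
  refine DifferentiableAt.comp (g := Ring.inverse) w ?_ h2
  apply differentiableAt_inverse
  simp

/-- `R` is the resolvent of `L` on the whole resolvent set, with values in a smaller space `Y`,
embedded by `J`. -/
structure IsLift (J : Y →L[ℂ] X) (L : X →ₗ.[ℂ] X) (R : ℂ → X →L[ℂ] Y) : Prop where
  inj : Function.Injective J
  isRes : ∀ z ∈ resolventSet L, IsResolventAt L z (J ∘L R z)
  diff : DifferentiableOn ℂ R (resolventSet L)

lemma IsLift.eq_resolvent {J : Y →L[ℂ] X} {L : X →ₗ.[ℂ] X} {R : ℂ → X →L[ℂ] Y}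
    (h : IsLift J L R) {z : ℂ} (hz : z ∈ resolventSet L) : J ∘L R z = resolvent L z :=
  (h.isRes z hz).resolvent_eq.symm

lemma IsLift.left {J : Y →L[ℂ] X} {L : X →ₗ.[ℂ] X} {R : ℂ → X →L[ℂ] Y}
    (h : IsLift J L R) {z : ℂ} (hz : z ∈ resolventSet L) {y : Y} (hy : J y ∈ L.domain) :
    R z (z • J y - L ⟨J y, hy⟩) = y :=
  h.inj ((h.isRes z hz).left hy)

lemma IsLift.uniq {J : Y →L[ℂ] X} {L : X →ₗ.[ℂ] X} {R : ℂ → X →L[ℂ] Y}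
    (h : IsLift J L R) {z : ℂ} {S : X →L[ℂ] Y} (hS : IsResolventAt L z (J ∘L S)) : R z = S := by
  ext y
  apply h.inj
  have := (h.isRes z hS.mem).unique hS
  exact congrArg (fun T : X →L[ℂ] X => T y) this

lemma IsLift.identity {J : Y →L[ℂ] X} {L : X →ₗ.[ℂ] X} {R : ℂ → X →L[ℂ] Y}
    (h : IsLift J L R) {z w : ℂ} (hz : z ∈ resolventSet L) (hw : w ∈ resolventSet L) (y : X) :
    R z y = R w (y + (w - z) • J (R z y)) := by
  apply h.inj
  have := resolvent_identity hz hw y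
  rw [← h.eq_resolvent hz, ← h.eq_resolvent hw] at this
  simpa using this

/-- A lift at a single point suffices: by the resolvent identity every resolvent factors as the one
at `w` after a bounded operator on `X` that is analytic in `z`. -/
lemma exists_isLift {J : Y →L[ℂ] X} (hJ : Function.Injective J) {L : X →ₗ.[ℂ] X} {w : ℂ}
    {S : X →L[ℂ] Y} (hS : IsResolventAt L w (J ∘L S)) : ∃ R, IsLift J L R := by
  have hw := hS.mem
  refine ⟨fun z => S ∘L (ContinuousLinearMap.id ℂ X + (w - z) • resolvent L z), hJ, ?_, ?_⟩
  · intro z hz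
    convert isResolventAt_resolvent hz using 1
    ext y
    rw [resolvent_identity hz hw y, hS.resolvent_eq]
    simp
  · intro z hz
    have := (differentiableAt_resolvent hz)
    refine DifferentiableAt.differentiableWithinAt ?_
    exact (differentiableAt_const S).clm_comp (((differentiableAt_const _).add
      ((by fun_prop : DifferentiableAt ℂ (fun z => w - z) z).smul this)))

end

section

/-! ### Fractional power spaces -/

lemma integrableOn_rpow_neg_div {β r : ℝ} (h0 : 0 < β) (h1 : β < 1) (hr : 0 < r) :
    IntegrableOn (fun t : ℝ => t ^ (-β) / (r + t)) (Set.Ioi 0) := by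
  have hm : Measurable fun t : ℝ => t ^ (-β) / (r + t) := by fun_prop
  rw [← Set.Ioc_union_Ioi_eq_Ioi zero_le_one]
  refine IntegrableOn.union ?_ ?_
  · have hi : IntegrableOn (fun t : ℝ => t ^ (-β) * r⁻¹) (Set.Ioc 0 1) := by
      have := intervalIntegral.intervalIntegrable_rpow' (a := 0) (b := 1) (r := -β) (by linarith)
      rw [intervalIntegrable_iff_integrableOn_Ioc_of_le zero_le_one] at this
      exact this.mul_const _
    refine hi.mono' hm.aestronglyMeasurable ?_
    filter_upwards [ae_restrict_mem measurableSet_Ioc] with t ht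
    have h2 : 0 ≤ t ^ (-β) := Real.rpow_nonneg ht.1.le _
    have ht0 := ht.1
    rw [Real.norm_of_nonneg (by positivity), div_eq_mul_inv]
    gcongr
    linarith
  · have hi : IntegrableOn (fun t : ℝ => t ^ (-β - 1)) (Set.Ioi 1) :=
      integrableOn_Ioi_rpow_of_lt (by linarith) one_pos
    refine hi.mono' hm.aestronglyMeasurable ?_
    filter_upwards [ae_restrict_mem measurableSet_Ioi] with t ht
    have ht0 : (0 : ℝ) < t := one_pos.trans ht
    have h2 : 0 ≤ t ^ (-β) := Real.rpow_nonneg ht0.le _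
    rw [Real.norm_of_nonneg (by positivity), Real.rpow_sub_one ht0.ne']
    gcongr
    linarith

lemma integral_rpow_neg_div {β r : ℝ} (hr : 0 < r) :
    ∫ t in Set.Ioi (0 : ℝ), t ^ (-β) / (r + t) =
      r ^ (-β) * ∫ u in Set.Ioi (0 : ℝ), u ^ (-β) / (1 + u) := by
  have h := integral_comp_mul_left_Ioi' (fun t : ℝ => t ^ (-β) / (r + t)) 0 hr
  rw [mul_zero] at h
  rw [← h, smul_eq_mul, ← integral_const_mul, ← integral_const_mul]
  refine setIntegral_congr_fun measurableSet_Ioi fun u hu => ?_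
  have hu0 : (0 : ℝ) < u := hu
  rw [Real.mul_rpow hr.le hu0.le]
  have : r + r * u = r * (1 + u) := by ring
  rw [this]
  field_simp

variable {X : Type*} [NormedAddCommGroup X] [NormedSpace ℂ X] [CompleteSpace X]

/-- A sector estimate, with the sector given by an inequality between real part and modulus. -/
structure SectorBound (A : X →ₗ.[ℂ] X) (ω k M : ℝ) : Prop where
  pos : 0 < k
  mem : ∀ z : ℂ, z ≠ ω → -(k * ‖z - ω‖) ≤ (z - ω).re → z ∈ resolventSet A
  le : ∀ z : ℂ, z ≠ ω → -(k * ‖z - ω‖) ≤ (z - ω).re → ‖resolvent A z‖ ≤ M / ‖z - ω‖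

/-- The opening is `k = -cos φ`, positive because `φ > π/2`. The linear inequality behaves better
than the argument under shifts and rotations. -/
lemma IsSectorial.sectorBound {A : X →ₗ.[ℂ] X} {ω : ℝ} (hA : IsSectorial A ω) :
    ∃ k M, SectorBound A ω k M := by
  obtain ⟨-, -, φ, M, h1, h2, h⟩ := hA
  have key : ∀ z : ℂ, z ≠ ω → -(-Real.cos φ * ‖z - ω‖) ≤ (z - ω).re → |(z - ω).arg| ≤ φ := by
    intro z hz hre
    have hn : 0 < ‖z - ω‖ := norm_pos_iff.2 (sub_ne_zero.2 hz)
    by_contra! hlt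
    have h3 : Real.cos |(z - ω).arg| < Real.cos φ :=
      Real.cos_lt_cos_of_nonneg_of_le_pi (by linarith [Real.pi_pos]) (Complex.abs_arg_le_pi _) hlt
    rw [Real.cos_abs, Complex.cos_arg (sub_ne_zero.2 hz), div_lt_iff₀ hn] at h3
    linarith
  refine ⟨-Real.cos φ, M, ?_, fun z hz hre => (h z hz (key z hz hre)).1,
    fun z hz hre => (h z hz (key z hz hre)).2⟩
  have := Real.cos_neg_of_pi_div_two_lt_of_lt h1 (by linarith)
  linarith

section RealAxis

variable {A : X →ₗ.[ℂ] X} {ω k M c : ℝ} (hA : SectorBound A ω k M) (hc : ω < c)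
include hA hc

lemma SectorBound.real_cond {s : ℝ} (hs : 0 ≤ s) :
    ((s + c : ℝ) : ℂ) ≠ ω ∧ -(k * ‖((s + c : ℝ) : ℂ) - ω‖) ≤ (((s + c : ℝ) : ℂ) - ω).re ∧
      ‖((s + c : ℝ) : ℂ) - ω‖ = c - ω + s := by
  have h1 : ((s + c : ℝ) : ℂ) - ω = ((c - ω + s : ℝ) : ℂ) := by push_cast; ring
  have h2 : 0 < c - ω + s := by linarith
  refine ⟨?_, ?_, ?_⟩
  · rw [Ne, Complex.ofReal_inj]; linarith
  · rw [h1, Complex.ofReal_re]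
    have := hA.pos
    have : 0 ≤ k * ‖((c - ω + s : ℝ) : ℂ)‖ := by positivity
    linarith
  · rw [h1, Complex.norm_real, Real.norm_of_nonneg h2.le]

lemma SectorBound.real_mem {s : ℝ} (hs : 0 ≤ s) : ((s + c : ℝ) : ℂ) ∈ resolventSet A :=
  hA.mem _ (hA.real_cond hc hs).1 (hA.real_cond hc hs).2.1

lemma SectorBound.real_le {s : ℝ} (hs : 0 ≤ s) :
    ‖resolvent A ((s + c : ℝ) : ℂ)‖ ≤ M / (c - ω + s) := by
  obtain ⟨h1, h2, h3⟩ := hA.real_cond hc hs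
  rw [← h3]; exact hA.le _ h1 h2

lemma SectorBound.nonneg : 0 ≤ M := by
  have h := (norm_nonneg _).trans (hA.real_le hc le_rfl)
  have : 0 < c - ω + 0 := by linarith
  by_contra! hM
  exact absurd h (not_le.2 (div_neg_of_neg_of_pos hM this))

lemma SectorBound.continuousOn : ContinuousOn (fun s : ℝ => resolvent A ((s + c : ℝ) : ℂ))
    (Set.Ici 0) := by
  intro s hs
  refine ContinuousAt.continuousWithinAt ?_
  exact ContinuousAt.comp (f := fun s : ℝ => ((s + c : ℝ) : ℂ))
    (differentiableAt_resolvent (hA.real_mem hc hs)).continuousAt (by fun_prop)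

lemma SectorBound.integrableOn {β : ℝ} (h0 : 0 < β) (h1 : β < 1) :
    IntegrableOn (fun s : ℝ => s ^ (-β) • resolvent A ((s + c : ℝ) : ℂ)) (Set.Ioi 0) := by
  have hcω : 0 < c - ω := by linarith
  refine ((integrableOn_rpow_neg_div h0 h1 hcω).const_mul M).mono' ?_ ?_
  · have h2 : ContinuousOn (fun s : ℝ => s ^ (-β)) (Set.Ioi 0) := fun s hs =>
      (Real.continuousAt_rpow_const _ _ (Or.inl (ne_of_gt hs))).continuousWithinAt
    exact (h2.smul ((hA.continuousOn hc).mono Set.Ioi_subset_Ici_self)).aestronglyMeasurable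
      measurableSet_Ioi
  · filter_upwards [ae_restrict_mem measurableSet_Ioi] with s hs
    have hs0 : (0 : ℝ) < s := hs
    have := hA.real_le hc hs0.le
    rw [norm_smul, Real.norm_of_nonneg (Real.rpow_nonneg hs0.le _)]
    calc _ ≤ s ^ (-β) * (M / (c - ω + s)) := by gcongr
      _ = _ := by ring

/-- By the resolvent identity the product is `(F s - F (u s)) / (s (u - 1))`, so this is a Frullani
integral whose value at infinity vanishes. -/
lemma SectorBound.integral_mul_scaled {u : ℝ} (hu : 0 < u) (hu1 : u ≠ 1) :
    IntegrableOn (fun s : ℝ => resolvent A ((s + c : ℝ) : ℂ) * resolvent A ((s * u + c : ℝ) : ℂ))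
      (Set.Ioi 0) ∧
    ∫ s in Set.Ioi (0 : ℝ), resolvent A ((s + c : ℝ) : ℂ) * resolvent A ((s * u + c : ℝ) : ℂ) =
      (Real.log u / (u - 1)) • resolvent A ((0 + c : ℝ) : ℂ) := by
  have hcω : 0 < c - ω := by linarith
  have hM := hA.nonneg hc
  set F : ℝ → X →L[ℂ] X := fun s => resolvent A ((s + c : ℝ) : ℂ) with hF
  have hFc : ContinuousOn F (Set.Ici 0) := hA.continuousOn hc
  have hFu : ContinuousOn (fun s => F (s * u)) (Set.Ici 0) :=
    hFc.comp (by fun_prop) fun s (hs : 0 ≤ s) => mul_nonneg hs hu.le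
  have hsmeas : AEStronglyMeasurable (fun s => F s * F (s * u)) (volume.restrict (Set.Ioi 0)) :=
    ((hFc.mul hFu).mono Set.Ioi_subset_Ici_self).aestronglyMeasurable measurableSet_Ioi
  have hint : IntegrableOn (fun s : ℝ => F s * F (s * u)) (Set.Ioi 0) := by
    have hb := integrable_one_add_abs_inv_sq.integrableOn (s := Set.Ioi (0 : ℝ))
    obtain ⟨m, hm0, hm1, hm2⟩ : ∃ m : ℝ, 0 < m ∧ m ≤ c - ω ∧ m ≤ 1 ∧ m ≤ u :=
      ⟨min (c - ω) (min 1 u), lt_min hcω (lt_min one_pos hu), min_le_left _ _,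
        (min_le_right _ _).trans (min_le_left _ _), (min_le_right _ _).trans (min_le_right _ _)⟩
    refine (hb.const_mul (M ^ 2 / m ^ 2)).mono' hsmeas ?_
    filter_upwards [ae_restrict_mem measurableSet_Ioi] with s hs
    have hs0 : (0 : ℝ) < s := hs
    have e1 := hA.real_le hc hs0.le
    have e2 := hA.real_le hc (mul_pos hs0 hu).le
    rw [abs_of_pos hs0]
    have l1 : m * (1 + s) ≤ c - ω + s := by nlinarith
    have l2 : m * (1 + s) ≤ c - ω + s * u := by nlinarith
    calc ‖F s * F (s * u)‖ ≤ ‖F s‖ * ‖F (s * u)‖ := norm_mul_le _ _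
      _ ≤ (M / (m * (1 + s))) * (M / (m * (1 + s))) := by
        gcongr
        · exact e1.trans (by gcongr)
        · exact e2.trans (by gcongr)
      _ = _ := by field_simp
  refine ⟨hint, ?_⟩
  have hid : ∀ s ∈ Set.Ioi (0 : ℝ), F s * F (s * u) = (u - 1)⁻¹ • (s⁻¹ • (F (1 * s) - F (u * s))) := by
    intro s hs
    have hs0 : (0 : ℝ) < s := hs
    have hsne : (s : ℂ) ≠ 0 := by exact_mod_cast hs0.ne'
    have hune : (u : ℂ) - 1 ≠ 0 := by
      rw [sub_ne_zero]; exact_mod_cast hu1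
    ext y
    have h1 := resolvent_identity (hA.real_mem hc hs0.le) (hA.real_mem hc (mul_pos hs0 hu).le) y
    rw [resolvent_comm (hA.real_mem hc hs0.le) (hA.real_mem hc (mul_pos hs0 hu).le)] at h1
    have h2 : F s y - F (s * u) y = ((s * (u - 1) : ℝ)) • F s (F (s * u) y) := by
      simp only [hF]
      rw [sub_eq_iff_eq_add', ← Complex.coe_smul]
      conv_lhs => rw [h1]
      congr 2; push_cast; ring
    rw [one_mul, mul_comm u s]
    simp only [smul_apply, sub_apply, h2]
    rw [smul_smul, smul_smul]
    have : (u - 1)⁻¹ * s⁻¹ * (s * (u - 1)) = 1 := by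
      have : u - 1 ≠ 0 := sub_ne_zero.2 hu1
      field_simp
    rw [this, one_smul]; rfl
  have hlim : Tendsto F atTop (𝓝 0) := by
    have h2 : Tendsto (fun s : ℝ => M / (c - ω + s)) atTop (𝓝 0) :=
      Tendsto.const_div_atTop (tendsto_atTop_add_const_left _ _ tendsto_id) _
    refine squeeze_zero_norm' ?_ h2
    filter_upwards [eventually_ge_atTop 0] with s hs
    exact hA.real_le hc hs
  have hlim0 : Tendsto F (𝓝[>] 0) (𝓝 (F 0)) :=
    ((hFc 0 (by simp)).mono Set.Ioi_subset_Ici_self).tendsto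
  have hfr := Frullani.integral_Ioi_eq (f := F) (a := 1) (b := u)
    ((hFc.mono Set.Ioi_subset_Ici_self).locallyIntegrableOn measurableSet_Ioi) one_pos hu hlim0 hlim
    (by
      have h3 : IntegrableOn (fun s => (u - 1) • (F s * F (s * u))) (Set.Ioi 0) :=
        Integrable.smul (u - 1) hint
      refine IntegrableOn.congr_fun h3 (fun s hs => ?_) measurableSet_Ioi
      rw [hid s hs, smul_smul, mul_inv_cancel₀ (sub_ne_zero.2 hu1), one_smul])
  have : ∀ s ∈ Set.Ioi (0 : ℝ), resolvent A ((s + c : ℝ) : ℂ) * resolvent A ((s * u + c : ℝ) : ℂ) =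
      (u - 1)⁻¹ • (s⁻¹ • (F (1 * s) - F (u * s))) := hid
  rw [setIntegral_congr_fun measurableSet_Ioi this, integral_smul, hfr, smul_smul, div_one,
    sub_zero, mul_comm, ← div_eq_mul_inv]

end RealAxis

end

/-! ### The fractional power space as a Banach space; the product law for fractional integrals -/

section

variable {X : Type*} [NormedAddCommGroup X] [NormedSpace ℂ X]

namespace FracSpace

variable {A : X →ₗ.[ℂ] X} {c α : ℝ}

/-- The operator `(c - A)^(-α)` as a map onto the fractional power space. -/
def mkL (A : X →ₗ.[ℂ] X) (c α : ℝ) : X →L[ℂ] FracSpace A c α :=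
  LinearMap.mkContinuous
    (LinearMap.rangeRestrict (negFracPower A c α : X →ₗ[ℂ] X) : X →ₗ[ℂ] FracSpace A c α) 1
    (fun y =>
      have h : fracPower A c α (LinearMap.rangeRestrict (negFracPower A c α : X →ₗ[ℂ] X) y) =
          Submodule.Quotient.mk y :=
        (LinearEquiv.symm_apply_eq (LinearMap.quotKerEquivRange _)).2 rfl
      (congrArg norm h).le.trans
        ((Submodule.Quotient.norm_mk_le _ y).trans (one_mul ‖y‖).symm.le))

lemma toBase_mkL (y : X) : toBase (mkL A c α y) = negFracPower A c α y := rfl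

lemma norm_mkL_le (y : X) : ‖mkL A c α y‖ ≤ ‖y‖ := by
  refine ((mkL A c α).le_opNorm y).trans ?_
  refine mul_le_of_le_one_left (norm_nonneg _) (LinearMap.mkContinuous_norm_le _ zero_le_one _)

lemma fracPower_mkL (y : X) : fracPower A c α (mkL A c α y) = Submodule.Quotient.mk y :=
  (LinearEquiv.symm_apply_eq (LinearMap.quotKerEquivRange _)).2 rfl

/-- The norm of `X^α` is a quotient norm, so preimages of almost equal norm exist. With this and
`norm_le_of_mkL` the injectivity of `(c - A)^(-α)` is never needed. -/
lemma exists_mkL_eq (x : FracSpace A c α) {ε : ℝ} (hε : 0 < ε) :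
    ∃ y, mkL A c α y = x ∧ ‖y‖ < ‖x‖ + ε := by
  obtain ⟨y, hy, hlt⟩ := Submodule.Quotient.norm_mk_lt (fracPower A c α x) hε
  refine ⟨y, ?_, hlt⟩
  apply (fracPower A c α).injective
  rw [fracPower_mkL, hy]

lemma norm_le_of_mkL {E : Type*} [NormedAddCommGroup E] [NormedSpace ℂ E] {T : FracSpace A c α → E}
    {C : ℝ} (hC : 0 ≤ C) (h : ∀ y, ‖T (mkL A c α y)‖ ≤ C * ‖y‖) (x : FracSpace A c α) :
    ‖T x‖ ≤ C * ‖x‖ := by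
  refine le_of_forall_pos_le_add fun ε hε => ?_
  obtain ⟨y, hy, hlt⟩ := exists_mkL_eq x (ε := ε / (C + 1)) (by positivity)
  rw [← hy] at hlt ⊢
  refine (h y).trans ?_
  calc C * ‖y‖ ≤ C * (‖mkL A c α y‖ + ε / (C + 1)) := by gcongr
    _ = C * ‖mkL A c α y‖ + ε * (C / (C + 1)) := by ring
    _ ≤ _ := by
      gcongr
      refine mul_le_of_le_one_right hε.le ?_
      rw [div_le_one (by positivity)]; linarith

/-- The inclusion of `X^α` in `X`, as a continuous linear map. -/
def toBaseL : FracSpace A c α →L[ℂ] X :=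
  LinearMap.mkContinuous toBase ‖negFracPower A c α‖
    (norm_le_of_mkL (norm_nonneg _) fun y => (negFracPower A c α).le_opNorm y)

lemma toBaseL_apply (x : FracSpace A c α) : toBaseL x = x.toBase := rfl

lemma toBaseL_injective : Function.Injective (toBaseL : FracSpace A c α →L[ℂ] X) :=
  Subtype.val_injective

instance [CompleteSpace X] : CompleteSpace (FracSpace A c α) := by
  -- `X^α` is isometric to a quotient of `X` by a closed subspace.
  have hi : Isometry (fracPower A c α) :=
    AddMonoidHomClass.isometry_of_norm (fracPower A c α) fun x => rfl
  refine (completeSpace_iff_isComplete_range hi.isUniformInducing).2 ?_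
  rw [(fracPower A c α).surjective.range_eq]
  exact isComplete_univ

end FracSpace

variable [CompleteSpace X]

open FracSpace

/-- The law `(c - A)^(-α) (c - A)^(-(1 - α)) = (c - A)⁻¹` up to normalization. Substituting `t = s
u` in the second factor and exchanging the integrals, the `s`-integral becomes
`SectorBound.integral_mul_scaled`. Only the positivity of `κ` matters, so its value is not computed.
-/
lemma SectorBound.mul_integrals {A : X →ₗ.[ℂ] X} {ω k M c α : ℝ} (hA : SectorBound A ω k M)
    (hc : ω < c) (h0 : 0 < α) (h1 : α < 1) (hne : resolvent A ((0 + c : ℝ) : ℂ) ≠ 0) :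
    ∃ κ : ℝ, 0 < κ ∧
      (∫ s in Set.Ioi (0 : ℝ), s ^ (-α) • resolvent A ((s + c : ℝ) : ℂ)) *
      (∫ s in Set.Ioi (0 : ℝ), s ^ (-(1 - α)) • resolvent A ((s + c : ℝ) : ℂ)) =
        κ • resolvent A ((0 + c : ℝ) : ℂ) := by
  have hcω : 0 < c - ω := by linarith
  have hM := hA.nonneg hc
  have hα1 : 0 < 1 - α := by linarith
  have hα2 : 1 - α < 1 := by linarith
  set F : ℝ → X →L[ℂ] X := fun s => resolvent A ((s + c : ℝ) : ℂ) with hF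
  have hFc : ContinuousOn F (Set.Ici 0) := hA.continuousOn hc
  have hFle : ∀ s, 0 ≤ s → ‖F s‖ ≤ M / (c - ω + s) := fun s hs => hA.real_le hc hs
  set N := ∫ s in Set.Ioi (0 : ℝ), s ^ (-(1 - α)) • F s with hN
  set K : ℝ → ℝ → X →L[ℂ] X := fun s u => u ^ (-(1 - α)) • (F s * F (s * u)) with hK
  have hgi : IntegrableOn (fun s : ℝ => s ^ (-(1 - α)) • F s) (Set.Ioi 0) :=
    hA.integrableOn hc hα1 hα2
  have hsc : ∀ s, 0 < s → ∀ u ∈ Set.Ioi (0 : ℝ),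
      (s * u) ^ (-(1 - α)) • F (s * u) = (s ^ (-(1 - α)) * u ^ (-(1 - α))) • F (s * u) := by
    intro s hs u hu
    rw [Real.mul_rpow hs.le (le_of_lt hu)]
  have hKs : ∀ s, 0 < s → IntegrableOn (K s) (Set.Ioi 0) := by
    intro s hs
    have h2 := (integrableOn_Ioi_comp_mul_left_iff (fun t : ℝ => t ^ (-(1 - α)) • F t) 0 hs).2
      (by rwa [mul_zero])
    have h3 := (h2.const_mul (F s)).smul (s ^ (1 - α))
    refine IntegrableOn.congr_fun h3 (fun u hu => ?_) measurableSet_Ioi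
    simp only [Pi.smul_apply]
    rw [hsc s hs u hu, mul_smul_comm, smul_smul, ← mul_assoc, ← Real.rpow_add hs, add_neg_cancel,
      Real.rpow_zero, one_mul]
  have hinner : ∀ s ∈ Set.Ioi (0 : ℝ), s ^ (-α) • F s * N = ∫ u in Set.Ioi (0 : ℝ), K s u := by
    intro s hs
    have hs0 : (0 : ℝ) < s := hs
    have h2 := integral_comp_mul_left_Ioi' (fun t : ℝ => t ^ (-(1 - α)) • F t) 0 hs0
    rw [mul_zero, ← hN, setIntegral_congr_fun measurableSet_Ioi (hsc s hs0)] at h2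
    simp_rw [mul_smul] at h2
    rw [integral_smul, smul_smul] at h2
    have h3 : ∫ u in Set.Ioi (0 : ℝ), K s u =
        F s * ∫ u in Set.Ioi (0 : ℝ), u ^ (-(1 - α)) • F (s * u) := by
      rw [← integral_const_mul_of_integrable]
      · simp only [hK, mul_smul_comm]
      · have h2 := (integrableOn_Ioi_comp_mul_left_iff (fun t : ℝ => t ^ (-(1 - α)) • F t) 0 hs0).2
          (by rwa [mul_zero])
        have h3 := h2.smul (s ^ (1 - α))
        refine IntegrableOn.congr_fun h3 (fun u hu => ?_) measurableSet_Ioi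
        simp only [Pi.smul_apply]
        rw [hsc s hs0 u hu, smul_smul, ← mul_assoc, ← Real.rpow_add hs0, add_neg_cancel,
          Real.rpow_zero, one_mul]
    rw [h3, ← h2, smul_mul_assoc, mul_smul_comm, smul_smul]
    have : s ^ (-α) * (s * s ^ (-(1 - α))) = 1 := by
      nth_rewrite 2 [← Real.rpow_one s]
      rw [← Real.rpow_add hs0, ← Real.rpow_add hs0]
      ring_nf; simp
    rw [this, one_smul]
  have hmeas : AEStronglyMeasurable (Function.uncurry K)
      ((volume.restrict (Set.Ioi 0)).prod (volume.restrict (Set.Ioi 0))) := by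
    rw [Measure.prod_restrict]
    refine ContinuousOn.aestronglyMeasurable ?_ (measurableSet_Ioi.prod measurableSet_Ioi)
    have c1 : ContinuousOn (fun x : ℝ × ℝ => x.2 ^ (-(1 - α))) (Set.Ioi 0 ×ˢ Set.Ioi 0) := by
      intro x hx
      exact (ContinuousAt.comp (f := Prod.snd) (x := x) (g := fun t : ℝ => t ^ (-(1 - α)))
        (Real.continuousAt_rpow_const _ _ (Or.inl (ne_of_gt hx.2)))
        continuous_snd.continuousAt).continuousWithinAt
    have c2 : ContinuousOn (fun x : ℝ × ℝ => F x.1) (Set.Ioi 0 ×ˢ Set.Ioi 0) :=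
      hFc.comp continuousOn_fst fun x hx => (le_of_lt hx.1 : (0 : ℝ) ≤ x.1)
    have c3 : ContinuousOn (fun x : ℝ × ℝ => F (x.1 * x.2)) (Set.Ioi 0 ×ˢ Set.Ioi 0) :=
      hFc.comp (by fun_prop) fun x hx => ((mul_pos hx.1 hx.2).le : (0 : ℝ) ≤ x.1 * x.2)
    exact c1.smul (c2.mul c3)
  have hprod : Integrable (Function.uncurry K)
      ((volume.restrict (Set.Ioi 0)).prod (volume.restrict (Set.Ioi 0))) := by
    rw [integrable_prod_iff hmeas]
    constructor
    · filter_upwards [ae_restrict_mem measurableSet_Ioi] with s hs using hKs s hs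
    · set I := ∫ u in Set.Ioi (0 : ℝ), u ^ (-(1 - α)) / (1 + u) with hIdef
      have hI : 0 ≤ I := setIntegral_nonneg measurableSet_Ioi fun u hu => by
        have : (0 : ℝ) < u := hu
        positivity
      -- Rescaling `u` by `(c - ω) / s` bounds the inner integral of the norm by a multiple of `s ^
      -- (-α) / (c - ω + s)`.
      refine ((integrableOn_rpow_neg_div h0 h1 hcω).const_mul
        (M ^ 2 * (c - ω) ^ (-(1 - α)) * I)).mono' hmeas.norm.integral_prod_right' ?_
      filter_upwards [ae_restrict_mem measurableSet_Ioi] with s hs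
      have hs0 : (0 : ℝ) < s := hs
      rw [Real.norm_of_nonneg (integral_nonneg fun _ => norm_nonneg _)]
      have hr : 0 < (c - ω) / s := by positivity
      have hb : ∀ u ∈ Set.Ioi (0 : ℝ), ‖Function.uncurry K (s, u)‖ ≤
          M ^ 2 / (c - ω + s) * s⁻¹ * (u ^ (-(1 - α)) / ((c - ω) / s + u)) := by
        intro u hu
        have hu0 : (0 : ℝ) < u := hu
        simp only [Function.uncurry_apply_pair, hK]
        rw [norm_smul, Real.norm_of_nonneg (Real.rpow_nonneg hu0.le _)]
        calc _ ≤ u ^ (-(1 - α)) * (M / (c - ω + s) * (M / (c - ω + s * u))) := by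
              gcongr
              refine (norm_mul_le _ _).trans ?_
              gcongr
              · exact hFle s hs0.le
              · exact hFle _ (mul_pos hs0 hu0).le
          _ = _ := by field_simp
      refine (setIntegral_mono_on (hKs s hs0).norm
        ((integrableOn_rpow_neg_div hα1 hα2 hr).const_mul _) measurableSet_Ioi hb).trans
        (le_of_eq ?_)
      rw [integral_const_mul, integral_rpow_neg_div hr, Real.div_rpow hcω.le hs0.le]
      have : (s ^ (-(1 - α)))⁻¹ * s⁻¹ = s ^ (-α) := by
        rw [← Real.rpow_neg hs0.le, ← Real.rpow_neg_one s, ← Real.rpow_add hs0]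
        congr 1; ring
      rw [← this, ← hIdef]
      field_simp
  have hae : ∀ᵐ u ∂(volume.restrict (Set.Ioi (0 : ℝ))), ∫ s in Set.Ioi (0 : ℝ), K s u =
      (u ^ (-(1 - α)) * (Real.log u / (u - 1))) • F 0 := by
    have hne1 : ∀ᵐ u ∂(volume.restrict (Set.Ioi (0 : ℝ))), u ≠ 1 :=
      ae_restrict_of_ae (by simp [ae_iff])
    filter_upwards [hne1, ae_restrict_mem measurableSet_Ioi] with u hu1 hu
    simp only [hK]
    rw [integral_smul, (hA.integral_mul_scaled hc hu hu1).2, smul_smul]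
  -- The scalar weight inherits its integrability from Fubini, because it multiplies a fixed nonzero
  -- operator.
  have hφ : IntegrableOn (fun u : ℝ => u ^ (-(1 - α)) * (Real.log u / (u - 1))) (Set.Ioi 0) := by
    have h2 := (integrable_congr hae).1 hprod.integral_prod_right
    exact (integrable_smul_const hne).1 h2
  refine ⟨∫ u in Set.Ioi (0 : ℝ), u ^ (-(1 - α)) * (Real.log u / (u - 1)), ?_, ?_⟩
  · have hnn : ∀ u ∈ Set.Ioi (0 : ℝ), 0 ≤ u ^ (-(1 - α)) * (Real.log u / (u - 1)) := by
      intro u hu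
      have hu0 : (0 : ℝ) < u := hu
      refine mul_nonneg (Real.rpow_nonneg hu0.le _) ?_
      rcases le_total 1 u with h | h
      · exact div_nonneg (Real.log_nonneg h) (by linarith)
      · exact div_nonneg_of_nonpos (Real.log_nonpos hu0.le h) (by linarith)
    rw [setIntegral_pos_iff_support_of_nonneg_ae _ hφ]
    · refine lt_of_lt_of_le ?_ (measure_mono (s := Set.Ioi (1 : ℝ)) ?_)
      · simp
      · intro u hu
        have hu1 : (1 : ℝ) < u := hu
        have hu0 : (0 : ℝ) < u := one_pos.trans hu1
        refine ⟨?_, hu0⟩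
        rw [Function.mem_support]
        exact (mul_pos (Real.rpow_pos_of_pos hu0 _)
          (div_pos (Real.log_pos hu1) (by linarith))).ne'
    · filter_upwards [ae_restrict_mem measurableSet_Ioi] with u hu using hnn u hu
  · rw [← integral_mul_const_of_integrable (hA.integrableOn hc h0 h1),
      setIntegral_congr_fun measurableSet_Ioi hinner, integral_integral_swap hprod,
      integral_congr_ae hae, integral_smul_const]

end

section

/-! ### Resolvents with values in the fractional power space -/

variable {X : Type*} [NormedAddCommGroup X] [NormedSpace ℂ X] [CompleteSpace X]

open FracSpace

section Fractional

variable {A : X →ₗ.[ℂ] X} {ω k M c α : ℝ}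

/-- The vector `y - (z - c) • resolvent A z y` is `(c - A)(z - A)⁻¹ y`. For `t ≤ ‖z - c‖` the
resolvent identity removes the unbounded factor and gives `1 / ‖z - c‖`; for larger `t` the sector
bound gives `1 / t`. -/
lemma SectorBound.norm_resolvent_defect_le (hA : SectorBound A ω k M) (hc : ω < c) {z : ℂ}
    (hz : z ∈ resolventSet A) (hzc : z ≠ c) {B : ℝ} (hB : 0 ≤ B)
    (hzB : ‖resolvent A z‖ ≤ B / ‖z - c‖) {t : ℝ} (ht : 0 < t) (y : X) :
    ‖resolvent A ((t + c : ℝ) : ℂ) (y - (z - c) • resolvent A z y)‖ ≤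
      2 * (1 + M) * (1 + B) * ‖y‖ / (‖z - c‖ + t) := by
  have hM := hA.nonneg hc
  have hn : 0 < ‖z - c‖ := norm_pos_iff.2 (sub_ne_zero.2 hzc)
  have hw := hA.real_mem hc ht.le
  have hwle := hA.real_le hc ht.le
  have hcω : 0 < c - ω := by linarith
  have hzy : ‖resolvent A z y‖ ≤ B / ‖z - c‖ * ‖y‖ :=
    ((resolvent A z).le_opNorm y).trans (by gcongr)
  rcases le_total t ‖z - c‖ with h | h
  · have e : resolvent A ((t + c : ℝ) : ℂ) (y - (z - c) • resolvent A z y) =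
        resolvent A z y - (t : ℂ) • resolvent A ((t + c : ℝ) : ℂ) (resolvent A z y) := by
      have := resolvent_identity hz hw y
      rw [map_sub, map_smul, eq_sub_of_add_eq this.symm]
      push_cast
      module
    rw [e]
    have h2 : ‖(t : ℂ) • resolvent A ((t + c : ℝ) : ℂ) (resolvent A z y)‖ ≤
        M * (B / ‖z - c‖ * ‖y‖) := by
      rw [norm_smul, Complex.norm_real, Real.norm_of_nonneg ht.le]
      calc t * _ ≤ t * (M / (c - ω + t) * (B / ‖z - c‖ * ‖y‖)) := by
            gcongr
            exact (ContinuousLinearMap.le_opNorm _ _).trans (by gcongr)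
        _ = (t / (c - ω + t)) * (M * (B / ‖z - c‖ * ‖y‖)) := by ring
        _ ≤ 1 * _ := by
            gcongr
            rw [div_le_one (by positivity)]; linarith
        _ = _ := one_mul _
    calc _ ≤ B / ‖z - c‖ * ‖y‖ + M * (B / ‖z - c‖ * ‖y‖) :=
          (norm_sub_le _ _).trans (add_le_add hzy h2)
      _ = (1 + M) * B * ‖y‖ / ‖z - c‖ := by ring
      _ ≤ 2 * (1 + M) * (1 + B) * ‖y‖ / (‖z - c‖ + t) := by
          rw [div_le_div_iff₀ hn (by positivity)]
          have : 0 ≤ (1 + M) * ‖y‖ := by positivity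
          have h3 : B * (‖z - c‖ + t) ≤ 2 * (1 + B) * ‖z - c‖ := by nlinarith
          nlinarith
  · have h1 : ‖y - (z - c) • resolvent A z y‖ ≤ (1 + B) * ‖y‖ := by
      refine (norm_sub_le _ _).trans ?_
      rw [norm_smul]
      have : ‖z - c‖ * ‖resolvent A z y‖ ≤ ‖z - c‖ * (B / ‖z - c‖ * ‖y‖) := by gcongr
      have e : ‖z - c‖ * (B / ‖z - c‖ * ‖y‖) = B * ‖y‖ := by field_simp
      linarith
    calc _ ≤ M / (c - ω + t) * ((1 + B) * ‖y‖) :=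
          (ContinuousLinearMap.le_opNorm _ _).trans (by gcongr)
      _ ≤ (1 + M) / t * ((1 + B) * ‖y‖) := by
          gcongr <;> linarith
      _ = (1 + M) * (1 + B) * ‖y‖ / t := by ring
      _ ≤ _ := by
          rw [div_le_div_iff₀ ht (by positivity)]
          have : 0 ≤ (1 + M) * (1 + B) * ‖y‖ := by positivity
          nlinarith

/-- `S` is `(c - A)⁻¹` factored through `(c - A)^(-α)`, so it takes values in `X^α`. The estimate is
the decay of `(z - A)⁻¹` from `X` to `X^α` with exponent `1 - α`, because `S` maps `(c - A)(z - A)⁻¹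
y` to the lift of `(z - A)⁻¹ y`. -/
lemma SectorBound.exists_lift_base (hA : SectorBound A ω k M) (hc : ω < c) (h0 : 0 ≤ α)
    (h1 : α < 1) : ∃ S : X →L[ℂ] FracSpace A c α, toBaseL ∘L S = resolvent A (c : ℂ) ∧
      ∃ C : ℝ, 0 ≤ C ∧ ∀ z ∈ resolventSet A, z ≠ c → ∀ B : ℝ, 0 ≤ B →
        ‖resolvent A z‖ ≤ B / ‖z - c‖ →
        ∀ y, ‖S (y - (z - c) • resolvent A z y)‖ ≤ C * (1 + B) * ‖z - c‖ ^ (-(1 - α)) * ‖y‖ := by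
  have hcm : (c : ℂ) ∈ resolventSet A := by simpa using hA.real_mem hc (le_refl (0 : ℝ))
  have hM := hA.nonneg hc
  rcases h0.eq_or_lt with rfl | h0
  · refine ⟨mkL A c 0 ∘L resolvent A c, ?_, 1, zero_le_one, ?_⟩
    · ext y
      simp [toBaseL_apply, toBase_mkL, negFracPower]
    · intro z hz hzc B hB hzB y
      have hn : 0 < ‖z - c‖ := norm_pos_iff.2 (sub_ne_zero.2 hzc)
      have e : resolvent A c (y - (z - c) • resolvent A z y) = resolvent A z y := by
        have := resolvent_identity hz hcm y
        rw [map_sub, map_smul, eq_sub_of_add_eq this.symm]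
        module
      rw [ContinuousLinearMap.comp_apply, e]
      refine (norm_mkL_le _).trans (((resolvent A z).le_opNorm y).trans ?_)
      gcongr
      refine hzB.trans ?_
      rw [one_mul, sub_zero, Real.rpow_neg_one, ← div_eq_mul_inv]
      gcongr
      linarith
  -- A vanishing resolvent occurs only for trivial `X`; `SectorBound.mul_integrals` excludes this
  -- case.
  by_cases hne : resolvent A ((0 + c : ℝ) : ℂ) = 0
  · refine ⟨0, ?_, 0, le_rfl, ?_⟩
    · rw [zero_add] at hne
      rw [hne]; simp
    · intro z hz hzc B hB hzB y
      simp
  obtain ⟨κ, hκ, hmul⟩ := hA.mul_integrals hc h0 h1 hne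
  set N := ∫ s in Set.Ioi (0 : ℝ), s ^ (-(1 - α)) • resolvent A ((s + c : ℝ) : ℂ) with hN
  have hα1 : 0 < 1 - α := by linarith
  have hα2 : 1 - α < 1 := by linarith
  have hsin : 0 < Real.sin (Real.pi * α) / Real.pi := by
    refine div_pos (Real.sin_pos_of_pos_of_lt_pi (by positivity) ?_) Real.pi_pos
    nlinarith [Real.pi_pos]
  set κ' := Real.sin (Real.pi * α) / Real.pi * κ with hκ'
  have hκ'0 : 0 < κ' := mul_pos hsin hκ
  refine ⟨((κ'⁻¹ : ℝ) : ℂ) • (mkL A c α ∘L N), ?_,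
    κ'⁻¹ * (2 * (1 + M) * ∫ u in Set.Ioi (0 : ℝ), u ^ (-(1 - α)) / (1 + u)), ?_, ?_⟩
  · ext y
    have e := congrArg (fun T : X →L[ℂ] X => T y) hmul
    simp only [ContinuousLinearMap.comp_apply, smul_apply, map_smul, toBaseL_apply, toBase_mkL]
    rw [negFracPower, if_neg h0.ne']
    simp only [ContinuousLinearMap.mul_def, ContinuousLinearMap.comp_apply, smul_apply,
      zero_add] at e ⊢
    rw [e]
    rw [← Complex.coe_smul κ, ← Complex.coe_smul, smul_smul, smul_smul, ← Complex.ofReal_mul,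
      ← Complex.ofReal_mul]
    rw [mul_assoc, ← hκ', inv_mul_cancel₀ hκ'0.ne']
    simp
  · have : 0 ≤ ∫ u in Set.Ioi (0 : ℝ), u ^ (-(1 - α)) / (1 + u) :=
      setIntegral_nonneg measurableSet_Ioi fun u hu => by
        have : (0 : ℝ) < u := hu
        positivity
    positivity
  · intro z hz hzc B hB hzB y
    have hn : 0 < ‖z - c‖ := norm_pos_iff.2 (sub_ne_zero.2 hzc)
    set v := y - (z - c) • resolvent A z y with hv
    have hNv : ‖N v‖ ≤ 2 * (1 + M) * (1 + B) * ‖y‖ *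
        (‖z - c‖ ^ (-(1 - α)) * ∫ u in Set.Ioi (0 : ℝ), u ^ (-(1 - α)) / (1 + u)) := by
      rw [hN, ContinuousLinearMap.integral_apply (hA.integrableOn hc hα1 hα2),
        ← integral_rpow_neg_div hn, ← integral_const_mul]
      refine norm_integral_le_of_norm_le ((integrableOn_rpow_neg_div hα1 hα2 hn).const_mul _) ?_
      filter_upwards [ae_restrict_mem measurableSet_Ioi] with s hs
      have hs0 : (0 : ℝ) < s := hs
      rw [smul_apply, norm_smul, Real.norm_of_nonneg (Real.rpow_nonneg hs0.le _)]
      calc _ ≤ s ^ (-(1 - α)) * (2 * (1 + M) * (1 + B) * ‖y‖ / (‖z - c‖ + s)) := by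
            gcongr
            exact hA.norm_resolvent_defect_le hc hz hzc hB hzB hs0 y
        _ = _ := by ring
    simp only [smul_apply, ContinuousLinearMap.comp_apply]
    rw [norm_smul, Complex.norm_real, Real.norm_of_nonneg (by positivity)]
    calc _ ≤ κ'⁻¹ * (2 * (1 + M) * (1 + B) * ‖y‖ *
        (‖z - c‖ ^ (-(1 - α)) * ∫ u in Set.Ioi (0 : ℝ), u ^ (-(1 - α)) / (1 + u))) := by
          gcongr
          exact (norm_mkL_le _).trans hNv
      _ = _ := by ring

lemma SectorBound.negFracPower_comm (hA : SectorBound A ω k M) (hc : ω < c) (h0 : 0 ≤ α)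
    (h1 : α < 1) {z : ℂ} (hz : z ∈ resolventSet A) (y : X) :
    resolvent A z (negFracPower A c α y) = negFracPower A c α (resolvent A z y) := by
  rcases h0.eq_or_lt with rfl | h0
  · simp [negFracPower]
  have hi := hA.integrableOn hc h0 h1
  rw [negFracPower, if_neg h0.ne', smul_apply, smul_apply,
    ContinuousLinearMap.integral_apply hi, ContinuousLinearMap.integral_apply hi,
    ← Complex.coe_smul, ← Complex.coe_smul, map_smul,
    ← ContinuousLinearMap.integral_comp_comm _ (hi.apply_continuousLinearMap y)]
  congr 1
  refine setIntegral_congr_fun measurableSet_Ioi fun s hs => ?_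
  have hs0 : (0 : ℝ) < s := hs
  simp only [smul_apply]
  rw [← Complex.coe_smul, ← Complex.coe_smul, map_smul, resolvent_comm (hA.real_mem hc hs0.le) hz]

end Fractional

/-- A lifted resolvent on a sector `-(k‖z‖) ≤ Re z`, `r ≤ ‖z‖`, with its decay. -/
structure SectorLift {X Y : Type*} [NormedAddCommGroup X] [NormedSpace ℂ X]
    [NormedAddCommGroup Y] [NormedSpace ℂ Y] (J : Y →L[ℂ] X) (L : X →ₗ.[ℂ] X)
    (R : ℂ → X →L[ℂ] Y) (k r B γ : ℝ) : Prop where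
  lift : IsLift J L R
  pos : 0 < k
  rate_pos : 0 < γ
  rate_le : γ ≤ 1
  mem : ∀ z : ℂ, r ≤ ‖z‖ → -(k * ‖z‖) ≤ z.re → z ∈ resolventSet L
  bound : ∀ z : ℂ, r ≤ ‖z‖ → -(k * ‖z‖) ≤ z.re → ‖R z‖ ≤ B * (1 + ‖z‖) ^ (-γ)
  bound_comp : ∀ z : ℂ, r ≤ ‖z‖ → -(k * ‖z‖) ≤ z.re → ‖R z ∘L J‖ ≤ B * (1 + ‖z‖)⁻¹

/-- Outside a large disc, the sector with vertex `0` and opening `k / 2` lies in the one with vertex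
`ω` and opening `k`. There `SectorBound.exists_lift_base` gives the decay. -/
lemma SectorBound.sectorLift {A : X →ₗ.[ℂ] X} {ω k M c α : ℝ} (hA : SectorBound A ω k M)
    (hc : ω < c) (h0 : 0 ≤ α) (h1 : α < 1) :
    ∃ (R : ℂ → X →L[ℂ] FracSpace A c α) (k r B : ℝ), SectorLift toBaseL A R k r B (1 - α) := by
  have hcm : (c : ℂ) ∈ resolventSet A := by simpa using hA.real_mem hc (le_refl (0 : ℝ))
  have hM := hA.nonneg hc
  obtain ⟨S, hS, C, hC, hSC⟩ := hA.exists_lift_base hc h0 h1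
  have hSr : IsResolventAt A c (toBaseL ∘L S) := hS ▸ isResolventAt_resolvent hcm
  obtain ⟨R, hR⟩ := exists_isLift toBaseL_injective hSr
  have hk := hA.pos
  -- Chosen so that for `r ≤ ‖z‖` the change of vertex costs at most half of the opening, and `‖z -
  -- ω‖` and `‖z - c‖` are at least half of `‖z‖`.
  set r : ℝ := 1 + 2 * (|ω| + |c|) * (1 + k) / k + 2 * (|ω| + |c|) with hr
  have hrω : 1 + 2 * (|ω| + |c|) ≤ r := by
    have : 0 ≤ 2 * (|ω| + |c|) * (1 + k) / k := by positivity
    linarith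
  have hrk : 2 * (|ω| + |c|) * (1 + k) ≤ k * r := by
    have : 2 * (|ω| + |c|) * (1 + k) = k * (2 * (|ω| + |c|) * (1 + k) / k) := by field_simp
    rw [this, hr]
    have : 0 ≤ k * (1 + 2 * (|ω| + |c|)) := by positivity
    linarith
  have geo : ∀ z : ℂ, r ≤ ‖z‖ → -(k / 2 * ‖z‖) ≤ z.re → (z ≠ ω ∧ -(k * ‖z - ω‖) ≤ (z - ω).re) ∧
      1 ≤ ‖z‖ ∧ ‖z‖ / 2 ≤ ‖z - ω‖ ∧ ‖z‖ / 2 ≤ ‖z - c‖ ∧ ‖z - c‖ ≤ 2 * ‖z‖ := by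
    intro z hz hre
    have a1 : ‖z‖ - |ω| ≤ ‖z - ω‖ := by
      have := norm_sub_norm_le z (ω : ℂ)
      simpa using this
    have a2 : ‖z‖ - |c| ≤ ‖z - c‖ := by
      have := norm_sub_norm_le z (c : ℂ)
      simpa using this
    have a3 : ‖z - c‖ ≤ ‖z‖ + |c| := by
      have := norm_sub_le z (c : ℂ)
      simpa using this
    have p1 := abs_nonneg ω
    have p2 := abs_nonneg c
    refine ⟨⟨?_, ?_⟩, by linarith, by linarith, by linarith, by linarith⟩
    · rintro rfl
      simp only [Complex.norm_real, Real.norm_eq_abs] at hz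
      linarith
    · have h3 : k * ‖z - ω‖ ≥ k * (‖z‖ - |ω|) := by gcongr
      have h4 : k * r ≤ k * ‖z‖ := by gcongr
      have h5 := le_abs_self ω
      rw [Complex.sub_re, Complex.ofReal_re]
      have : 0 ≤ |c| * k := by positivity
      nlinarith
  refine ⟨R, k / 2, r, 4 * C * (1 + 4 * M) + 4 * M, hR, by positivity, by linarith, by linarith,
    fun z hz hre => hA.mem z (geo z hz hre).1.1 (geo z hz hre).1.2, ?_, ?_⟩
  · intro z hz hre
    obtain ⟨⟨g1, g2⟩, g3, g4, g5, g6⟩ := geo z hz hre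
    have hzA := hA.mem z g1 g2
    have hzc : z ≠ c := by
      rintro rfl
      rw [sub_self, norm_zero] at g5
      linarith
    have hn : 0 < ‖z - c‖ := norm_pos_iff.2 (sub_ne_zero.2 hzc)
    have hzB : ‖resolvent A z‖ ≤ 4 * M / ‖z - c‖ := by
      refine (hA.le z g1 g2).trans ?_
      rw [div_le_div_iff₀ (by linarith) hn]
      nlinarith
    have hpow : ‖z - c‖ ^ (-(1 - α)) ≤ 4 * (1 + ‖z‖) ^ (-(1 - α)) := by
      have h4 : (1 + ‖z‖) / 4 ≤ ‖z - c‖ := by linarith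
      have hp : 0 < 1 + ‖z‖ := by linarith
      calc ‖z - c‖ ^ (-(1 - α)) ≤ ((1 + ‖z‖) / 4) ^ (-(1 - α)) :=
            Real.rpow_le_rpow_of_nonpos (by positivity) h4 (by linarith)
        _ = (1 + ‖z‖) ^ (-(1 - α)) * 4 ^ (1 - α) := by
            rw [Real.div_rpow hp.le (by norm_num), Real.rpow_neg (x := 4) (by norm_num),
              div_inv_eq_mul]
        _ ≤ (1 + ‖z‖) ^ (-(1 - α)) * 4 ^ (1 : ℝ) := by
            gcongr
            · norm_num
            · linarith
        _ = _ := by rw [Real.rpow_one]; ring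
    refine ContinuousLinearMap.opNorm_le_bound _ (by positivity) fun y => ?_
    have e : R z y = S (y - (z - c) • resolvent A z y) := by
      rw [hR.identity hzA hcm y, hR.uniq hSr, ← hR.eq_resolvent hzA]
      congr 1
      simp only [ContinuousLinearMap.comp_apply]
      module
    rw [e]
    refine (hSC z hzA hzc (4 * M) (by positivity) hzB y).trans ?_
    refine mul_le_mul_of_nonneg_right ?_ (norm_nonneg y)
    calc _ ≤ C * (1 + 4 * M) * (4 * (1 + ‖z‖) ^ (-(1 - α))) :=
          mul_le_mul_of_nonneg_left hpow (by positivity)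
      _ = 4 * C * (1 + 4 * M) * (1 + ‖z‖) ^ (-(1 - α)) := by ring
      _ ≤ _ := by
        gcongr
        linarith
  · intro z hz hre
    obtain ⟨⟨g1, g2⟩, g3, g4, g5, g6⟩ := geo z hz hre
    have hzA := hA.mem z g1 g2
    have hb : ‖resolvent A z‖ ≤ (4 * C * (1 + 4 * M) + 4 * M) * (1 + ‖z‖)⁻¹ := by
      refine (hA.le z g1 g2).trans ?_
      calc M / ‖z - ω‖ ≤ 4 * M / (1 + ‖z‖) := by
            rw [div_le_div_iff₀ (by linarith) (by linarith)]
            nlinarith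
        _ = 4 * M * (1 + ‖z‖)⁻¹ := by ring
        _ ≤ _ := by
            gcongr
            have : 0 ≤ 4 * C * (1 + 4 * M) := by positivity
            linarith
    refine ContinuousLinearMap.opNorm_le_bound _ (by positivity) fun y => ?_
    refine norm_le_of_mkL (by positivity) (fun x => ?_) y
    -- The resolvent commutes with `(c - A)^(-α)`, so on `X^α` it is no larger than on `X`.
    have e : (R z ∘L toBaseL) (mkL A c α x) = mkL A c α (resolvent A z x) := by
      apply toBaseL_injective
      rw [toBaseL_apply (mkL A c α (resolvent A z x)), toBase_mkL,
        ← hA.negFracPower_comm hc h0 h1 hzA, ← hR.eq_resolvent hzA]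
      rfl
    rw [e]
    refine (norm_mkL_le _).trans (((resolvent A z).le_opNorm x).trans ?_)
    gcongr

section Perturb

variable {Y : Type*} [NormedAddCommGroup Y] [NormedSpace ℂ Y]

lemma tendsto_one_add_norm_rpow {γ : ℝ} (hγ : 0 < γ) {δ : ℝ} (hδ : 0 < δ) :
    ∃ r : ℝ, 0 < r ∧ ∀ s, r ≤ s → (1 + s) ^ (-γ) ≤ δ := by
  have h := (tendsto_rpow_neg_atTop hγ).comp (tendsto_atTop_add_const_left atTop (1 : ℝ) tendsto_id)
  obtain ⟨r, hr⟩ := eventually_atTop.1 (h.eventually_le_const hδ)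
  exact ⟨max r 1, by positivity, fun s hs => hr s ((le_max_left _ _).trans hs)⟩

/-- As `R z` decays, `T ∘L R z` has norm at most `1 / 2` outside a larger disc, and a Neumann series
gives the perturbed resolvent with at most twice the norm. The opening and the rate are unchanged.
-/
lemma SectorLift.perturb {J : Y →L[ℂ] X} {A L : X →ₗ.[ℂ] X} {R : ℂ → X →L[ℂ] Y} {k r B γ : ℝ}
    (hR : SectorLift J A R k r B γ) (hdom : L.domain = A.domain) (T : Y →L[ℂ] X)
    (hT : ∀ y (hL : J y ∈ L.domain) (hA : J y ∈ A.domain), L ⟨J y, hL⟩ = A ⟨J y, hA⟩ + T y) :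
    ∃ (R' : ℂ → X →L[ℂ] Y) (r' B' : ℝ), SectorLift J L R' k r' B' γ := by
  obtain ⟨r₁, hr₁, hr₁'⟩ := tendsto_one_add_norm_rpow hR.rate_pos
    (δ := (1 / 2) / ((‖T‖ + 1) * (|B| + 1))) (by positivity)
  have hsmall : ∀ z : ℂ, max r r₁ ≤ ‖z‖ → -(k * ‖z‖) ≤ z.re → ‖T ∘L R z‖ ≤ 1 / 2 := by
    intro z hz hre
    calc ‖T ∘L R z‖ ≤ ‖T‖ * ‖R z‖ := ContinuousLinearMap.opNorm_comp_le _ _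
      _ ≤ ‖T‖ * (B * (1 + ‖z‖) ^ (-γ)) := by
          gcongr; exact hR.bound z ((le_max_left _ _).trans hz) hre
      _ ≤ (‖T‖ + 1) * ((|B| + 1) * ((1 / 2) / ((‖T‖ + 1) * (|B| + 1)))) := by
          have h3 := hr₁' _ ((le_max_right _ _).trans hz)
          have : B ≤ |B| + 1 := by linarith [le_abs_self B]
          have h4 : 0 ≤ (1 + ‖z‖) ^ (-γ) := by positivity
          have h5 : B * (1 + ‖z‖) ^ (-γ) ≤ (|B| + 1) * ((1 / 2) / ((‖T‖ + 1) * (|B| + 1))) := by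
            gcongr
          have h6 : 0 ≤ (|B| + 1) * ((1 / 2) / ((‖T‖ + 1) * (|B| + 1))) := by positivity
          nlinarith [norm_nonneg T]
      _ = 1 / 2 := by field_simp
  have hres : ∀ z : ℂ, max r r₁ ≤ ‖z‖ → -(k * ‖z‖) ≤ z.re →
      IsResolventAt L z (J ∘L (R z ∘L Ring.inverse (1 - T ∘L R z))) := by
    intro z hz hre
    refine IsResolventAt.perturb hdom
      (hR.lift.isRes z (hR.mem z ((le_max_left _ _).trans hz) hre)) T (fun y hL hA => ?_)
      ((hsmall z hz hre).trans_lt (by norm_num))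
    rw [hT y hL hA]; abel
  have hx0 : 0 < max r r₁ := lt_max_of_lt_right hr₁
  have hnx : ‖((max r r₁ : ℝ) : ℂ)‖ = max r r₁ := by
    rw [Complex.norm_real, Real.norm_of_nonneg hx0.le]
  obtain ⟨R', hR'⟩ := exists_isLift hR.lift.inj (hres ((max r r₁ : ℝ) : ℂ) hnx.ge (by
    rw [hnx, Complex.ofReal_re]
    have := mul_pos hR.pos hx0
    linarith))
  have hb1 : ∀ z : ℂ, max r r₁ ≤ ‖z‖ → -(k * ‖z‖) ≤ z.re →
      ‖R' z‖ ≤ 2 * |B| * (1 + ‖z‖) ^ (-γ) := by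
    intro z hz hre
    rw [hR'.uniq (hres z hz hre)]
    calc _ ≤ ‖R z‖ * ‖Ring.inverse (1 - T ∘L R z)‖ := ContinuousLinearMap.opNorm_comp_le _ _
      _ ≤ (|B| * (1 + ‖z‖) ^ (-γ)) * 2 := by
          gcongr
          · refine (hR.bound z ((le_max_left _ _).trans hz) hre).trans ?_
            gcongr
            exact le_abs_self B
          · exact norm_inverse_one_sub_le (hsmall z hz hre)
      _ = _ := by ring
  refine ⟨R', max r r₁, 2 * |B| + (|B| + 2 * |B| * (‖T‖ * |B|)), hR', hR.pos, hR.rate_pos,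
    hR.rate_le, fun z hz hre => (hres z hz hre).mem, ?_, ?_⟩
  · intro z hz hre
    refine (hb1 z hz hre).trans ?_
    gcongr
    have : 0 ≤ |B| + 2 * |B| * (‖T‖ * |B|) := by positivity
    linarith
  · intro z hz hre
    have hRJ : ‖R z ∘L J‖ ≤ |B| * (1 + ‖z‖)⁻¹ := by
      refine (hR.bound_comp z ((le_max_left _ _).trans hz) hre).trans ?_
      gcongr
      exact le_abs_self B
    -- The second resolvent identity keeps the full rate `(1 + ‖z‖)⁻¹` on the small space; the
    -- Neumann factor itself acts only on `X`.
    have e : R' z ∘L J = R z ∘L J + R' z ∘L (T ∘L (R z ∘L J)) := by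
      rw [hR'.uniq (hres z hz hre)]
      ext y
      have := (inverse_one_sub_mul ((hsmall z hz hre).trans_lt (by norm_num)) (J y)).2
      simp only [ContinuousLinearMap.comp_apply, add_apply, map_sub] at this ⊢
      rw [← map_add, ← sub_eq_iff_eq_add.1 this]
    rw [e]
    have hb2 : ‖R' z‖ ≤ 2 * |B| := by
      refine (hb1 z hz hre).trans (mul_le_of_le_one_right (by positivity) ?_)
      exact Real.rpow_le_one_of_one_le_of_nonpos (by linarith [norm_nonneg z])
        (by linarith [hR.rate_pos])
    calc _ ≤ |B| * (1 + ‖z‖)⁻¹ + 2 * |B| * (‖T‖ * (|B| * (1 + ‖z‖)⁻¹)) := by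
          refine (norm_add_le _ _).trans (add_le_add hRJ ?_)
          refine (ContinuousLinearMap.opNorm_comp_le _ _).trans ?_
          refine mul_le_mul hb2 ?_ (norm_nonneg _) (by positivity)
          exact (ContinuousLinearMap.opNorm_comp_le _ _).trans
            (mul_le_mul_of_nonneg_left hRJ (norm_nonneg _))
      _ = (|B| + 2 * |B| * (‖T‖ * |B|)) * (1 + ‖z‖)⁻¹ := by ring
      _ ≤ _ := by
          refine mul_le_mul_of_nonneg_right ?_ (by positivity)
          have : 0 ≤ 2 * |B| := by positivity
          linarith

end Perturb

lemma domain_le_fracDomain {A : X →ₗ.[ℂ] X} {c α : ℝ} {R : ℂ → X →L[ℂ] FracSpace A c α}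
    (hR : IsLift toBaseL A R) {z : ℂ} (hz : z ∈ resolventSet A) : A.domain ≤ fracDomain A c α := by
  intro x hx
  have h := (hR.isRes z hz).left hx
  rw [← h]
  exact (R z _).2

lemma addFrac_domain {A : X →ₗ.[ℂ] X} {c α : ℝ} {R : ℂ → X →L[ℂ] FracSpace A c α}
    (hR : IsLift toBaseL A R) {z : ℂ} (hz : z ∈ resolventSet A) (T : FracSpace A c α →L[ℂ] X) :
    (addFrac A T).domain = A.domain :=
  inf_eq_left.2 (domain_le_fracDomain hR hz)

lemma addFrac_apply {A : X →ₗ.[ℂ] X} {c α : ℝ} (T : FracSpace A c α →L[ℂ] X)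
    (y : FracSpace A c α) (hL : toBaseL y ∈ (addFrac A T).domain) (hA : toBaseL y ∈ A.domain) :
    addFrac A T ⟨toBaseL y, hL⟩ = A ⟨toBaseL y, hA⟩ + T y := rfl

/-- The resolvent of `A + T`, for `A` sectorial and `T : X^α → X` bounded. -/
theorem IsSectorial.exists_sectorLift {A : X →ₗ.[ℂ] X} {ω c α : ℝ} (hA : IsSectorial A ω)
    (hc : ω < c) (h0 : 0 ≤ α) (h1 : α < 1) (T : FracSpace A c α →L[ℂ] X) :
    (addFrac A T).domain = A.domain ∧
    ∃ (R : ℂ → X →L[ℂ] FracSpace A c α) (k r B : ℝ),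
      SectorLift toBaseL (addFrac A T) R k r B (1 - α) := by
  obtain ⟨k, M, hS⟩ := hA.sectorBound
  have hcm : (c : ℂ) ∈ resolventSet A := by simpa using hS.real_mem hc (le_refl (0 : ℝ))
  obtain ⟨R, k', r, B, hR⟩ := hS.sectorLift hc h0 h1
  have hd := addFrac_domain hR.lift hcm T
  obtain ⟨R', r', B', h⟩ := hR.perturb hd T (addFrac_apply T)
  exact ⟨hd, R', k', r', B', h⟩

end

section

/-! ### Riesz projections along the circles of centre `ρ` and radius `ρ` -/

lemma clm_circleIntegral {E F : Type*} [NormedAddCommGroup E] [NormedSpace ℂ E] [CompleteSpace E]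
    [NormedAddCommGroup F] [NormedSpace ℂ F] [CompleteSpace F] (T : E →L[ℂ] F) {f : ℂ → E} {a : ℂ}
    {ρ : ℝ} (hf : CircleIntegrable f a ρ) :
    T (circleIntegral f a ρ) = circleIntegral (fun w => T (f w)) a ρ := by
  simp only [circleIntegral]
  rw [← ContinuousLinearMap.intervalIntegral_comp_comm _ hf.out]
  simp

section Riesz

variable {X Y : Type*} [NormedAddCommGroup X] [NormedSpace ℂ X] [CompleteSpace X]
  [NormedAddCommGroup Y] [NormedSpace ℂ Y] [CompleteSpace Y]

/-- The Riesz integral of a lifted resolvent over the circle of centre and radius `ρ`. -/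
def rieszLift (R : ℂ → X →L[ℂ] Y) (ρ : ℝ) : X →L[ℂ] Y :=
  (2 * Real.pi * Complex.I : ℂ)⁻¹ • circleIntegral R (ρ : ℂ) ρ

/-- The Cauchy integral of a lifted resolvent over the circle of centre and radius `ρ`. -/
def rieszCauchy (R : ℂ → X →L[ℂ] Y) (ρ : ℝ) (z : ℂ) : X →L[ℂ] Y :=
  (2 * Real.pi * Complex.I : ℂ)⁻¹ • circleIntegral (fun w => (w - z)⁻¹ • R w) (ρ : ℂ) ρ

open Classical in
/-- The part of the resolvent that is analytic inside the circle. -/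
def stablePart (J : Y →L[ℂ] X) (R : ℂ → X →L[ℂ] Y) (ρ : ℝ) (z : ℂ) : X →L[ℂ] Y :=
  if z ∈ Metric.ball (ρ : ℂ) ρ then rieszCauchy R ρ z else R z - rieszLift R ρ ∘L (J ∘L R z)

/-- The closed right half plane outside the disc of centre and radius `ρ` is free of spectrum. -/
structure IsRieszRadius (L : X →ₗ.[ℂ] X) (ρ : ℝ) : Prop where
  pos : 0 < ρ
  mem : ∀ z : ℂ, 0 ≤ z.re → z ∉ Metric.ball (ρ : ℂ) ρ → z ∈ resolventSet L

lemma re_nonneg_of_mem_closedBall {ρ : ℝ} {w : ℂ} (hw : w ∈ Metric.closedBall (ρ : ℂ) ρ) :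
    0 ≤ w.re := by
  rw [Metric.mem_closedBall, Complex.dist_eq] at hw
  have := (Complex.abs_re_le_norm _).trans hw
  rw [Complex.sub_re, Complex.ofReal_re, abs_le] at this
  linarith

lemma IsRieszRadius.sphere {L : X →ₗ.[ℂ] X} {ρ : ℝ} (hρ : IsRieszRadius L ρ) {w : ℂ}
    (hw : w ∈ Metric.sphere (ρ : ℂ) ρ) : w ∈ resolventSet L := by
  refine hρ.mem w (re_nonneg_of_mem_closedBall (Metric.sphere_subset_closedBall hw)) ?_
  rw [Metric.mem_ball, Metric.mem_sphere.1 hw]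
  exact lt_irrefl _

lemma two_pi_I_inv_smul_integral_const {ρ : ℝ} {z : ℂ} (hz : z ∈ Metric.ball (ρ : ℂ) ρ) (y : Y) :
    (2 * Real.pi * Complex.I : ℂ)⁻¹ • circleIntegral (fun w => (w - z)⁻¹ • y) (ρ : ℂ) ρ = y := by
  rw [circleIntegral.integral_smul_const, circleIntegral.integral_sub_inv_of_mem_ball hz, smul_smul,
    inv_mul_cancel₀ Complex.two_pi_I_ne_zero, one_smul]

variable {J : Y →L[ℂ] X} {L : X →ₗ.[ℂ] X} {R : ℂ → X →L[ℂ] Y} (hR : IsLift J L R)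
include hR

lemma IsLift.comm {z w : ℂ} (hz : z ∈ resolventSet L) (hw : w ∈ resolventSet L) (y : X) :
    R w (J (R z y)) = R z (J (R w y)) := by
  apply hR.inj
  have := resolvent_comm hz hw y
  rw [← hR.eq_resolvent hz, ← hR.eq_resolvent hw] at this
  exact this

lemma IsLift.differentiableAt {z : ℂ} (hz : z ∈ resolventSet L) : DifferentiableAt ℂ R z :=
  hR.diff.differentiableAt ((isOpen_resolventSet L).mem_nhds hz)

variable {ρ : ℝ} (hρ : IsRieszRadius L ρ)
include hρ

lemma IsLift.continuousOn_sphere : ContinuousOn R (Metric.sphere (ρ : ℂ) ρ) :=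
  hR.diff.continuousOn.mono fun _ hw => hρ.sphere hw

lemma IsLift.circleIntegrable : CircleIntegrable R (ρ : ℂ) ρ :=
  (hR.continuousOn_sphere hρ).circleIntegrable hρ.pos.le

lemma continuousOn_inv_sub {z : ℂ} (hz : z ∈ Metric.ball (ρ : ℂ) ρ) :
    ContinuousOn (fun w : ℂ => (w - z)⁻¹) (Metric.sphere (ρ : ℂ) ρ) := by
  refine ContinuousOn.inv₀ (by fun_prop) fun w hw h => ?_
  rw [sub_eq_zero] at h
  rw [h, Metric.mem_sphere] at hw
  rw [Metric.mem_ball, hw] at hz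
  exact lt_irrefl _ hz

lemma IsLift.circleIntegrable_cauchy {z : ℂ} (hz : z ∈ Metric.ball (ρ : ℂ) ρ) :
    CircleIntegrable (fun w => (w - z)⁻¹ • R w) (ρ : ℂ) ρ :=
  ((continuousOn_inv_sub hR hρ hz).smul (hR.continuousOn_sphere hρ)).circleIntegrable hρ.pos.le

lemma IsLift.clm_rieszLift {F : Type*} [NormedAddCommGroup F] [NormedSpace ℂ F] [CompleteSpace F]
    (T : Y →L[ℂ] F) (y : X) :
    T (rieszLift R ρ y) =
      (2 * Real.pi * Complex.I : ℂ)⁻¹ • circleIntegral (fun w => T (R w y)) (ρ : ℂ) ρ := by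
  rw [rieszLift, smul_apply, map_smul]
  congr 1
  exact clm_circleIntegral (T ∘L ContinuousLinearMap.apply ℂ Y y) (hR.circleIntegrable hρ)

lemma IsLift.clm_rieszCauchy {F : Type*} [NormedAddCommGroup F] [NormedSpace ℂ F] [CompleteSpace F]
    (T : Y →L[ℂ] F) {z : ℂ} (hz : z ∈ Metric.ball (ρ : ℂ) ρ) (y : X) :
    T (rieszCauchy R ρ z y) =
      (2 * Real.pi * Complex.I : ℂ)⁻¹ •
        circleIntegral (fun w => (w - z)⁻¹ • T (R w y)) (ρ : ℂ) ρ := by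
  rw [rieszCauchy, smul_apply, map_smul]
  congr 1
  have := clm_circleIntegral (T ∘L ContinuousLinearMap.apply ℂ Y y)
    (hR.circleIntegrable_cauchy hρ hz)
  simpa using this

lemma IsLift.rieszLift_comm {z : ℂ} (hz : z ∈ resolventSet L) (y : X) :
    rieszLift R ρ (J (R z y)) = R z (J (rieszLift R ρ y)) := by
  have h1 := hR.clm_rieszLift hρ (ContinuousLinearMap.id ℂ Y) (J (R z y))
  have h2 := hR.clm_rieszLift hρ (R z ∘L J) y
  simp only [ContinuousLinearMap.id_apply, ContinuousLinearMap.comp_apply] at h1 h2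
  rw [h1, h2]
  congr 1
  exact circleIntegral.integral_congr hρ.pos.le fun w hw => hR.comm hz (hρ.sphere hw) y

lemma IsLift.circleIntegrable_clm {F : Type*} [NormedAddCommGroup F] [NormedSpace ℂ F]
    (T : Y →L[ℂ] F) (y : X) : CircleIntegrable (fun w => T (R w y)) (ρ : ℂ) ρ := by
  refine ContinuousOn.circleIntegrable hρ.pos.le ?_
  exact T.continuous.comp_continuousOn ((hR.continuousOn_sphere hρ).clm_apply continuousOn_const)

lemma IsLift.circleIntegrable_inv_smul {F : Type*} [NormedAddCommGroup F] [NormedSpace ℂ F]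
    {z : ℂ} (hz : z ∈ Metric.ball (ρ : ℂ) ρ) (x : F) :
    CircleIntegrable (fun w => (w - z)⁻¹ • x) (ρ : ℂ) ρ :=
  ContinuousOn.circleIntegrable hρ.pos.le
    ((continuousOn_inv_sub hR hρ hz).smul continuousOn_const)

/-- By the resolvent identity the integrand becomes `(w - z)⁻¹ • R z₀ y - R w (J (R z₀ y))`. The
first part integrates by Cauchy's formula, the second is the Riesz integral. -/
lemma IsLift.rieszCauchy_mul {z z₀ : ℂ} (hz : z ∈ Metric.ball (ρ : ℂ) ρ) (hz₀ : z₀ ∈ resolventSet L)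
    (y : X) : rieszCauchy R ρ z ((z - z₀) • J (R z₀ y) + y) =
      R z₀ y - rieszLift R ρ (J (R z₀ y)) := by
  have h1 := hR.clm_rieszCauchy hρ (ContinuousLinearMap.id ℂ Y) hz ((z - z₀) • J (R z₀ y) + y)
  have h2 := hR.clm_rieszLift hρ (ContinuousLinearMap.id ℂ Y) (J (R z₀ y))
  simp only [ContinuousLinearMap.id_apply] at h1 h2
  rw [h1, h2]
  have h5 := two_pi_I_inv_smul_integral_const hz (R z₀ y)
  refine Eq.trans ?_ (congrArg (fun v => v - _) h5)
  rw [← smul_sub, ← circleIntegral.integral_sub (hR.circleIntegrable_inv_smul hρ hz _)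
    (show CircleIntegrable (fun w => R w (J (R z₀ y))) (ρ : ℂ) ρ from
      hR.circleIntegrable_clm hρ (ContinuousLinearMap.id ℂ Y) _)]
  congr 1
  refine circleIntegral.integral_congr hρ.pos.le fun w hw => ?_
  have hwz : w - z ≠ 0 := by
    intro h
    rw [sub_eq_zero] at h
    rw [h, Metric.mem_sphere] at hw
    rw [Metric.mem_ball, hw] at hz
    exact lt_irrefl _ hz
  have h3 := hR.identity hz₀ (hρ.sphere hw) y
  have h4 : R w ((z - z₀) • J (R z₀ y) + y) = R z₀ y - (w - z) • R w (J (R z₀ y)) := by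
    nth_rewrite 2 [h3]
    rw [← map_smul (R w) (w - z), ← map_sub]
    congr 1
    module
  rw [h4, smul_sub, smul_smul, inv_mul_cancel₀ hwz, one_smul]

lemma IsLift.rieszCauchy_eq {z : ℂ} (hz : z ∈ Metric.ball (ρ : ℂ) ρ) (hz' : z ∈ resolventSet L) :
    rieszCauchy R ρ z = R z - rieszLift R ρ ∘L (J ∘L R z) := by
  ext y
  have := hR.rieszCauchy_mul hρ hz hz' y
  simpa using this

lemma IsLift.stablePart_eq {z : ℂ} (hz : z ∈ resolventSet L) :
    stablePart J R ρ z = R z - rieszLift R ρ ∘L (J ∘L R z) := by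
  rw [stablePart]
  split_ifs with h
  · exact hR.rieszCauchy_eq hρ h hz
  · rfl

lemma stablePart_of_mem_ball {z : ℂ} (hz : z ∈ Metric.ball (ρ : ℂ) ρ) :
    stablePart J R ρ z = rieszCauchy R ρ z := if_pos hz

/-- The Cauchy integral is a power series in the disc, and `IsLift.rieszCauchy_eq` glues it to `(1 -
P) R z` on the resolvent set. Hence the unstable spectrum is removed. -/
lemma IsLift.differentiableOn_stablePart :
    DifferentiableOn ℂ (stablePart J R ρ) (Metric.ball (ρ : ℂ) ρ ∪ resolventSet L) := by
  rintro z (hz | hz)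
  · obtain ⟨r, rfl⟩ : ∃ r : NNReal, (r : ℝ) = ρ := ⟨⟨ρ, hρ.pos.le⟩, rfl⟩
    have h1 := hasFPowerSeriesOn_cauchy_integral (hR.circleIntegrable hρ)
      (NNReal.coe_pos.1 hρ.pos)
    have h2 : DifferentiableAt ℂ (rieszCauchy R r) z := by
      refine (h1.differentiableOn z ?_).differentiableAt (Metric.isOpen_eball.mem_nhds ?_) <;>
      · rw [Metric.mem_eball, edist_lt_coe]
        exact hz
    refine (h2.congr_of_eventuallyEq ?_).differentiableWithinAt
    filter_upwards [Metric.isOpen_ball.mem_nhds hz] with w hw using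
      stablePart_of_mem_ball hR hρ hw
  · have h2 : DifferentiableAt ℂ (fun z => R z - rieszLift R ρ ∘L (J ∘L R z)) z := by
      have := hR.differentiableAt hz
      fun_prop
    refine (h2.congr_of_eventuallyEq ?_).differentiableWithinAt
    filter_upwards [(isOpen_resolventSet L).mem_nhds hz] with w hw using hR.stablePart_eq hρ hw

/-- This and `IsLift.mul_stablePart` say that `stablePart` inverts `z - L` on the complement of the
unstable space, from both sides. Writing `L` through one fixed resolvent avoids restricting an
unbounded operator. -/
lemma IsLift.stablePart_mul {z z₀ : ℂ} (hz : z ∈ Metric.ball (ρ : ℂ) ρ ∪ resolventSet L)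
    (hz₀ : z₀ ∈ resolventSet L) (y : X) :
    stablePart J R ρ z ((z - z₀) • J (R z₀ y) + y) = R z₀ y - rieszLift R ρ (J (R z₀ y)) := by
  rcases hz with hz | hz
  · rw [stablePart_of_mem_ball hR hρ hz, hR.rieszCauchy_mul hρ hz hz₀]
  · rw [hR.stablePart_eq hρ hz, sub_apply, ContinuousLinearMap.comp_apply,
      ContinuousLinearMap.comp_apply]
    have h3 := hR.identity hz₀ hz y
    rw [add_comm] at h3
    rw [← h3]

lemma IsLift.mul_stablePart {z z₀ : ℂ} (hz : z ∈ Metric.ball (ρ : ℂ) ρ ∪ resolventSet L)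
    (hz₀ : z₀ ∈ resolventSet L) (y : X) :
    stablePart J R ρ z y =
      R z₀ ((z₀ - z) • J (stablePart J R ρ z y) + (y - J (rieszLift R ρ y))) := by
  rcases hz with hz | hz
  · rw [stablePart_of_mem_ball hR hρ hz]
    have h1 := hR.clm_rieszCauchy hρ (ContinuousLinearMap.id ℂ Y) hz y
    have h2 := hR.clm_rieszCauchy hρ (R z₀ ∘L J) hz y
    have h3 := hR.clm_rieszLift hρ (R z₀ ∘L J) y
    simp only [ContinuousLinearMap.id_apply, ContinuousLinearMap.comp_apply] at h1 h2 h3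
    rw [map_add, map_sub, map_smul, h2, h3, smul_comm, ← circleIntegral.integral_smul]
    have h4 := two_pi_I_inv_smul_integral_const hz (R z₀ y)
    have i1 := hR.circleIntegrable_inv_smul hρ hz (R z₀ y)
    have i2 : CircleIntegrable (fun w => R z₀ (J (R w y))) (ρ : ℂ) ρ :=
      hR.circleIntegrable_clm hρ (R z₀ ∘L J) y
    have i5 : CircleIntegrable (fun w => (w - z)⁻¹ • R z₀ y - R z₀ (J (R w y))) (ρ : ℂ) ρ :=
      i1.sub i2
    have i4 : CircleIntegrable (fun w => (z₀ - z) • (w - z)⁻¹ • R z₀ (J (R w y))) (ρ : ℂ) ρ := by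
      refine ContinuousOn.circleIntegrable hρ.pos.le ?_
      refine continuousOn_const.smul ((continuousOn_inv_sub hR hρ hz).smul ?_)
      exact (R z₀ ∘L J).continuous.comp_continuousOn
        ((hR.continuousOn_sphere hρ).clm_apply continuousOn_const)
    refine Eq.trans ?_ (congrArg (fun v => _ + (v - _)) h4)
    rw [← smul_sub, ← smul_add, ← circleIntegral.integral_sub i1 i2, ← circleIntegral.integral_add
      i4 i5, h1]
    congr 1
    refine circleIntegral.integral_congr hρ.pos.le fun w hw => ?_
    have hwz : w - z ≠ 0 := by
      intro h
      rw [sub_eq_zero] at h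
      rw [h, Metric.mem_sphere] at hw
      rw [Metric.mem_ball, hw] at hz
      exact lt_irrefl _ hz
    have h5 := hR.identity (hρ.sphere hw) hz₀ y
    rw [map_add, map_smul] at h5
    have h6 : R z₀ y = R w y - (z₀ - w) • R z₀ (J (R w y)) := by rw [eq_sub_iff_add_eq]; exact h5.symm
    rw [h6]
    set v := R z₀ (J (R w y))
    have h7 : v = (w - z)⁻¹ • (w - z) • v := by rw [smul_smul, inv_mul_cancel₀ hwz, one_smul]
    nth_rewrite 3 [h7]
    rw [smul_comm (z₀ - z), ← smul_sub, ← smul_add]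
    congr 1
    module
  · rw [hR.stablePart_eq hρ hz]
    simp only [sub_apply, ContinuousLinearMap.comp_apply]
    have h1 := hR.identity hz hz₀ y
    refine (congrArg (fun v => v - rieszLift R ρ (J v)) h1).trans ?_
    rw [ hR.rieszLift_comm hρ hz₀, ← map_sub]
    congr 1
    simp only [map_add, map_smul, map_sub]
    module

/-- The function `(1 - P) R z` is analytic on the whole closed disc of radius `ρ'`, so its circle
integral `P' - P P'` vanishes. The case `ρ' = ρ` is the idempotence of the projection. -/
lemma IsLift.rieszLift_mul {ρ' : ℝ} (hρ' : IsRieszRadius L ρ') (y : X) :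
    rieszLift R ρ (J (rieszLift R ρ' y)) = rieszLift R ρ' y := by
  have hsub : Metric.closedBall (ρ' : ℂ) ρ' ⊆ Metric.ball (ρ : ℂ) ρ ∪ resolventSet L := by
    intro w hw
    by_cases h : w ∈ Metric.ball (ρ : ℂ) ρ
    · exact Or.inl h
    · exact Or.inr (hρ.mem w (re_nonneg_of_mem_closedBall hw) h)
  have hd := hR.differentiableOn_stablePart hρ
  have ho : IsOpen (Metric.ball (ρ : ℂ) ρ ∪ resolventSet L) :=
    Metric.isOpen_ball.union (isOpen_resolventSet L)
  have h0 := Complex.circleIntegral_eq_zero_of_differentiable_on_off_countable hρ'.pos.le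
    (f := fun z => stablePart J R ρ z y) (c := (ρ' : ℂ)) Set.countable_empty
    ((hd.continuousOn.mono hsub).clm_apply continuousOn_const) (fun z hz => by
      have := hd.differentiableAt (ho.mem_nhds (hsub (Metric.ball_subset_closedBall hz.1)))
      fun_prop)
  have h1 := hR.clm_rieszLift hρ' (rieszLift R ρ ∘L J) y
  have h2 := hR.clm_rieszLift hρ' (ContinuousLinearMap.id ℂ Y) y
  simp only [ContinuousLinearMap.id_apply, ContinuousLinearMap.comp_apply] at h1 h2
  have i1 : CircleIntegrable (fun w => R w y) (ρ' : ℂ) ρ' :=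
    hR.circleIntegrable_clm hρ' (ContinuousLinearMap.id ℂ Y) y
  have i2 : CircleIntegrable (fun w => rieszLift R ρ (J (R w y))) (ρ' : ℂ) ρ' :=
    hR.circleIntegrable_clm hρ' (rieszLift R ρ ∘L J) y
  rw [h1, h2, eq_comm, ← sub_eq_zero, ← smul_sub, ← circleIntegral.integral_sub i1 i2]
  rw [← circleIntegral.integral_congr hρ'.pos.le (f := fun z => stablePart J R ρ z y), h0, smul_zero]
  intro w hw
  simp [hR.stablePart_eq hρ (hρ'.sphere hw)]

-- With `P P' = P'` and `P' P = P`, commutation of the two projections gives equality.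
omit hρ in
lemma IsLift.rieszLift_eq (hρ : IsRieszRadius L ρ) {ρ' : ℝ} (hρ' : IsRieszRadius L ρ') :
    rieszLift R ρ = rieszLift R ρ' := by
  ext y
  have h1 := hR.rieszLift_mul hρ hρ' y
  have h2 := hR.rieszLift_mul hρ' hρ y
  have h3 := hR.clm_rieszLift hρ (rieszLift R ρ' ∘L J) y
  have h4 := hR.clm_rieszLift hρ (ContinuousLinearMap.id ℂ Y) (J (rieszLift R ρ' y))
  simp only [ContinuousLinearMap.id_apply, ContinuousLinearMap.comp_apply] at h3 h4
  rw [← h1, ← h2, h3, h4]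
  congr 1
  exact circleIntegral.integral_congr hρ.pos.le fun w hw =>
    hR.rieszLift_comm hρ' (hρ.sphere hw) y

/-- The Riesz integral is eventually constant in the radius, so the limit is any of its values. -/
lemma IsLift.unstableProjection_eq (hev : ∀ᶠ s in atTop, IsRieszRadius L s) :
    unstableProjection L = J ∘L rieszLift R ρ := by
  refine Tendsto.limUnder_eq (tendsto_const_nhds.congr' ?_)
  filter_upwards [hev] with s hs
  rw [hR.rieszLift_eq hρ hs]
  ext y
  have h1 := hR.clm_rieszLift hs J y
  have hi : CircleIntegrable (resolvent L) (s : ℂ) s := by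
    refine ContinuousOn.circleIntegrable hs.pos.le fun w hw => ?_
    exact (differentiableAt_resolvent (hs.sphere hw)).continuousAt.continuousWithinAt
  have h2 := clm_circleIntegral (ContinuousLinearMap.apply ℂ X y) hi
  simp only [ContinuousLinearMap.apply_apply] at h2
  rw [ContinuousLinearMap.comp_apply, h1, smul_apply, h2]
  congr 1
  refine circleIntegral.integral_congr hs.pos.le fun w hw => ?_
  rw [← hR.eq_resolvent (hs.sphere hw)]
  rfl

end Riesz

end

section

/-! ### Decay of resolvents on the regions `-(k (1 + ‖z‖)) < Re z` -/

/-- Far out, a thin region around the right half plane lies in the sector. Within radius `max r 1`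
it lies in a closed thickening of a compact half disc, which stays in `U` for small `k'`. Continuity
gives bounds on the compact part, sectoriality on the rest. -/
lemma exists_region_subset {U : Set ℂ} (hU : IsOpen U) (hU0 : ∀ z : ℂ, 0 ≤ z.re → z ∈ U) {k : ℝ}
    (hk : 0 < k) (r : ℝ) : ∃ (k' : ℝ) (K : Set ℂ), 0 < k' ∧ k' ≤ 1 / 4 ∧ IsCompact K ∧ K ⊆ U ∧
      ∀ z ∈ region k', z ∈ K ∨ (r ≤ ‖z‖ ∧ -(k * ‖z‖) ≤ z.re) := by
  set r' := max r 1 with hr'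
  have hr1 : 1 ≤ r' := le_max_right _ _
  set K₀ : Set ℂ := Metric.closedBall 0 r' ∩ {z | 0 ≤ z.re} with hK₀
  have hK₀c : IsCompact K₀ :=
    (isCompact_closedBall 0 r').inter_right (isClosed_le continuous_const Complex.continuous_re)
  obtain ⟨δ, hδ, hsub⟩ := hK₀c.exists_cthickening_subset_open hU fun z hz => hU0 z hz.2
  refine ⟨min (1 / 4) (min (k / 2) (δ / (1 + r'))), Metric.cthickening δ K₀, by positivity,
    min_le_left _ _, hK₀c.cthickening, hsub, fun z hz => ?_⟩
  set k' := min (1 / 4) (min (k / 2) (δ / (1 + r'))) with hk'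
  have hk1 : k' ≤ k / 2 := (min_le_right _ _).trans (min_le_left _ _)
  have hk2 : k' ≤ δ / (1 + r') := (min_le_right _ _).trans (min_le_right _ _)
  have hz' : -(k' * (1 + ‖z‖)) < z.re := hz
  have hk0 : 0 < k' := by positivity
  rcases le_total ‖z‖ r' with h | h
  · left
    have h3 : k' * (1 + ‖z‖) ≤ δ := by
      calc k' * (1 + ‖z‖) ≤ δ / (1 + r') * (1 + r') := by gcongr
        _ = δ := by field_simp
    rcases le_total 0 z.re with h0 | h0
    · exact Metric.self_subset_cthickening _ ⟨by simpa using h, h0⟩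
    · refine Metric.mem_cthickening_of_dist_le z (⟨0, z.im⟩ : ℂ) δ K₀ ⟨?_, ?_⟩ ?_
      · rw [mem_closedBall_zero_iff]
        have : ‖(⟨0, z.im⟩ : ℂ)‖ = |z.im| := by
          rw [show (⟨0, z.im⟩ : ℂ) = (z.im : ℂ) * Complex.I by apply Complex.ext <;> simp]
          simp
        rw [this]
        exact (Complex.abs_im_le_norm z).trans h
      · simp
      · rw [Complex.dist_eq, show z - (⟨0, z.im⟩ : ℂ) = (z.re : ℂ) by apply Complex.ext <;> simp,
          Complex.norm_real, Real.norm_eq_abs, abs_of_nonpos h0]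
        linarith
  · right
    refine ⟨(le_max_left _ _).trans h, ?_⟩
    nlinarith

lemma exists_decay_bound_of_isCompact {F : Type*} [NormedAddCommGroup F] {K : Set ℂ}
    (hK : IsCompact K) {Q : ℂ → F} (hQ : ContinuousOn Q K) (γ : ℝ) :
    ∃ M, 0 ≤ M ∧ ∀ z ∈ K, ‖Q z‖ ≤ M * (1 + ‖z‖) ^ (-γ) := by
  have h0 : ∀ z : ℂ, 0 < 1 + ‖z‖ := fun z => by positivity
  have hc : ContinuousOn (fun z => ‖Q z‖ * (1 + ‖z‖) ^ γ) K := by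
    refine hQ.norm.mul (Continuous.continuousOn ?_)
    exact Continuous.rpow_const (by fun_prop) fun z => Or.inl (h0 z).ne'
  obtain ⟨M, hM⟩ := hK.exists_bound_of_continuousOn hc
  refine ⟨max M 0, le_max_right _ _, fun z hz => ?_⟩
  rw [Real.rpow_neg (h0 z).le, ← div_eq_mul_inv, le_div_iff₀ (Real.rpow_pos_of_pos (h0 z) _)]
  exact (le_abs_self _).trans ((hM z hz).trans (le_max_left _ _))

variable {X Y : Type*} [NormedAddCommGroup X] [NormedSpace ℂ X] [CompleteSpace X]
  [NormedAddCommGroup Y] [NormedSpace ℂ Y] {J : Y →L[ℂ] X} {L : X →ₗ.[ℂ] X}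
  {R : ℂ → X →L[ℂ] Y} {k r B γ : ℝ}

/-- A rotation by `θ` changes the real part by at most `|θ| * ‖z‖`, for which half of the opening is
reserved. -/
lemma rotate_mem_region {k θ : ℝ} (hθ : |θ| ≤ k / 2) {z : ℂ} (hz : z ∈ region (k / 2)) :
    Complex.exp (-(θ * Complex.I)) * z ∈ region k := by
  have hz' : -(k / 2 * (1 + ‖z‖)) < z.re := hz
  have hn : ‖Complex.exp (-(θ * Complex.I))‖ = 1 := by
    rw [← neg_mul, ← Complex.ofReal_neg, Complex.norm_exp_ofReal_mul_I]
  have h1 : ‖Complex.exp (-(θ * Complex.I)) - 1‖ ≤ |θ| := by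
    have := Real.norm_exp_I_mul_ofReal_sub_one_le (x := -θ)
    rw [Real.norm_eq_abs, abs_neg] at this
    rwa [show -((θ : ℂ) * Complex.I) = Complex.I * ((-θ : ℝ) : ℂ) by push_cast; ring]
  have h2 : |(Complex.exp (-(θ * Complex.I)) * z).re - z.re| ≤ |θ| * ‖z‖ := by
    rw [← Complex.sub_re]
    refine (Complex.abs_re_le_norm _).trans ?_
    rw [show Complex.exp (-(θ * Complex.I)) * z - z = (Complex.exp (-(θ * Complex.I)) - 1) * z by
      ring, norm_mul]
    gcongr
  have h3 : |θ| * ‖z‖ ≤ k / 2 * ‖z‖ := by gcongr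
  have hk : 0 ≤ k / 2 := (abs_nonneg θ).trans hθ
  change -(k * (1 + ‖_‖)) < _
  rw [norm_mul, hn, one_mul]
  have := (abs_le.1 h2).1
  nlinarith

/-- If the spectrum lies in the open left half plane, the resolvent and its rotations decay. -/
lemma SectorLift.exists_decayFamily_rotate (hR : SectorLift J L R k r B γ)
    (hs : ∀ z : ℂ, 0 ≤ z.re → z ∈ resolventSet L) :
    ∃ k' M M₀ : ℝ, 0 < k' ∧ ∀ θ : ℝ, |θ| ≤ k' →
      DecayFamily k' γ M (fun z => Complex.exp (-(θ * Complex.I)) •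
        R (Complex.exp (-(θ * Complex.I)) * z)) ∧
      (∀ z ∈ region k', Complex.exp (-(θ * Complex.I)) * z ∈ resolventSet L) ∧
      ∀ z ∈ region k', ‖(Complex.exp (-(θ * Complex.I)) •
        R (Complex.exp (-(θ * Complex.I)) * z)) ∘L J‖ ≤ M₀ * (1 + ‖z‖)⁻¹ := by
  obtain ⟨k', K, hk', hk4, hK, hKU, hcase⟩ :=
    exists_region_subset (isOpen_resolventSet L) hs hR.pos r
  have hRc : ContinuousOn R K := hR.lift.diff.continuousOn.mono hKU
  obtain ⟨M₁, hM₁, hb₁⟩ := exists_decay_bound_of_isCompact hK hRc γ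
  obtain ⟨M₂, hM₂, hb₂⟩ := exists_decay_bound_of_isCompact hK
    (Q := fun z => R z ∘L J) (hRc.clm_comp continuousOn_const) 1
  have hmem : ∀ z ∈ region k', z ∈ resolventSet L := fun z hz =>
    (hcase z hz).elim (fun h => hKU h) fun h => hR.mem z h.1 h.2
  have hn : ∀ θ : ℝ, ‖Complex.exp (-(θ * Complex.I))‖ = 1 := fun θ => by
    rw [← neg_mul, ← Complex.ofReal_neg, Complex.norm_exp_ofReal_mul_I]
  have B1 : ∀ z ∈ region k', ‖R z‖ ≤ max M₁ B * (1 + ‖z‖) ^ (-γ) := by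
    intro z hz
    rcases hcase z hz with h | h
    · refine (hb₁ z h).trans ?_
      gcongr
      exact le_max_left _ _
    · refine (hR.bound z h.1 h.2).trans ?_
      gcongr
      exact le_max_right _ _
  have B2 : ∀ z ∈ region k', ‖R z ∘L J‖ ≤ max M₂ B * (1 + ‖z‖)⁻¹ := by
    intro z hz
    rcases hcase z hz with h | h
    · refine (hb₂ z h).trans ?_
      rw [Real.rpow_neg_one]
      gcongr
      exact le_max_left _ _
    · refine (hR.bound_comp z h.1 h.2).trans ?_
      gcongr
      exact le_max_right _ _
  refine ⟨k' / 2, max M₁ B, max M₂ B, by positivity, fun θ hθ => ⟨⟨by positivity, by linarith,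
    hR.rate_pos, hR.rate_le, ?_, ?_⟩, ?_, ?_⟩⟩
  · intro z hz
    have h1 := hR.lift.diff.differentiableAt
      ((isOpen_resolventSet L).mem_nhds (hmem _ (rotate_mem_region hθ hz)))
    refine DifferentiableAt.differentiableWithinAt ?_
    have h2 : DifferentiableAt ℂ (fun z => R (Complex.exp (-(θ * Complex.I)) * z)) z :=
      DifferentiableAt.comp z h1 (by fun_prop)
    exact h2.const_smul (Complex.exp (-(θ * Complex.I)))
  · intro z hz
    rw [norm_smul, hn, one_mul]
    refine (B1 _ (rotate_mem_region hθ hz)).trans_eq ?_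
    rw [norm_mul, hn, one_mul]
  · exact fun z hz => hmem _ (rotate_mem_region hθ hz)
  · intro z hz
    rw [ContinuousLinearMap.smul_comp, norm_smul, hn, one_mul]
    refine (B2 _ (rotate_mem_region hθ hz)).trans_eq ?_
    rw [norm_mul, hn, one_mul]

lemma shift_mem_sector {k' lam : ℝ} (hk' : 0 < k') (hk4 : k' ≤ 1 / 4) (hl : 1 ≤ lam) {z : ℂ}
    (hz : z ∈ region k') : -(k' * ‖z + lam‖) ≤ (z + lam).re ∧ lam / 4 ≤ ‖z + lam‖ ∧
      (1 + ‖z‖) / 5 ≤ 1 + ‖z + lam‖ := by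
  have hz' : -(k' * (1 + ‖z‖)) < z.re := hz
  have h1 : ‖z‖ ≤ ‖z + lam‖ + lam := by
    have := norm_sub_le (z + lam) (lam : ℂ)
    rw [add_sub_cancel_right, Complex.norm_real, Real.norm_of_nonneg (by linarith)] at this
    exact this
  have h2 : lam / 4 ≤ ‖z + lam‖ := by
    by_contra! hlt
    have h3 := (Complex.abs_re_le_norm (z + lam)).trans hlt.le
    rw [Complex.add_re, Complex.ofReal_re] at h3
    have := (abs_le.1 h3).2
    nlinarith
  refine ⟨?_, h2, by linarith⟩
  rw [Complex.add_re, Complex.ofReal_re]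
  nlinarith

/-- After a large shift to the right, the resolvent decays with a small constant. -/
lemma SectorLift.exists_decayFamily_shift (hR : SectorLift J L R k r B γ) :
    ∃ k' M₀ : ℝ, 0 < k' ∧ ∀ κ : ℝ, 0 < κ → ∃ lam : ℝ, 0 < lam ∧
      DecayFamily k' (γ / 2) κ (fun z => R (z + lam)) ∧
      (∀ z ∈ region k', z + lam ∈ resolventSet L) ∧
      ∀ z ∈ region k', ‖R (z + lam) ∘L J‖ ≤ M₀ * (1 + ‖z‖)⁻¹ := by
  have hγ := hR.rate_pos
  have hγ1 := hR.rate_le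
  set k' := min (1 / 4) k with hk'
  have hkp : 0 < k' := lt_min (by norm_num) hR.pos
  have hk4 : k' ≤ 1 / 4 := min_le_left _ _
  refine ⟨k', 5 * |B|, hkp, fun κ hκ => ?_⟩
  -- Half of the decay rate is spent on smallness, through the factor `(lam / 4) ^ (-(γ / 2))`; the
  -- other half remains as decay in `z`.
  have ht := ((tendsto_rpow_neg_atTop (show 0 < γ / 2 by linarith)).comp
    (tendsto_id.atTop_div_const (show (0 : ℝ) < 4 by norm_num))).const_mul (5 * |B|)
  rw [mul_zero] at ht
  obtain ⟨lam, hl1, hl2⟩ := ((eventually_ge_atTop (max 1 (4 * r))).and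
    (ht.eventually_le_const hκ)).exists
  have hl : 1 ≤ lam := (le_max_left _ _).trans hl1
  have hlr : 4 * r ≤ lam := (le_max_right _ _).trans hl1
  have hl0 : 0 < lam := by linarith
  have geo : ∀ z ∈ region k', r ≤ ‖z + lam‖ ∧ -(k * ‖z + lam‖) ≤ (z + lam).re ∧
      lam / 4 ≤ ‖z + lam‖ ∧ (1 + ‖z‖) / 5 ≤ 1 + ‖z + lam‖ := by
    intro z hz
    obtain ⟨h1, h2, h3⟩ := shift_mem_sector hkp hk4 hl hz
    refine ⟨by linarith, ?_, h2, h3⟩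
    have : k' * ‖z + lam‖ ≤ k * ‖z + lam‖ := by
      gcongr; exact min_le_right _ _
    linarith
  refine ⟨lam, hl0, ⟨hkp, hk4, by linarith, by linarith, ?_, ?_⟩, ?_, ?_⟩
  · intro z hz
    obtain ⟨g1, g2, -, -⟩ := geo z hz
    have h1 := hR.lift.diff.differentiableAt
      ((isOpen_resolventSet L).mem_nhds (hR.mem _ g1 g2))
    exact (DifferentiableAt.comp z h1 (by fun_prop)).differentiableWithinAt
  · intro z hz
    obtain ⟨g1, g2, g3, g4⟩ := geo z hz
    have p1 : 0 < 1 + ‖z‖ := by positivity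
    have p2 : 0 < 1 + ‖z + lam‖ := by positivity
    calc ‖R (z + lam)‖ ≤ B * (1 + ‖z + lam‖) ^ (-γ) := hR.bound _ g1 g2
      _ ≤ |B| * (1 + ‖z + lam‖) ^ (-γ) := by gcongr; exact le_abs_self B
      _ = |B| * ((1 + ‖z + lam‖) ^ (-(γ / 2)) * (1 + ‖z + lam‖) ^ (-(γ / 2))) := by
          rw [← Real.rpow_add p2]; congr 2; ring
      _ ≤ |B| * ((lam / 4) ^ (-(γ / 2)) * ((1 + ‖z‖) / 5) ^ (-(γ / 2))) := by
          have e1 : (1 + ‖z + lam‖) ^ (-(γ / 2)) ≤ (lam / 4) ^ (-(γ / 2)) :=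
            Real.rpow_le_rpow_of_nonpos (by positivity) (by linarith) (by linarith)
          have e2 : (1 + ‖z + lam‖) ^ (-(γ / 2)) ≤ ((1 + ‖z‖) / 5) ^ (-(γ / 2)) :=
            Real.rpow_le_rpow_of_nonpos (by positivity) g4 (by linarith)
          gcongr
      _ ≤ |B| * ((lam / 4) ^ (-(γ / 2)) * (5 * (1 + ‖z‖) ^ (-(γ / 2)))) := by
          gcongr
          rw [Real.div_rpow p1.le (by norm_num), Real.rpow_neg (x := 5) (by norm_num), div_inv_eq_mul,
            mul_comm]
          gcongr
          calc (5 : ℝ) ^ (γ / 2) ≤ 5 ^ (1 : ℝ) :=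
                Real.rpow_le_rpow_of_exponent_le (by norm_num) (by linarith)
            _ = 5 := Real.rpow_one 5
      _ = (5 * |B| * (lam / 4) ^ (-(γ / 2))) * (1 + ‖z‖) ^ (-(γ / 2)) := by ring
      _ ≤ κ * (1 + ‖z‖) ^ (-(γ / 2)) := by
          gcongr
          exact hl2
  · exact fun z hz => hR.mem _ (geo z hz).1 (geo z hz).2.1
  · intro z hz
    obtain ⟨g1, g2, g3, g4⟩ := geo z hz
    have p1 : 0 < 1 + ‖z‖ := by positivity
    calc ‖R (z + lam) ∘L J‖ ≤ B * (1 + ‖z + lam‖)⁻¹ := hR.bound_comp _ g1 g2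
      _ ≤ |B| * ((1 + ‖z‖) / 5)⁻¹ := by
          gcongr
          exact le_abs_self B
      _ = _ := by rw [inv_div]; ring

/-- A point with `0 ≤ Re z` outside the disc of centre and radius `s` satisfies `2 s Re z ≤ ‖z‖ ^
2`. Hence if `‖z‖ ≤ r` it is close to the imaginary axis, a compact piece of which has a
neighbourhood in the resolvent set. The other points are in the sector. -/
lemma SectorLift.eventually_isRieszRadius (hR : SectorLift J L R k r B γ)
    (hi : ∀ z : ℂ, z.re = 0 → z ∈ resolventSet L) : ∀ᶠ s in atTop, IsRieszRadius L s := by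
  set K₀ : Set ℂ := Metric.closedBall 0 r ∩ {z | z.re = 0} with hK₀
  have hK₀c : IsCompact K₀ :=
    (isCompact_closedBall 0 r).inter_right (isClosed_eq Complex.continuous_re continuous_const)
  obtain ⟨δ, hδ, hsub⟩ := hK₀c.exists_thickening_subset_open (isOpen_resolventSet L)
    fun z hz => hi z hz.2
  filter_upwards [eventually_gt_atTop (max 0 (r ^ 2 / δ))] with s hs
  have hs0 : 0 < s := (le_max_left _ _).trans_lt hs
  have hs1 : r ^ 2 / δ < s := (le_max_right _ _).trans_lt hs
  rw [div_lt_iff₀ hδ] at hs1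
  refine ⟨hs0, fun z hz hzb => ?_⟩
  rcases le_total r ‖z‖ with h | h
  · refine hR.mem z h ?_
    have : 0 ≤ k * ‖z‖ := mul_nonneg hR.pos.le (norm_nonneg _)
    linarith
  · rw [Metric.mem_ball, not_lt, Complex.dist_eq] at hzb
    have h2 : s ^ 2 ≤ ‖z - s‖ ^ 2 := by gcongr
    rw [← Complex.normSq_eq_norm_sq, Complex.normSq_apply] at h2
    simp only [Complex.sub_re, Complex.ofReal_re, Complex.sub_im, Complex.ofReal_im, sub_zero] at h2
    have h3 : ‖z‖ ^ 2 = z.re * z.re + z.im * z.im := by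
      rw [← Complex.normSq_eq_norm_sq, Complex.normSq_apply]
    have h4 : ‖z‖ ^ 2 ≤ r ^ 2 := by gcongr
    have h5 : z.re < δ := by
      by_contra! hge
      nlinarith
    refine hsub ?_
    rw [Metric.mem_thickening_iff]
    refine ⟨⟨0, z.im⟩, ⟨?_, rfl⟩, ?_⟩
    · rw [mem_closedBall_zero_iff]
      have : ‖(⟨0, z.im⟩ : ℂ)‖ = |z.im| := by
        rw [show (⟨0, z.im⟩ : ℂ) = (z.im : ℂ) * Complex.I by apply Complex.ext <;> simp]
        simp
      rw [this]
      exact (Complex.abs_im_le_norm z).trans h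
    · rw [Complex.dist_eq, show z - (⟨0, z.im⟩ : ℂ) = (z.re : ℂ) by apply Complex.ext <;> simp,
        Complex.norm_real, Real.norm_eq_abs, abs_of_nonneg hz]
      exact h5

/-- Spectral splitting of a generator with inverse `-R₀` into finitely many unstable eigenmodes
`b j` with eigenvalues `μ j > 0` and a part whose resolvent `Q` decays on the right. -/
structure UnstableSplitting (J : Y →L[ℂ] X) (R₀ : X →L[ℂ] Y) {N : ℕ} (μ : Fin N → ℝ)
    (b : Fin N → Y) (ℓ : Fin N → X →L[ℂ] ℂ) (Q : ℂ → X →L[ℂ] Y) (k γ M : ℝ) : Prop where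
  decay : DecayFamily k γ M Q
  mu_pos : ∀ j, 0 < μ j
  dual : ∀ i j, ℓ i (J (b j)) = if i = j then 1 else 0
  eig : ∀ j, R₀ (-(μ j : ℂ) • J (b j)) = b j
  coord : ∀ j u, ℓ j u = -(μ j : ℂ) * ℓ j (J (R₀ u))
  left : ∀ z ∈ region k, ∀ u, Q z (z • J (R₀ u) + u) = R₀ u - ∑ j, ℓ j (J (R₀ u)) • b j
  right : ∀ z ∈ region k, ∀ y, Q z y = R₀ (-(z • J (Q z y)) + (y - ∑ j, ℓ j y • J (b j)))

variable [CompleteSpace Y]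

/-- The decaying part `Q` is `stablePart`, and the functionals `ℓ j` are coordinates of the spectral
projection in the given eigenbasis. Decay of `Q` holds on a compact set by analyticity and far out
by the bound for the resolvent. -/
theorem SectorLift.exists_unstableSplitting (hR : SectorLift J L R k r B γ)
    (hi : ∀ z : ℂ, z.re = 0 → z ∈ resolventSet L) (h : HasDiagonalRealNonResonantUnstablePart L) :
    ∃ (N : ℕ) (μ : Fin N → ℝ) (b : Fin N → Y) (ℓ : Fin N → X →L[ℂ] ℂ) (Q : ℂ → X →L[ℂ] Y)
      (k' M : ℝ), UnstableSplitting J (R 0) μ b ℓ Q k' γ M ∧ IsNonResonant μ := by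
  obtain ⟨N, e, μ, he, hμ⟩ := h
  have hev := hR.eventually_isRieszRadius hi
  obtain ⟨ρ, hρ⟩ := hev.exists
  have hL := hR.lift
  have h0 : (0 : ℂ) ∈ resolventSet L := hi 0 rfl
  set p := rieszLift R ρ with hp
  have hP : unstableProjection L = J ∘L p := hL.unstableProjection_eq hρ hev
  have hPP : ∀ y, p (J (p y)) = p y := hL.rieszLift_mul hρ hρ
  have hrange : ∀ j, ∃ b : Y, J b = (e j : X) ∧ p (J b) = b := by
    intro j
    obtain ⟨x, hx⟩ := (e j).2
    refine ⟨p x, ?_, hPP x⟩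
    rw [← hx, hP]; rfl
  choose b hb hpb using hrange
  have hbne : ∀ j, b j ≠ 0 := by
    intro j hj
    apply e.ne_zero j
    apply Subtype.ext
    rw [← hb j, hj, map_zero]; rfl
  have hres : ∀ j, ∀ w ∈ resolventSet L, (w - μ j) • R w (J (b j)) = b j := by
    intro j w hw
    obtain ⟨hd, hj⟩ := he j
    have hd' : J (b j) ∈ L.domain := by rw [hb j]; exact hd
    have h1 := hL.left hw hd'
    have h2 : L ⟨J (b j), hd'⟩ = (μ j : ℂ) • J (b j) := by
      simp only [hb j]
      exact hj
    rw [h2, ← sub_smul, map_smul] at h1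
    exact h1
  -- On an eigenvector the resolvent is `(w - μ j)⁻¹`. If `μ j` were outside the disc, the Riesz
  -- integral would send the eigenvector to zero, whereas it fixes it.
  have hμpos : ∀ j, 0 < μ j := by
    intro j
    by_cases hball : (μ j : ℂ) ∈ Metric.ball (ρ : ℂ) ρ
    · rw [Metric.mem_ball, Complex.dist_eq, ← Complex.ofReal_sub, Complex.norm_real,
        Real.norm_eq_abs, abs_lt] at hball
      linarith
    · exfalso
      apply hbne j
      have hnot : ∀ w ∈ resolventSet L, w ≠ μ j := by
        rintro w hw rfl
        have := hres j _ hw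
        rw [sub_self, zero_smul] at this
        exact hbne j this.symm
      have hn2 : ∀ w ∈ Metric.closedBall (ρ : ℂ) ρ, w - μ j ≠ 0 := by
        intro w hw h
        rw [sub_eq_zero] at h
        by_cases hwb : w ∈ Metric.ball (ρ : ℂ) ρ
        · exact hball (h ▸ hwb)
        · exact hnot w (hρ.mem w (re_nonneg_of_mem_closedBall hw) hwb) h
      have h1 := hL.clm_rieszLift hρ (ContinuousLinearMap.id ℂ Y) (J (b j))
      rw [ContinuousLinearMap.id_apply, ← hp, hpb j] at h1
      rw [h1]
      have h2 : circleIntegral (fun w => (w - (μ j : ℂ))⁻¹ • b j) (ρ : ℂ) ρ = 0 := by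
        refine Complex.circleIntegral_eq_zero_of_differentiable_on_off_countable hρ.pos.le
          Set.countable_empty ?_ ?_
        · exact (ContinuousOn.inv₀ (by fun_prop) hn2).smul continuousOn_const
        · intro z hz
          have := hn2 z (Metric.ball_subset_closedBall hz.1)
          have h3 : DifferentiableAt ℂ (fun w : ℂ => w - (μ j : ℂ)) z := by fun_prop
          exact (h3.fun_inv this).smul_const _
      rw [← circleIntegral.integral_congr hρ.pos.le (f := fun w => (w - (μ j : ℂ))⁻¹ • b j), h2,
        smul_zero]
      intro w hw
      have h3 := hn2 w (Metric.sphere_subset_closedBall hw)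
      have h4 := hres j w (hρ.sphere hw)
      simp only [ContinuousLinearMap.id_apply]
      nth_rewrite 1 [← h4]
      rw [smul_smul, inv_mul_cancel₀ h3, one_smul]
  have : FiniteDimensional ℂ (unstableSpace L) := Module.Basis.finiteDimensional_of_finite e
  have hmem : ∀ x, unstableProjection L x ∈ unstableSpace L := fun x => ⟨x, rfl⟩
  set ℓ : Fin N → X →L[ℂ] ℂ := fun j =>
    (LinearMap.toContinuousLinearMap (e.coord j)) ∘L
      ((unstableProjection L).codRestrict (unstableSpace L) hmem) with hℓ
  have hℓapp : ∀ j x, ℓ j x = e.repr ⟨unstableProjection L x, hmem x⟩ j := fun j x => rfl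
  have hdual : ∀ i j, ℓ i (J (b j)) = if i = j then 1 else 0 := by
    intro i j
    rw [hℓapp]
    have : (⟨unstableProjection L (J (b j)), hmem _⟩ : unstableSpace L) = e j := by
      apply Subtype.ext
      simp only [hP, ContinuousLinearMap.comp_apply]
      rw [hpb j, hb j]
    rw [this, Module.Basis.repr_self, Finsupp.single_apply]
    simp only [eq_comm]
  have hsum : ∀ y, p y = ∑ j, ℓ j y • b j := by
    intro y
    apply hL.inj
    rw [map_sum]
    simp only [map_smul, hb]
    have := congrArg Subtype.val (e.sum_repr ⟨unstableProjection L y, hmem y⟩)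
    simp only [hP, ContinuousLinearMap.comp_apply] at this
    rw [← this]
    simp only [hℓapp, hP, Submodule.coe_sum, Submodule.coe_smul, ContinuousLinearMap.comp_apply]
  have hℓp : ∀ j v, ℓ j (J (p v)) = ℓ j v := by
    intro j v
    rw [hsum v, map_sum, map_sum]
    simp only [map_smul, hdual, smul_eq_mul, mul_ite, mul_one, mul_zero]
    simp
  have heig : ∀ j, R 0 (-(μ j : ℂ) • J (b j)) = b j := by
    intro j
    have := hres j 0 h0
    rwa [zero_sub, ← map_smul] at this
  set U := Metric.ball (ρ : ℂ) ρ ∪ resolventSet L with hU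
  have hUo : IsOpen U := Metric.isOpen_ball.union (isOpen_resolventSet L)
  have hU0 : ∀ z : ℂ, 0 ≤ z.re → z ∈ U := by
    intro z hz
    by_cases hb : z ∈ Metric.ball (ρ : ℂ) ρ
    · exact Or.inl hb
    · exact Or.inr (hρ.mem z hz hb)
  obtain ⟨k', K, hk', hk4, hK, hKU, hcase⟩ := exists_region_subset hUo hU0 hR.pos r
  have hd : DifferentiableOn ℂ (stablePart J R ρ) U := hL.differentiableOn_stablePart hρ
  obtain ⟨M₁, hM₁, hb₁⟩ := exists_decay_bound_of_isCompact hK (hd.continuousOn.mono hKU) γ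
  have hreg : ∀ z ∈ region k', z ∈ U := fun z hz =>
    (hcase z hz).elim (fun h => hKU h) fun h => Or.inr (hR.mem z h.1 h.2)
  refine ⟨N, μ, b, ℓ, stablePart J R ρ, k', max M₁ ((1 + ‖p‖ * ‖J‖) * B),
    ⟨⟨hk', hk4, hR.rate_pos, hR.rate_le, hd.mono hreg, ?_⟩, hμpos, hdual, heig, ?_, ?_, ?_⟩, hμ⟩
  · intro z hz
    rcases hcase z hz with h | h
    · refine (hb₁ z h).trans ?_
      gcongr
      exact le_max_left _ _
    · rw [hL.stablePart_eq hρ (hR.mem z h.1 h.2)]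
      have hb := hR.bound z h.1 h.2
      calc ‖R z - p ∘L (J ∘L R z)‖ ≤ ‖R z‖ + ‖p‖ * (‖J‖ * ‖R z‖) := by
            refine (norm_sub_le _ _).trans ?_
            gcongr
            refine (ContinuousLinearMap.opNorm_comp_le _ _).trans ?_
            gcongr
            exact ContinuousLinearMap.opNorm_comp_le _ _
        _ = (1 + ‖p‖ * ‖J‖) * ‖R z‖ := by ring
        _ ≤ (1 + ‖p‖ * ‖J‖) * (B * (1 + ‖z‖) ^ (-γ)) := by gcongr
        _ = ((1 + ‖p‖ * ‖J‖) * B) * (1 + ‖z‖) ^ (-γ) := by ring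
        _ ≤ _ := by
          gcongr
          exact le_max_right _ _
  · intro j u
    rw [← hℓp j (J (R 0 u)), hp, hL.rieszLift_comm hρ h0, ← hp, hsum u]
    simp only [map_sum, map_smul]
    have h2 : ∀ i, -(μ i : ℂ) • R 0 (J (b i)) = b i := fun i => by rw [← map_smul, heig i]
    have h3 : ∀ i, ℓ j (J (R 0 (J (b i)))) = -(μ i : ℂ)⁻¹ * if j = i then 1 else 0 := by
      intro i
      have hne : (μ i : ℂ) ≠ 0 := Complex.ofReal_ne_zero.2 (hμpos i).ne'
      have h4 := congrArg (fun v => ℓ j (J v)) (h2 i)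
      simp only [map_smul, hdual, smul_eq_mul] at h4
      rw [← h4]
      field_simp
    simp only [h3, smul_eq_mul, mul_ite, mul_one, mul_zero, Finset.sum_ite_eq, Finset.mem_univ,
      if_true]
    have hne : (μ j : ℂ) ≠ 0 := Complex.ofReal_ne_zero.2 (hμpos j).ne'
    field_simp
  · intro z hz u
    have h1 := hL.stablePart_mul hρ (hreg z hz) h0 u
    rw [sub_zero] at h1
    rw [h1, ← hsum]
  · intro z hz y
    have h1 := hL.mul_stablePart hρ (hreg z hz) h0 y
    rw [zero_sub, neg_smul] at h1
    rw [← hp, hsum y, map_sum] at h1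
    simp only [map_smul J] at h1
    exact h1

end

section

/-! ### Analyticity of Fréchet differentiable maps between complex Banach spaces -/

universe u

section

variable {E F : Type u} [NormedAddCommGroup E] [NormedSpace ℂ E]
  [NormedAddCommGroup F] [NormedSpace ℂ F]

/-- A complex Fréchet differentiable map that is bounded on bounded sets. -/
structure IsEntire (g : E → F) : Prop where
  diff : Differentiable ℂ g
  bdd : ∀ r : ℝ, ∃ C : ℝ, 0 ≤ C ∧ ∀ y, ‖y‖ ≤ r → ‖g y‖ ≤ C

lemma hasDerivAt_comp_line {g : E → F} (hg : Differentiable ℂ g) (x v : E) (ζ : ℂ) :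
    HasDerivAt (fun ζ : ℂ => g (x + ζ • v)) (fderiv ℂ g (x + ζ • v) v) ζ := by
  have h1 : HasDerivAt (fun ζ : ℂ => x + ζ • v) v ζ := by
    simpa using ((hasDerivAt_id ζ).smul_const v).const_add x
  exact (hg (x + ζ • v)).hasFDerivAt.comp_hasDerivAt ζ h1

/-- The one-variable Cauchy estimate on the complex line through `x` in direction `v`, on a disc of
radius `s / ‖v‖`. -/
lemma norm_fderiv_le_of_forall_mem_closedBall {g : E → F} (hg : Differentiable ℂ g) {x : E}
    {s M : ℝ} (hs : 0 < s) (hM : ∀ y ∈ Metric.closedBall x s, ‖g y‖ ≤ M) :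
    ‖fderiv ℂ g x‖ ≤ M / s := by
  have hM0 : 0 ≤ M := (norm_nonneg _).trans (hM x (Metric.mem_closedBall_self hs.le))
  refine ContinuousLinearMap.opNorm_le_bound _ (by positivity) fun v => ?_
  rcases eq_or_ne v 0 with rfl | hv
  · simp
  have hv0 : 0 < ‖v‖ := norm_pos_iff.2 hv
  have hd : Differentiable ℂ fun ζ : ℂ => g (x + ζ • v) := fun ζ =>
    (hasDerivAt_comp_line hg x v ζ).differentiableAt
  have h1 := Complex.norm_deriv_le_of_forall_mem_sphere_norm_le (c := 0) (R := s / ‖v‖) (C := M)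
    (by positivity) hd.diffContOnCl (fun z hz => hM _ (by
      rw [mem_sphere_zero_iff_norm] at hz
      rw [mem_closedBall_iff_norm, add_sub_cancel_left, norm_smul, hz]
      field_simp; rfl))
  rw [(hasDerivAt_comp_line hg x v 0).deriv, zero_smul, add_zero] at h1
  refine h1.trans_eq ?_
  field_simp

lemma IsEntire.exists_fderiv_le {g : E → F} (hg : IsEntire g) (r : ℝ) :
    ∃ C : ℝ, 0 ≤ C ∧ ∀ y, ‖y‖ ≤ r → ‖fderiv ℂ g y‖ ≤ C := by
  obtain ⟨C, hC, h⟩ := hg.bdd (r + 1)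
  refine ⟨C, hC, fun y hy => ?_⟩
  have := norm_fderiv_le_of_forall_mem_closedBall hg.diff one_pos (x := y) (M := C) fun z hz => h z ?_
  · simpa using this
  · rw [mem_closedBall_iff_norm] at hz
    have := norm_le_norm_add_norm_sub' z y
    linarith

lemma IsEntire.exists_norm_sub_le {g : E → F} (hg : IsEntire g) (r : ℝ) :
    ∃ C : ℝ, 0 ≤ C ∧ ∀ y w, ‖y‖ ≤ r → ‖w‖ ≤ 1 → ‖g (y + w) - g y‖ ≤ C * ‖w‖ := by
  obtain ⟨C, hC, h⟩ := hg.exists_fderiv_le (r + 1)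
  refine ⟨C, hC, fun y w hy hw => ?_⟩
  let _ : NormedSpace ℝ E := NormedSpace.restrictScalars ℝ ℂ E
  have := (convex_closedBall (0 : E) (r + 1)).norm_image_sub_le_of_norm_fderiv_le (𝕜 := ℂ) (f := g)
    (x := y) (y := y + w) (fun x _ => hg.diff x) (fun x hx => h x (by simpa using hx))
    (by simp; linarith)
    (by rw [mem_closedBall_zero_iff]; exact (norm_add_le _ _).trans (by linarith))
  simpa using this

lemma IsEntire.sub_shift {g : E → F} (hg : IsEntire g) (w : E) :
    Differentiable ℂ fun y => g (y + w) - g y :=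
  (hg.diff.comp (differentiable_id.add_const w)).sub hg.diff

lemma IsEntire.fderiv_shift {g : E → F} (hg : IsEntire g) (w y : E) :
    fderiv ℂ (fun y => g (y + w) - g y) y = fderiv ℂ g (y + w) - fderiv ℂ g y := by
  have h1 : DifferentiableAt ℂ (fun y => g (y + w)) y :=
    (hg.diff.comp (differentiable_id.add_const w)) y
  rw [fderiv_fun_sub h1 (hg.diff y), fderiv_comp_add_right]

/-- The Cauchy estimate is applied to the difference `y ↦ g (y + w) - g y`, which is already of size
`‖w‖`. -/
lemma IsEntire.exists_fderiv_sub_le {g : E → F} (hg : IsEntire g) (r : ℝ) :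
    ∃ C : ℝ, 0 ≤ C ∧ ∀ y w, ‖y‖ ≤ r → ‖w‖ ≤ 1 →
      ‖fderiv ℂ g (y + w) - fderiv ℂ g y‖ ≤ C * ‖w‖ := by
  obtain ⟨C, hC, h⟩ := hg.exists_norm_sub_le (r + 1)
  refine ⟨C, hC, fun y w hy hw => ?_⟩
  rw [← hg.fderiv_shift]
  have := norm_fderiv_le_of_forall_mem_closedBall (hg.sub_shift w) one_pos (x := y)
    (M := C * ‖w‖) fun z hz => h z w ?_ hw
  · simpa using this
  · rw [mem_closedBall_iff_norm] at hz
    have := norm_le_norm_add_norm_sub' z y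
    linarith

lemma IsEntire.exists_taylor_two_le {g : E → F} (hg : IsEntire g) (r : ℝ) :
    ∃ C : ℝ, 0 ≤ C ∧ ∀ y w, ‖y‖ ≤ r → ‖w‖ ≤ 1 →
      ‖g (y + w) - g y - fderiv ℂ g y w‖ ≤ C * ‖w‖ ^ 2 := by
  obtain ⟨C, hC, h⟩ := hg.exists_fderiv_sub_le r
  refine ⟨C, hC, fun y w hy hw => ?_⟩
  let _ : NormedSpace ℝ E := NormedSpace.restrictScalars ℝ ℂ E
  have := (convex_closedBall y ‖w‖).norm_image_sub_le_of_norm_fderiv_le' (𝕜 := ℂ) (f := g)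
    (C := C * ‖w‖) (φ := fderiv ℂ g y) (x := y) (y := y + w) (fun x _ => hg.diff x)
    (fun x hx => by
      rw [mem_closedBall_iff_norm] at hx
      have := h y (x - y) hy (hx.trans hw)
      rw [add_sub_cancel] at this
      exact this.trans (by gcongr)) (by simp) (by simp)
  rw [add_sub_cancel_left] at this
  refine this.trans_eq (by ring)

variable [CompleteSpace F]

/-- A directional derivative is an average of values of `g`, so uniform estimates for `g` pass to
`g'` under the integral sign. -/
lemma IsEntire.fderiv_apply_eq {g : E → F} (hg : IsEntire g) (y v : E) :
    fderiv ℂ g y v = (2 * Real.pi * Complex.I : ℂ)⁻¹ •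
      circleIntegral (fun ζ => ((ζ - 0) ^ 2)⁻¹ • g (y + ζ • v)) 0 1 := by
  have hd : Differentiable ℂ fun ζ : ℂ => g (y + ζ • v) := fun ζ =>
    (hasDerivAt_comp_line hg.diff y v ζ).differentiableAt
  have := Complex.two_pi_I_inv_smul_circleIntegral_sub_sq_inv_smul_of_differentiable
    (w₀ := 0) isOpen_univ (Set.subset_univ (Metric.closedBall 0 1)) hd.differentiableOn (by simp)
  rw [this, (hasDerivAt_comp_line hg.diff y v 0).deriv, zero_smul, add_zero]

lemma IsEntire.continuous_fderiv {g : E → F} (hg : IsEntire g) : Continuous (fderiv ℂ g) := by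
  rw [continuous_iff_continuousAt]
  intro y
  obtain ⟨C, hC, h⟩ := hg.exists_fderiv_sub_le ‖y‖
  rw [ContinuousAt, tendsto_iff_norm_sub_tendsto_zero]
  have h1 : Tendsto (fun x => C * ‖x - y‖) (𝓝 y) (𝓝 0) := by
    have : ContinuousAt (fun x => C * ‖x - y‖) y := by fun_prop
    simpa [ContinuousAt] using this
  refine squeeze_zero' (Eventually.of_forall fun _ => norm_nonneg _) ?_ h1
  filter_upwards [Metric.closedBall_mem_nhds y one_pos] with x hx
  rw [mem_closedBall_iff_norm] at hx
  simpa using h y (x - y) le_rfl hx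

/-- `D` is the Cauchy average of `g'` over the circle in direction `v`; the error is the same
average of the second-order Taylor errors of `g`, uniformly for `‖v‖ ≤ 1`. -/
lemma IsEntire.exists_fderiv_apply_taylor_le {g : E → F} (hg : IsEntire g) (r : ℝ) :
    ∃ C : ℝ, 0 ≤ C ∧ ∀ y v, ‖y‖ ≤ r → ‖v‖ ≤ 1 → ∃ D : E →L[ℂ] F, ∀ w, ‖w‖ ≤ 1 →
      ‖fderiv ℂ g (y + w) v - fderiv ℂ g y v - D w‖ ≤ C * ‖w‖ ^ 2 := by
  obtain ⟨C, hC, h⟩ := hg.exists_taylor_two_le (r + 1)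
  refine ⟨C, hC, fun y v hy hv => ?_⟩
  have hc1 : ContinuousOn (fun ζ : ℂ => ((ζ - 0) ^ 2)⁻¹) (Metric.sphere 0 1) := by
    refine ContinuousOn.inv₀ (by fun_prop) fun ζ hζ => ?_
    rw [mem_sphere_zero_iff_norm] at hζ
    have : ζ ≠ 0 := by rintro rfl; simp at hζ
    simpa using this
  have hi : CircleIntegrable (fun ζ : ℂ => ((ζ - 0) ^ 2)⁻¹ • fderiv ℂ g (y + ζ • v)) 0 1 :=
    (hc1.smul ((hg.continuous_fderiv.comp (by fun_prop)).continuousOn)).circleIntegrable zero_le_one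
  refine ⟨(2 * Real.pi * Complex.I : ℂ)⁻¹ •
    circleIntegral (fun ζ => ((ζ - 0) ^ 2)⁻¹ • fderiv ℂ g (y + ζ • v)) 0 1, fun w hw => ?_⟩
  have hgi : ∀ x : E, CircleIntegrable (fun ζ : ℂ => ((ζ - 0) ^ 2)⁻¹ • g (x + ζ • v)) 0 1 := fun x =>
    (hc1.smul ((hg.diff.continuous.comp (by fun_prop)).continuousOn)).circleIntegrable zero_le_one
  have hi2 : CircleIntegrable (fun ζ : ℂ => ((ζ - 0) ^ 2)⁻¹ • fderiv ℂ g (y + ζ • v) w) 0 1 :=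
    (hc1.smul ((hg.continuous_fderiv.comp (by fun_prop)).clm_apply
      continuous_const).continuousOn).circleIntegrable zero_le_one
  have e1 := clm_circleIntegral (ContinuousLinearMap.apply ℂ F w) hi
  simp only [ContinuousLinearMap.apply_apply, smul_apply] at e1
  have hsub : CircleIntegrable (fun ζ : ℂ => ((ζ - 0) ^ 2)⁻¹ • g (y + w + ζ • v) -
    ((ζ - 0) ^ 2)⁻¹ • g (y + ζ • v)) 0 1 := (hgi (y + w)).sub (hgi y)
  rw [smul_apply, e1, hg.fderiv_apply_eq, hg.fderiv_apply_eq y v, ← smul_sub, ← smul_sub,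
    ← circleIntegral.integral_sub (hgi _) (hgi _), ← circleIntegral.integral_sub hsub hi2]
  refine (circleIntegral.norm_two_pi_i_inv_smul_integral_le_of_norm_le_const zero_le_one
    fun ζ hζ => ?_).trans_eq (one_mul _)
  rw [mem_sphere_zero_iff_norm] at hζ
  rw [← smul_sub, ← smul_sub, norm_smul, sub_zero, norm_inv, norm_pow, hζ]
  simp only [one_pow, inv_one, one_mul]
  rw [add_right_comm]
  refine h _ w ?_ hw
  refine (norm_add_le _ _).trans ?_
  rw [norm_smul, hζ, one_mul]
  linarith

lemma IsEntire.exists_hasFDerivAt_fderiv_apply {g : E → F} (hg : IsEntire g) (y : E) :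
    ∃ C : ℝ, 0 ≤ C ∧ ∀ v, ‖v‖ ≤ 1 → ∃ D : E →L[ℂ] F,
      HasFDerivAt (fun x => fderiv ℂ g x v) D y ∧ ∀ w, ‖w‖ ≤ 1 →
      ‖fderiv ℂ g (y + w) v - fderiv ℂ g y v - D w‖ ≤ C * ‖w‖ ^ 2 := by
  obtain ⟨C, hC, h⟩ := hg.exists_fderiv_apply_taylor_le ‖y‖
  refine ⟨C, hC, fun v hv => ?_⟩
  obtain ⟨D, hD⟩ := h y v le_rfl hv
  refine ⟨D, ?_, hD⟩
  rw [hasFDerivAt_iff_isLittleO_nhds_zero]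
  refine Asymptotics.IsBigO.trans_isLittleO (g := fun w : E => ‖w‖ ^ 2) ?_
    (Asymptotics.isLittleO_norm_pow_id one_lt_two)
  refine Asymptotics.IsBigO.of_bound C ?_
  filter_upwards [Metric.closedBall_mem_nhds (0 : E) one_pos] with w hw
  rw [Real.norm_of_nonneg (by positivity)]
  exact hD w (by simpa using hw)

lemma IsEntire.differentiable_fderiv_apply {g : E → F} (hg : IsEntire g) (v : E) :
    Differentiable ℂ fun x => fderiv ℂ g x v := by
  intro y
  obtain ⟨C, hC, h⟩ := hg.exists_hasFDerivAt_fderiv_apply y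
  set t : ℂ := ((‖v‖ + 1 : ℝ) : ℂ)⁻¹ with ht
  have ht0 : t ≠ 0 := by
    rw [ht]; exact inv_ne_zero (Complex.ofReal_ne_zero.2 (by positivity))
  have htv : ‖t • v‖ ≤ 1 := by
    rw [norm_smul, ht, norm_inv, Complex.norm_real, Real.norm_of_nonneg (by positivity),
      inv_mul_le_iff₀ (by positivity)]
    linarith
  obtain ⟨D, h1, -⟩ := h (t • v) htv
  have h2 : (fun x => fderiv ℂ g x v) = fun x => t⁻¹ • fderiv ℂ g x (t • v) := by
    funext x
    rw [map_smul, smul_smul, inv_mul_cancel₀ ht0, one_smul]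
  rw [h2]
  exact (h1.const_smul t⁻¹).differentiableAt

lemma opNorm_le_of_unit_ball {T : E →L[ℂ] F} {K : ℝ} (hK : 0 ≤ K)
    (h : ∀ v, ‖v‖ ≤ 1 → ‖T v‖ ≤ K) : ‖T‖ ≤ K := by
  refine ContinuousLinearMap.opNorm_le_bound _ hK fun v => ?_
  rcases eq_or_ne v 0 with rfl | hv
  · simp
  have hv0 : 0 < ‖v‖ := norm_pos_iff.2 hv
  have h1 := h (((‖v‖ : ℝ) : ℂ)⁻¹ • v) (by
    rw [norm_smul, norm_inv, Complex.norm_real, norm_norm, inv_mul_cancel₀ hv0.ne'])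
  rw [map_smul, norm_smul, norm_inv, Complex.norm_real, norm_norm, inv_mul_le_iff₀ hv0] at h1
  linarith

/-- Differentiability in operator norm follows from that of `x ↦ g' x v` for each `v`, because the
second-order error is uniform over the unit ball of `v`. The second derivative is assembled as a
bounded bilinear map. -/
lemma IsEntire.fderiv {g : E → F} (hg : IsEntire g) : IsEntire (fderiv ℂ g) := by
  refine ⟨fun y => ?_, hg.exists_fderiv_le⟩
  obtain ⟨C, hC, h⟩ := hg.exists_hasFDerivAt_fderiv_apply y
  obtain ⟨C', hC', h'⟩ := hg.exists_fderiv_le (‖y‖ + 1)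
  have hd := fun v => hg.differentiable_fderiv_apply v y
  have hnorm : ∀ w v : E, ‖_root_.fderiv ℂ (fun x => _root_.fderiv ℂ g x v) y w‖ ≤ C' * ‖w‖ * ‖v‖ := by
    intro w v
    have := norm_fderiv_le_of_forall_mem_closedBall (g := fun x => _root_.fderiv ℂ g x v)
      (hg.differentiable_fderiv_apply v) one_pos (x := y) (M := C' * ‖v‖) fun z hz => by
        refine (ContinuousLinearMap.le_opNorm _ _).trans ?_
        gcongr
        refine h' z ?_
        rw [mem_closedBall_iff_norm] at hz
        have := norm_le_norm_add_norm_sub' z y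
        linarith
    rw [div_one] at this
    refine (ContinuousLinearMap.le_opNorm _ _).trans ?_
    calc _ ≤ C' * ‖v‖ * ‖w‖ := by gcongr
      _ = _ := by ring
  set B : E →L[ℂ] E →L[ℂ] F := LinearMap.mkContinuous₂
    (LinearMap.mk₂ ℂ (fun w v => _root_.fderiv ℂ (fun x => _root_.fderiv ℂ g x v) y w)
      (fun w w' v => map_add _ w w') (fun a w v => map_smul _ a w)
      (fun w v v' => by
        simp only [map_add]
        rw [fderiv_fun_add (hd v) (hd v')]
        rfl)
      (fun a w v => by
        simp only [map_smul]
        rw [fderiv_fun_const_smul (hd v) a]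
        rfl)) C' hnorm with hB
  refine HasFDerivAt.differentiableAt (f' := B) ?_
  rw [hasFDerivAt_iff_isLittleO_nhds_zero]
  refine Asymptotics.IsBigO.trans_isLittleO (g := fun w : E => ‖w‖ ^ 2) ?_
    (Asymptotics.isLittleO_norm_pow_id one_lt_two)
  refine Asymptotics.IsBigO.of_bound C ?_
  filter_upwards [Metric.closedBall_mem_nhds (0 : E) one_pos] with w hw
  rw [Real.norm_of_nonneg (by positivity)]
  refine opNorm_le_of_unit_ball (by positivity) fun v hv => ?_
  obtain ⟨D, h1, h2⟩ := h v hv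
  have h3 : B w v = D w := by
    change _root_.fderiv ℂ (fun x => _root_.fderiv ℂ g x v) y w = _
    rw [h1.fderiv]
  rw [sub_apply, sub_apply, h3]
  exact h2 w (by simpa using hw)

lemma IsEntire.contDiff {g : E → F} (hg : IsEntire g) : ContDiff ℂ (⊤ : ℕ∞) g := by
  rw [contDiff_infty]
  intro n
  induction n generalizing F with
  | zero => exact contDiff_zero.2 hg.diff.continuous
  | succ n ih =>
    push_cast
    rw [contDiff_succ_iff_fderiv]
    exact ⟨hg.diff, fun h => by simp at h, ih hg.fderiv⟩

/-- Each of the `n` differentiations uses up a radius `s`. -/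
lemma IsEntire.norm_iteratedFDeriv_le {g : E → F} (hg : IsEntire g) (n : ℕ) {s M : ℝ} (hs : 0 < s)
    {x : E} (hM : ∀ y ∈ Metric.closedBall x (n * s), ‖g y‖ ≤ M) :
    ‖iteratedFDeriv ℂ n g x‖ ≤ M / s ^ n := by
  induction n generalizing F M with
  | zero => simpa using hM x (by simp)
  | succ n ih =>
    rw [← norm_iteratedFDeriv_fderiv]
    refine (ih hg.fderiv (M := M / s) fun y hy => ?_).trans_eq ?_
    · refine norm_fderiv_le_of_forall_mem_closedBall hg.diff hs fun z hz => hM z ?_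
      rw [mem_closedBall_iff_norm] at hy hz ⊢
      have := norm_sub_le_norm_sub_add_norm_sub z y x
      push_cast
      linarith
    · rw [pow_succ, div_div, mul_comm]

/-- Cauchy estimates with steps `1 / n` inside the unit ball bound the `n`-th Taylor coefficient by
`C n ^ n / n! ≤ C e ^ n`, and `e < 4`. The sum is `g` because it is so along each complex line
through the origin. -/
lemma IsEntire.hasFPowerSeriesOnBall {g : E → F} (hg : IsEntire g) :
    ∃ p : FormalMultilinearSeries ℂ E F, HasFPowerSeriesOnBall g p 0 (1 / 4) := by
  obtain ⟨C, hC, hb⟩ := hg.bdd 1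
  refine ⟨fun n => ((n.factorial : ℂ)⁻¹) • iteratedFDeriv ℂ n g 0, ?_, by norm_num, ?_⟩
  · have : ((1 / 4 : NNReal) : ENNReal) = 1 / 4 := by norm_num
    rw [← this]
    refine FormalMultilinearSeries.le_radius_of_bound _ (max C ‖g 0‖) fun n => ?_
    rcases Nat.eq_zero_or_pos n with rfl | hn
    · simp
    have hn0 : (0 : ℝ) < n := Nat.cast_pos.2 hn
    have h1 := hg.norm_iteratedFDeriv_le n (s := 1 / n) (x := 0) (M := C) (by positivity)
      (fun y hy => hb y (by
        rw [mem_closedBall_zero_iff] at hy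
        rwa [mul_one_div_cancel hn0.ne'] at hy))
    have h2 := Real.pow_div_factorial_le_exp (n : ℝ) hn0.le n
    have hf : (0 : ℝ) < n.factorial := Nat.cast_pos.2 n.factorial_pos
    rw [norm_smul, norm_inv, Complex.norm_natCast]
    calc _ ≤ (n.factorial : ℝ)⁻¹ * (C / (1 / n) ^ n) * (1 / 4) ^ n := by
          push_cast
          gcongr
      _ = C * ((n : ℝ) ^ n / n.factorial) * (1 / 4) ^ n := by
          rw [div_pow, one_pow]; field_simp
      _ ≤ C * Real.exp n * (1 / 4) ^ n := by gcongr
      _ ≤ C * 1 := by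
          rw [mul_assoc]
          gcongr
          rw [← Real.exp_one_pow, ← mul_pow]
          refine pow_le_one₀ (by positivity) ?_
          have := Real.exp_one_lt_d9
          linarith
      _ ≤ _ := by rw [mul_one]; exact le_max_left _ _
  · intro y hy
    have hd : Differentiable ℂ fun ζ : ℂ => g (ζ • y) := fun ζ => by
      simpa using (hasDerivAt_comp_line hg.diff 0 y ζ).differentiableAt
    have h1 := Complex.hasSum_taylorSeries_of_entire hd 0 1
    rw [one_smul] at h1
    rw [zero_add]
    convert h1 using 2 with n
    have h2 := (ContinuousLinearMap.toSpanSingleton ℂ y).iteratedFDeriv_comp_right hg.contDiff 0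
      (i := n) (by exact_mod_cast le_top)
    have h3 : (g ∘ ContinuousLinearMap.toSpanSingleton ℂ y) = fun ζ : ℂ => g (ζ • y) := rfl
    rw [h3] at h2
    rw [iteratedDeriv_eq_iteratedFDeriv, h2]
    simp

end

end

section

/-! ### Absolutely summable families and lifts of multilinear maps -/

open scoped ENNReal

section

universe u

variable {ι : Type}

/-- Absolutely summable families. -/
def SumFamily (ι : Type) (E : Type u) [NormedAddCommGroup E] : Type u :=
  lp (fun _ : ι => E) 1

instance {E : Type u} [NormedAddCommGroup E] : NormedAddCommGroup (SumFamily ι E) :=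
  inferInstanceAs (NormedAddCommGroup (lp (fun _ : ι => E) 1))

instance {E : Type u} [NormedAddCommGroup E] [NormedSpace ℂ E] : NormedSpace ℂ (SumFamily ι E) :=
  inferInstanceAs (NormedSpace ℂ (lp (fun _ : ι => E) 1))

instance {E : Type u} [NormedAddCommGroup E] [CompleteSpace E] : CompleteSpace (SumFamily ι E) :=
  inferInstanceAs (CompleteSpace (lp (fun _ : ι => E) 1))

instance {E : Type u} [NormedAddCommGroup E] : CoeFun (SumFamily ι E) fun _ => ι → E :=
  ⟨fun a => (a : lp (fun _ : ι => E) 1).1⟩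

variable {E F G H : Type u} [NormedAddCommGroup E] [NormedSpace ℂ E]
  [NormedAddCommGroup F] [NormedSpace ℂ F] [NormedAddCommGroup G] [NormedSpace ℂ G]
  [NormedAddCommGroup H] [NormedSpace ℂ H]

lemma SumFamily.add_apply (a a' : SumFamily ι E) (m : ι) : (a + a') m = a m + a' m := rfl

lemma SumFamily.smul_apply (z : ℂ) (a : SumFamily ι E) (m : ι) : (z • a) m = z • a m := rfl

lemma SumFamily.zero_apply (m : ι) : (0 : SumFamily ι E) m = 0 := rfl

lemma SumFamily.hasSum_norm (a : SumFamily ι E) : HasSum (fun m => ‖a m‖) ‖a‖ := by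
  have h : HasSum (fun m => ‖a m‖ ^ (1 : ℝ≥0∞).toReal) (‖a‖ ^ (1 : ℝ≥0∞).toReal) :=
    lp.hasSum_norm (E := fun _ : ι => E) (p := 1) (by simp) a
  simpa only [ENNReal.toReal_one, Real.rpow_one] using h

lemma SumFamily.summable_apply [CompleteSpace F] {S : ι → E →L[ℂ] F} {C : ℝ}
    (hS : ∀ m, ‖S m‖ ≤ C) (a : SumFamily ι E) : Summable fun m => S m (a m) := by
  refine Summable.of_norm_bounded (a.hasSum_norm.summable.mul_left C) fun m => ?_
  exact ((S m).le_opNorm _).trans (by gcongr; exact hS m)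

/-- The map `a ↦ ∑ S m (a m)` for a bounded family `S` of operators. -/
def sumMap [CompleteSpace F] (S : ι → E →L[ℂ] F) (C : ℝ) (hS : ∀ m, ‖S m‖ ≤ C) :
    SumFamily ι E →L[ℂ] F :=
  LinearMap.mkContinuous
    { toFun := fun a => ∑' m, S m (a m)
      map_add' := fun a a' => by
        rw [← (SumFamily.summable_apply hS a).tsum_add (SumFamily.summable_apply hS a')]
        simp only [SumFamily.add_apply, map_add]
      map_smul' := fun z a => by
        rw [RingHom.id_apply, ← (SumFamily.summable_apply hS a).tsum_const_smul]
        simp only [SumFamily.smul_apply, map_smul] } C fun a => by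
    refine tsum_of_norm_bounded (a.hasSum_norm.mul_left C) fun m => ?_
    exact ((S m).le_opNorm _).trans (by gcongr; exact hS m)

lemma sumMap_apply [CompleteSpace F] {S : ι → E →L[ℂ] F} {C : ℝ} (hS : ∀ m, ‖S m‖ ≤ C)
    (a : SumFamily ι E) : sumMap S C hS a = ∑' m, S m (a m) := rfl

lemma norm_sumMap_le [CompleteSpace F] {S : ι → E →L[ℂ] F} {C : ℝ} (hC : 0 ≤ C)
    (hS : ∀ m, ‖S m‖ ≤ C) : ‖sumMap S C hS‖ ≤ C := LinearMap.mkContinuous_norm_le _ hC _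

/-- Composition with `S m` followed by summation, as an operation on operators. -/
def sumMapComp [CompleteSpace H] (S : ι → G →L[ℂ] H) (hS : ∀ m, ‖S m‖ ≤ 1) :
    (E →L[ℂ] G) →L[ℂ] (SumFamily ι E →L[ℂ] H) :=
  have hb : ∀ (T : E →L[ℂ] G) (m : ι), ‖S m ∘L T‖ ≤ ‖T‖ := fun T m =>
    (ContinuousLinearMap.opNorm_comp_le _ _).trans
      (mul_le_of_le_one_left (norm_nonneg _) (hS m))
  LinearMap.mkContinuous
    { toFun := fun T => sumMap (fun m => S m ∘L T) ‖T‖ (hb T)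
      map_add' := fun T T' => by
        ext a
        rw [add_apply, sumMap_apply, sumMap_apply, sumMap_apply,
          ← (SumFamily.summable_apply (hb T) a).tsum_add (SumFamily.summable_apply (hb T') a)]
        simp
      map_smul' := fun z T => by
        ext a
        rw [RingHom.id_apply, smul_apply, sumMap_apply, sumMap_apply,
          ← (SumFamily.summable_apply (hb T) a).tsum_const_smul]
        simp } 1 fun T => by
    rw [one_mul]
    exact norm_sumMap_le (norm_nonneg _) (hb T)

lemma sumMapComp_apply [CompleteSpace H] {S : ι → G →L[ℂ] H} (hS : ∀ m, ‖S m‖ ≤ 1) (T : E →L[ℂ] G)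
    (a : SumFamily ι E) : sumMapComp S hS T a = ∑' m, S m (T (a m)) := rfl

lemma norm_sumMapComp_le [CompleteSpace H] {S : ι → G →L[ℂ] H} (hS : ∀ m, ‖S m‖ ≤ 1) :
    ‖sumMapComp (E := E) S hS‖ ≤ 1 := by
  rw [sumMapComp]
  exact LinearMap.mkContinuous_norm_le _ zero_le_one _

variable [DecidableEq ι]

/-- The family with a single nonzero member. -/
def singleL (m : ι) : E →L[ℂ] SumFamily ι E :=
  (lp.singleContinuousLinearMap ℂ (fun _ : ι => E) 1 m : E →L[ℂ] lp (fun _ : ι => E) 1)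

lemma singleL_apply (m : ι) (x : E) (m' : ι) :
    singleL m x m' = if m' = m then x else 0 := by
  change (Pi.single m x : ι → E) m' = _
  rw [Pi.single_apply]

lemma norm_singleL_apply (m : ι) (x : E) : ‖singleL m x‖ = ‖x‖ :=
  lp.norm_single (E := fun _ : ι => E) (p := 1) (by simp) m x

lemma norm_singleL_le (m : ι) : ‖(singleL m : E →L[ℂ] SumFamily ι E)‖ ≤ 1 :=
  ContinuousLinearMap.opNorm_le_bound _ zero_le_one fun x => by rw [norm_singleL_apply, one_mul]

lemma SumFamily.hasSum_singleL (a : SumFamily ι E) : HasSum (fun m => singleL m (a m)) a :=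
  lp.hasSum_single (E := fun _ : ι => E) (p := 1) (by simp) a

lemma sumMap_singleL [CompleteSpace F] {S : ι → E →L[ℂ] F} {C : ℝ} (hS : ∀ m, ‖S m‖ ≤ C) (m : ι)
    (x : E) : sumMap S C hS (singleL m x) = S m x := by
  rw [sumMap_apply, tsum_eq_single m]
  · rw [singleL_apply, if_pos rfl]
  · intro m' hm'
    rw [singleL_apply, if_neg hm', map_zero]

/-- The `m`-th member, as a continuous linear map. -/
def coordL [CompleteSpace E] (m : ι) : SumFamily ι E →L[ℂ] E :=
  sumMap (fun m' => if m' = m then ContinuousLinearMap.id ℂ E else 0) 1 fun m' => by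
    split_ifs
    · exact ContinuousLinearMap.norm_id_le
    · simp

lemma coordL_apply [CompleteSpace E] (m : ι) (a : SumFamily ι E) : coordL m a = a m := by
  rw [coordL, sumMap_apply, tsum_eq_single m]
  · simp
  · intro m' hm'
    simp [hm']

/-- The sum of `w m • a m` for bounded weights. -/
def weightedSum [CompleteSpace E] (w : ι → ℂ) (hw : ∀ m, ‖w m‖ ≤ 1) : SumFamily ι E →L[ℂ] E :=
  sumMap (fun m => w m • ContinuousLinearMap.id ℂ E) 1 fun m => by
    rw [norm_smul]
    exact mul_le_one₀ (hw m) (norm_nonneg _) ContinuousLinearMap.norm_id_le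

lemma weightedSum_singleL [CompleteSpace E] {w : ι → ℂ} (hw : ∀ m, ‖w m‖ ≤ 1) (m : ι) (x : E) :
    weightedSum w hw (singleL m x) = w m • x := sumMap_singleL _ m x

lemma norm_weightedSum_le [CompleteSpace E] {w : ι → ℂ} (hw : ∀ m, ‖w m‖ ≤ 1) (a : SumFamily ι E) :
    ‖weightedSum w hw a‖ ≤ ‖a‖ := by
  refine ((weightedSum w hw).le_opNorm a).trans ?_
  exact mul_le_of_le_one_left (norm_nonneg _) (norm_sumMap_le zero_le_one _)

variable [AddCommMonoid ι]

/-- Translation of the indices by `m`. -/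
def shiftL [CompleteSpace E] (m : ι) : SumFamily ι E →L[ℂ] SumFamily ι E :=
  sumMap (fun m' => singleL (m + m')) 1 fun _ => norm_singleL_le _

lemma norm_shiftL_le [CompleteSpace E] (m : ι) :
    ‖(shiftL m : SumFamily ι E →L[ℂ] SumFamily ι E)‖ ≤ 1 := norm_sumMap_le zero_le_one _

/-- Multiplicative weights are characters of the index monoid: summation against them turns
translation of indices into multiplication. This is checked on families with a single member. -/
lemma weightedSum_shiftL [CompleteSpace E] {w : ι → ℂ} (hw : ∀ m, ‖w m‖ ≤ 1)
    (hmul : ∀ m m', w (m + m') = w m * w m') (m : ι) (a : SumFamily ι E) :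
    weightedSum w hw (shiftL m a) = w m • weightedSum w hw a := by
  have h1 := ((weightedSum w hw ∘L shiftL m).hasSum a.hasSum_singleL)
  have h2 := ((w m • weightedSum w hw).hasSum a.hasSum_singleL)
  refine h1.unique ?_
  rw [← smul_apply]
  convert h2 using 2 with m'
  simp only [ContinuousLinearMap.comp_apply, shiftL, sumMap_singleL, weightedSum_singleL, hmul,
    smul_apply, mul_smul]

/-- Families whose members of degree less than `k` vanish. -/
def OrderGE (deg : ι →+ ℕ) (k : ℕ) (a : SumFamily ι E) : Prop := ∀ m, deg m < k → a m = 0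

lemma OrderGE.hasSum [CompleteSpace E] {deg : ι →+ ℕ} {k : ℕ} {κ : Type*} {f : κ → SumFamily ι E}
    {a : SumFamily ι E} (h : HasSum f a) (hf : ∀ i, OrderGE deg k (f i)) : OrderGE deg k a := by
  intro m hm
  have h1 := (coordL m).hasSum h
  simp only [coordL_apply] at h1
  refine h1.unique ?_
  simp only [fun i => hf i m hm]
  exact hasSum_zero

lemma OrderGE.shiftL [CompleteSpace E] {deg : ι →+ ℕ} {k : ℕ} {a : SumFamily ι E}
    (ha : OrderGE deg k a) (m : ι) : OrderGE deg (deg m + k) (shiftL m a) := by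
  refine OrderGE.hasSum ((AnalyticSemigroup.shiftL m).hasSum a.hasSum_singleL) fun m' => ?_
  intro m'' hm''
  rw [AnalyticSemigroup.shiftL, sumMap_singleL, singleL_apply]
  split_ifs with h
  · refine ha m' ?_
    rw [h, map_add] at hm''
    omega
  · rfl

variable [CompleteSpace F]

lemma norm_postcomp_shiftL_le (n : ℕ) (m : ι) :
    ‖ContinuousLinearMap.compContinuousMultilinearMapL ℂ (fun _ : Fin n => SumFamily ι E)
      (SumFamily ι F) (SumFamily ι F) (shiftL m)‖ ≤ 1 := by
  refine ContinuousLinearMap.opNorm_le_bound _ zero_le_one fun T => ?_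
  refine (ContinuousLinearMap.norm_compContinuousMultilinearMap_le _ _).trans ?_
  gcongr
  exact norm_shiftL_le m

/-- Operators of norm at most one that lift multilinear maps to absolutely summable families. -/
abbrev LiftOp (ι : Type) (E F : Type u) [NormedAddCommGroup E] [NormedSpace ℂ E]
    [NormedAddCommGroup F] [NormedSpace ℂ F] (n : ℕ) : Type u :=
  {Φ : (E [×n]→L[ℂ] F) →L[ℂ] (SumFamily ι E [×n]→L[ℂ] SumFamily ι F) // ‖Φ‖ ≤ 1}

/-- The lift of constants. -/
def liftZero : LiftOp ι E F 0 :=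
  ⟨(continuousMultilinearCurryFin0 ℂ (SumFamily ι E)
      (SumFamily ι F)).symm.toContinuousLinearEquiv.toContinuousLinearMap ∘L
    (singleL (0 : ι) ∘L
      (continuousMultilinearCurryFin0 ℂ E F).toContinuousLinearEquiv.toContinuousLinearMap), by
    refine ContinuousLinearMap.opNorm_le_bound _ zero_le_one fun T => le_of_eq ?_
    rw [one_mul]
    exact ((continuousMultilinearCurryFin0 ℂ (SumFamily ι E) (SumFamily ι F)).symm.norm_map
      _).trans ((norm_singleL_apply _ _).trans
      ((continuousMultilinearCurryFin0 ℂ E F).norm_map T))⟩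

lemma norm_postcomp_comp_le {n : ℕ} (Φ : LiftOp ι E F n) (m : ι) :
    ‖ContinuousLinearMap.compContinuousMultilinearMapL ℂ (fun _ : Fin n => SumFamily ι E)
      (SumFamily ι F) (SumFamily ι F) (shiftL m) ∘L Φ.1‖ ≤ 1 :=
  (ContinuousLinearMap.opNorm_comp_le _ _).trans
    (mul_le_one₀ (norm_postcomp_shiftL_le n m) (norm_nonneg _) Φ.2)

/-- The lift of maps of one more variable. -/
def liftSucc {n : ℕ} (Φ : LiftOp ι E F n) : LiftOp ι E F (n + 1) :=
  ⟨(continuousMultilinearCurryLeftEquiv ℂ (fun _ : Fin (n + 1) => SumFamily ι E)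
      (SumFamily ι F)).symm.toContinuousLinearEquiv.toContinuousLinearMap ∘L
    (sumMapComp _ (norm_postcomp_comp_le Φ) ∘L
      (continuousMultilinearCurryLeftEquiv ℂ (fun _ : Fin (n + 1) => E)
        F).toContinuousLinearEquiv.toContinuousLinearMap), by
    refine ContinuousLinearMap.opNorm_le_bound _ zero_le_one fun T => ?_
    rw [one_mul]
    refine ((continuousMultilinearCurryLeftEquiv ℂ (fun _ : Fin (n + 1) => SumFamily ι E)
      (SumFamily ι F)).symm.norm_map _).trans_le ?_
    refine ((sumMapComp _ (norm_postcomp_comp_le Φ)).le_opNorm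
      (continuousMultilinearCurryLeftEquiv ℂ (fun _ : Fin (n + 1) => E) F T)).trans ?_
    refine (mul_le_of_le_one_left (norm_nonneg _) (norm_sumMapComp_le _)).trans_eq ?_
    exact (continuousMultilinearCurryLeftEquiv ℂ (fun _ : Fin (n + 1) => E) F).norm_map T⟩

lemma hasSum_liftSucc {n : ℕ} (Φ : LiftOp ι E F n) (T : E [×(n + 1)]→L[ℂ] F)
    (v : Fin (n + 1) → SumFamily ι E) :
    HasSum (fun m => shiftL m (Φ.1 (T.curryLeft (v 0 m)) (Fin.tail v))) ((liftSucc Φ).1 T v) := by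
  have h1 : ∀ m, ‖(ContinuousLinearMap.compContinuousMultilinearMapL ℂ
          (fun _ : Fin n => SumFamily ι E) (SumFamily ι F) (SumFamily ι F) (shiftL m) ∘L
            Φ.1) ∘L T.curryLeft‖ ≤ ‖T.curryLeft‖ := fun m =>
    (ContinuousLinearMap.opNorm_comp_le _ _).trans
      (mul_le_of_le_one_left (norm_nonneg _) (norm_postcomp_comp_le Φ m))
  have h2 := (SumFamily.summable_apply h1 (v 0)).hasSum
  have e : (liftSucc Φ).1 T v =
      (sumMapComp _ (norm_postcomp_comp_le Φ) T.curryLeft (v 0)) (Fin.tail v) := rfl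
  have h3 := (ContinuousMultilinearMap.apply ℂ (fun _ : Fin n => SumFamily ι E) (SumFamily ι F)
    (Fin.tail v)).hasSum h2
  rw [e, sumMapComp_apply]
  exact h3

/-- The lift of continuous multilinear maps to absolutely summable families, adding indices. -/
def liftOp : (n : ℕ) → LiftOp ι E F n
  | 0 => liftZero
  | n + 1 => liftSucc (liftOp n)

/-- The lift of a continuous multilinear map to absolutely summable families. -/
def liftMultilinear (ι : Type) [DecidableEq ι] [AddCommMonoid ι] {n : ℕ} (T : E [×n]→L[ℂ] F) :
    SumFamily ι E [×n]→L[ℂ] SumFamily ι F := (liftOp n).1 T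

lemma norm_liftMultilinear_le {n : ℕ} (T : E [×n]→L[ℂ] F) : ‖liftMultilinear ι T‖ ≤ ‖T‖ :=
  (ContinuousLinearMap.le_opNorm _ _).trans
    (mul_le_of_le_one_left (norm_nonneg _) (liftOp n).2)

lemma liftMultilinear_zero {n : ℕ} : liftMultilinear ι (0 : E [×n]→L[ℂ] F) = 0 := map_zero _

lemma liftMultilinear_zero_apply (T : E [×0]→L[ℂ] F) (v : Fin 0 → SumFamily ι E) :
    liftMultilinear ι T v = singleL 0 (T 0) := rfl

lemma hasSum_liftMultilinear_succ {n : ℕ} (T : E [×(n + 1)]→L[ℂ] F)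
    (v : Fin (n + 1) → SumFamily ι E) :
    HasSum (fun m => shiftL m (liftMultilinear ι (T.curryLeft (v 0 m)) (Fin.tail v)))
      (liftMultilinear ι T v) :=
  hasSum_liftSucc (liftOp n) T v

/-- The lift is a convolution of indices, so summation against a character intertwines it with `T`.
For exponential weights, it thus computes the coefficients obtained by inserting exponential series
into `T`. -/
lemma weightedSum_liftMultilinear [CompleteSpace E] {w : ι → ℂ} (hw : ∀ m, ‖w m‖ ≤ 1)
    (hmul : ∀ m m', w (m + m') = w m * w m') (h0 : w 0 = 1) (n : ℕ) (T : E [×n]→L[ℂ] F)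
    (v : Fin n → SumFamily ι E) :
    weightedSum w hw (liftMultilinear ι T v) = T fun i => weightedSum w hw (v i) := by
  induction n with
  | zero =>
    rw [liftMultilinear_zero_apply, weightedSum_singleL, h0, one_smul]
    congr 1
    exact Subsingleton.elim _ _
  | succ n ih =>
    have h1 := (weightedSum w hw).hasSum (hasSum_liftMultilinear_succ T v)
    simp only [weightedSum_shiftL hw hmul, ih] at h1
    refine h1.unique ?_
    have h2 := (SumFamily.summable_apply (S := fun m => w m • ContinuousLinearMap.id ℂ E) (C := 1)
      (fun m => by
        rw [norm_smul]
        exact mul_le_one₀ (hw m) (norm_nonneg _) ContinuousLinearMap.norm_id_le) (v 0)).hasSum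
    have h3 := ((ContinuousMultilinearMap.apply ℂ (fun _ : Fin n => E) F
      (fun i => weightedSum w hw (v i.succ))) ∘L T.curryLeft).hasSum h2
    convert h3 using 1
    · funext m
      simp [Fin.tail_def]
    · have : (T fun i => weightedSum w hw (v i)) =
          T (Fin.cons (weightedSum w hw (v 0)) fun i => weightedSum w hw (v i.succ)) := by
        congr 1
        funext i
        refine Fin.cases ?_ (fun i => ?_) i <;> simp
      rw [this]
      rfl

/-- Degrees add under convolution, and each of the `n` arguments starts in degree one. -/
lemma orderGE_liftMultilinear {deg : ι →+ ℕ} (n : ℕ)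
    (T : E [×n]→L[ℂ] F) {v : Fin n → SumFamily ι E} (hv : ∀ i, OrderGE deg 1 (v i)) :
    OrderGE deg n (liftMultilinear ι T v) := by
  induction n with
  | zero => intro m hm; omega
  | succ n ih =>
    refine OrderGE.hasSum (hasSum_liftMultilinear_succ T v) fun m => ?_
    rcases Nat.eq_zero_or_pos (deg m) with h | h
    · have : v 0 m = 0 := hv 0 m (by omega)
      rw [this]
      intro m' hm'
      simp [SumFamily.zero_apply, liftMultilinear_zero]
    · have := (ih (T.curryLeft (v 0 m)) (v := Fin.tail v) fun i => hv i.succ).shiftL m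
      intro m' hm'
      exact this m' (by omega)

end

end

section

/-! ### Lifts of entire maps to absolutely summable families -/

open scoped ENNReal

section

universe u

variable {ι : Type} [DecidableEq ι] [AddCommMonoid ι]
  {E F : Type u} [NormedAddCommGroup E] [NormedSpace ℂ E] [CompleteSpace E]
  [NormedAddCommGroup F] [NormedSpace ℂ F] [CompleteSpace F]

/-- The lift of a power series to absolutely summable families. -/
def liftSeries (ι : Type) [DecidableEq ι] [AddCommMonoid ι] (p : FormalMultilinearSeries ℂ E F) :
    FormalMultilinearSeries ℂ (SumFamily ι E) (SumFamily ι F) := fun n => liftMultilinear ι (p n)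

lemma radius_le_radius_liftSeries (p : FormalMultilinearSeries ℂ E F) :
    p.radius ≤ (liftSeries ι p).radius := by
  refine ENNReal.le_of_forall_nnreal_lt fun r hr => ?_
  obtain ⟨C, -, hC⟩ := p.norm_mul_pow_le_of_lt_radius hr
  refine FormalMultilinearSeries.le_radius_of_bound _ C fun n => ?_
  refine le_trans ?_ (hC n)
  exact mul_le_mul_of_nonneg_right (norm_liftMultilinear_le (p n)) (by positivity)

/-- An entire map vanishing to second order at the origin acts on absolutely summable families,
compatibly with sums for multiplicative weights and with the degree filtration. -/
theorem IsEntire.exists_lift {g : E → F} (hg : IsEntire g) (h0 : g 0 = 0)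
    (h1 : _root_.fderiv ℂ g 0 = 0) (deg : ι →+ ℕ) :
    ∃ G : SumFamily ι E → SumFamily ι F, G 0 = 0 ∧
      HasStrictFDerivAt G (0 : SumFamily ι E →L[ℂ] SumFamily ι F) 0 ∧
      (∀ a, ‖a‖ < 1 / 4 → ∀ (w : ι → ℂ) (hw : ∀ m, ‖w m‖ ≤ 1),
        (∀ m m', w (m + m') = w m * w m') → w 0 = 1 →
        weightedSum w hw (G a) = g (weightedSum w hw a)) ∧
      ∀ a, ‖a‖ < 1 / 4 → OrderGE deg 1 a → OrderGE deg 2 (G a) := by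
  obtain ⟨p, hp⟩ := hg.hasFPowerSeriesOnBall
  have p0 : p 0 = 0 := by
    ext v
    have : p 0 v = g 0 := hp.coeff_zero v
    rw [this, h0]; rfl
  have p1 : p 1 = 0 := by
    have h2 := hp.hasFPowerSeriesAt.fderiv_eq
    rw [h1] at h2
    have := (continuousMultilinearCurryFin1 ℂ E F).map_eq_zero_iff.1 h2.symm
    exact this
  have hr : (1 / 4 : ℝ≥0∞) ≤ (liftSeries ι p).radius := hp.r_le.trans (radius_le_radius_liftSeries p)
  have hpos : 0 < (liftSeries ι p).radius := hp.r_pos.trans_le hr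
  have hG := ((liftSeries ι p).hasFPowerSeriesOnBall hpos).mono (by norm_num) hr
  have hball : ∀ {V : Type u} [NormedAddCommGroup V] (a : V), ‖a‖ < 1 / 4 →
      a ∈ Metric.eball (0 : V) (1 / 4) := by
    intro V _ a ha
    have e : (1 / 4 : ℝ≥0∞) = ENNReal.ofReal (1 / 4) := by
      rw [ENNReal.ofReal_div_of_pos (by norm_num)]; simp
    rw [e, Metric.eball_ofReal]
    simpa using ha
  have hsum : ∀ a, ‖a‖ < 1 / 4 → HasSum (fun n => liftMultilinear ι (p n) fun _ => a)
      ((liftSeries ι p).sum a) := fun a ha => by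
    have := hG.hasSum (hball a ha)
    rw [zero_add] at this
    exact this
  -- Only terms of arity at least two survive, which gives both the vanishing derivative of the lift
  -- and its order two.
  have hz : ∀ n, n < 2 → p n = 0 := by
    intro n hn
    interval_cases n
    · exact p0
    · exact p1
  refine ⟨(liftSeries ι p).sum, ?_, ?_, ?_, ?_⟩
  · have h2 := hsum 0 (by norm_num)
    refine h2.unique ?_
    convert hasSum_zero with n
    rcases Nat.eq_zero_or_pos n with rfl | hn
    · rw [p0, liftMultilinear_zero]; rfl
    · exact (liftMultilinear ι (p n)).map_coord_zero (⟨0, hn⟩ : Fin n) rfl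
  · have := hG.hasFPowerSeriesAt.hasStrictFDerivAt
    rw [show (liftSeries ι p) 1 = 0 by
      change liftMultilinear ι (p 1) = 0
      rw [p1, liftMultilinear_zero], map_zero] at this
    exact this
  · intro a ha w hw hmul hw0
    have h2 := (weightedSum w hw).hasSum (hsum a ha)
    simp only [weightedSum_liftMultilinear hw hmul hw0] at h2
    have h3 := hp.hasSum (hball (weightedSum w hw a) ((norm_weightedSum_le hw a).trans_lt ha))
    rw [zero_add] at h3
    exact h2.unique h3
  · intro a ha ho
    refine OrderGE.hasSum (hsum a ha) fun n => ?_
    rcases lt_or_ge n 2 with hn | hn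
    · rw [hz n hn, liftMultilinear_zero]
      intro m _
      rfl
    · have := orderGE_liftMultilinear n (p n) (v := fun _ => a) fun _ => ho
      intro m hm
      exact this m (by omega)

end

end

section

/-! ### Orbits in the unstable manifold as exponential series -/

section

universe u

variable {N : ℕ}

/-- The order of a multi-index. -/
def multiDeg (N : ℕ) : (Fin N → ℕ) →+ ℕ where
  toFun m := ∑ i, m i
  map_zero' := by simp
  map_add' m m' := by simp [Finset.sum_add_distrib]

lemma multiDeg_apply (m : Fin N → ℕ) : multiDeg N m = ∑ i, m i := rfl

lemma multiDeg_eq_zero (m : Fin N → ℕ) (h : multiDeg N m = 0) : m = 0 := by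
  funext i
  rw [multiDeg_apply, Finset.sum_eq_zero_iff] at h
  exact h i (Finset.mem_univ i)

lemma multiDeg_single (j : Fin N) : multiDeg N (Pi.single j 1) = 1 := by
  rw [multiDeg_apply, Finset.sum_eq_single j] <;> simp +contextual

/-- The frequency of a multi-index. -/
def freq (μ : Fin N → ℝ) (m : Fin N → ℕ) : ℝ := ∑ i, (m i : ℝ) * μ i

lemma freq_add (μ : Fin N → ℝ) (m m' : Fin N → ℕ) : freq μ (m + m') = freq μ m + freq μ m' := by
  simp [freq, add_mul, Finset.sum_add_distrib]

lemma freq_zero (μ : Fin N → ℝ) : freq μ 0 = 0 := by simp [freq]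

lemma freq_single (μ : Fin N → ℝ) (j : Fin N) : freq μ (Pi.single j 1) = μ j := by
  rw [freq, Finset.sum_eq_single j] <;> simp +contextual

lemma freq_nonneg {μ : Fin N → ℝ} (hμ : ∀ j, 0 < μ j) (m : Fin N → ℕ) : 0 ≤ freq μ m :=
  Finset.sum_nonneg fun i _ => mul_nonneg (Nat.cast_nonneg _) (hμ i).le

lemma finite_freq_le {μ : Fin N → ℝ} (hμ : ∀ j, 0 < μ j) (B : ℝ) : {m | freq μ m ≤ B}.Finite := by
  refine (Set.finite_Iic fun i => ⌊B / μ i⌋₊).subset fun m hm i => ?_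
  refine Nat.le_floor ?_
  rw [le_div_iff₀ (hμ i)]
  refine le_trans ?_ hm
  exact Finset.single_le_sum (f := fun i => (m i : ℝ) * μ i)
    (fun i _ => mul_nonneg (Nat.cast_nonneg _) (hμ i).le) (Finset.mem_univ i)

/-- There are no small divisors: positivity of all `μ i` leaves finitely many frequencies below `μ j
+ 1`. A vanishing denominator does no harm, as `0⁻¹ = 0`. -/
lemma exists_inv_freq_sub_le {μ : Fin N → ℝ} (hμ : ∀ j, 0 < μ j) (j : Fin N) :
    ∃ C : ℝ, ∀ m, ‖((freq μ m : ℂ) - μ j)⁻¹‖ ≤ C := by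
  have hf := (finite_freq_le hμ (μ j + 1)).image fun m => ‖((freq μ m : ℂ) - μ j)⁻¹‖
  obtain ⟨C, hC⟩ := hf.bddAbove
  refine ⟨max C 1, fun m => ?_⟩
  by_cases h : freq μ m ≤ μ j + 1
  · exact (hC ⟨m, h, rfl⟩).trans (le_max_left _ _)
  · refine le_trans ?_ (le_max_right _ _)
    rw [norm_inv, ← Complex.ofReal_sub, Complex.norm_real, Real.norm_eq_abs]
    exact inv_le_one_of_one_le₀ (le_trans (by linarith) (le_abs_self _))

/-- The exponential weights `exp (freq μ m * t)`. -/
def expWeight (μ : Fin N → ℝ) (t : ℂ) (m : Fin N → ℕ) : ℂ := Complex.exp (freq μ m * t)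

lemma norm_expWeight (μ : Fin N → ℝ) (t : ℂ) (m : Fin N → ℕ) :
    ‖expWeight μ t m‖ = Real.exp (freq μ m * t.re) := by
  rw [expWeight, Complex.norm_exp]
  simp

lemma norm_expWeight_le {μ : Fin N → ℝ} (hμ : ∀ j, 0 < μ j) {t : ℂ} (ht : t.re ≤ 0)
    (m : Fin N → ℕ) : ‖expWeight μ t m‖ ≤ 1 := by
  rw [norm_expWeight, Real.exp_le_one_iff]
  exact mul_nonpos_of_nonneg_of_nonpos (freq_nonneg hμ m) ht

lemma expWeight_add (μ : Fin N → ℝ) (t : ℂ) (m m' : Fin N → ℕ) :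
    expWeight μ t (m + m') = expWeight μ t m * expWeight μ t m' := by
  rw [expWeight, freq_add, expWeight, expWeight, ← Complex.exp_add]
  push_cast
  ring_nf

lemma expWeight_zero (μ : Fin N → ℝ) (t : ℂ) : expWeight μ t 0 = 1 := by simp [expWeight, freq_zero]

lemma expWeight_single (μ : Fin N → ℝ) (t : ℂ) (j : Fin N) :
    expWeight μ t (Pi.single j 1) = Complex.exp (μ j * t) := by rw [expWeight, freq_single]

lemma hasDerivAt_expWeight (μ : Fin N → ℝ) (t : ℂ) (m : Fin N → ℕ) :
    HasDerivAt (fun t => expWeight μ t m) (freq μ m * expWeight μ t m) t := by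
  have h := ((hasDerivAt_id t).const_mul (freq μ m : ℂ)).cexp
  rw [mul_one, mul_comm] at h
  exact h

/-- From `x exp (-x) ≤ 1`: left of the imaginary axis the exponential pays for the unbounded
frequency, so the series can be differentiated term by term. -/
lemma norm_freq_mul_expWeight_le {μ : Fin N → ℝ} (hμ : ∀ j, 0 < μ j) {s : ℝ} (hs : 0 < s) {t : ℂ}
    (ht : t.re < -s) (m : Fin N → ℕ) : ‖(freq μ m : ℂ) * expWeight μ t m‖ ≤ 1 / s := by
  have h0 := freq_nonneg hμ m
  rw [norm_mul, Complex.norm_real, Real.norm_of_nonneg h0, norm_expWeight, le_div_iff₀ hs]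
  have h1 : Real.exp (freq μ m * t.re) ≤ Real.exp (-(freq μ m * s)) := by
    rw [Real.exp_le_exp]
    nlinarith
  have h2 := Real.add_one_le_exp (freq μ m * s)
  calc freq μ m * Real.exp (freq μ m * t.re) * s
      ≤ freq μ m * Real.exp (-(freq μ m * s)) * s := by gcongr
    _ = (freq μ m * s) * Real.exp (-(freq μ m * s)) := by ring
    _ ≤ Real.exp (freq μ m * s) * Real.exp (-(freq μ m * s)) := by
        gcongr
        linarith
    _ = 1 := by rw [← Real.exp_add]; simp

/-- Almost periods of the basic exponentials are almost periods of the exponential weights. -/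
lemma norm_expWeight_sub_one_le (μ : Fin N → ℝ) {σ η : ℝ}
    (h : ∀ j, ‖Complex.exp (μ j * (σ * Complex.I)) - 1‖ ≤ η) (m : Fin N → ℕ) :
    ‖expWeight μ (σ * Complex.I) m - 1‖ ≤ multiDeg N m * η := by
  have hprod : ∀ s : Finset (Fin N), ∀ (z : Fin N → ℂ), (∀ i, ‖z i‖ = 1) → ∀ (c : Fin N → ℝ),
      (∀ i, ‖z i - 1‖ ≤ c i) → ‖∏ i ∈ s, z i - 1‖ ≤ ∑ i ∈ s, c i := by
    intro s z hz c hc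
    induction s using Finset.induction_on with
    | empty => simp
    | insert a s ha ih =>
      rw [Finset.prod_insert ha, Finset.sum_insert ha,
        show z a * ∏ i ∈ s, z i - 1 = (z a - 1) + z a * (∏ i ∈ s, z i - 1) by ring]
      refine (norm_add_le _ _).trans (add_le_add (hc a) ?_)
      rwa [norm_mul, hz a, one_mul]
  have hn : ∀ j, ‖Complex.exp (μ j * (σ * Complex.I))‖ = 1 := fun j => by
    rw [Complex.norm_exp]; simp
  have hpow : ∀ j (n : ℕ), ‖Complex.exp (μ j * (σ * Complex.I)) ^ n - 1‖ ≤ n * η := by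
    intro j n
    induction n with
    | zero => simp
    | succ n ih =>
      rw [pow_succ', show ∀ z w : ℂ, z * w - 1 = (z - 1) + z * (w - 1) by intros; ring]
      refine (norm_add_le _ _).trans ?_
      rw [norm_mul, hn, one_mul]
      have := h j
      push_cast
      linarith
  have e : expWeight μ (σ * Complex.I) m =
      ∏ j, Complex.exp (μ j * (σ * Complex.I)) ^ m j := by
    rw [expWeight, freq]
    push_cast
    rw [Finset.sum_mul, Complex.exp_sum]
    refine Finset.prod_congr rfl fun j _ => ?_
    rw [← Complex.exp_nat_mul, mul_assoc]
  rw [e, multiDeg_apply]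
  push_cast
  rw [Finset.sum_mul]
  exact hprod _ _ (fun i => by rw [norm_pow, hn, one_pow]) _ fun i => hpow i (m i)

variable {E : Type u} [NormedAddCommGroup E] [NormedSpace ℂ E] [CompleteSpace E]

/-- The sum of the exponential series with coefficients `a`. -/
def expSeries (μ : Fin N → ℝ) (a : SumFamily (Fin N → ℕ) E) (t : ℂ) : E :=
  ∑' m, expWeight μ t m • a m

lemma hasSum_expSeries {μ : Fin N → ℝ} (hμ : ∀ j, 0 < μ j) (a : SumFamily (Fin N → ℕ) E) {t : ℂ}
    (ht : t.re ≤ 0) : HasSum (fun m => expWeight μ t m • a m) (expSeries μ a t) := by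
  have := (SumFamily.summable_apply (S := fun m => expWeight μ t m • ContinuousLinearMap.id ℂ E)
    (C := 1) (fun m => by
      rw [norm_smul]
      exact mul_le_one₀ (norm_expWeight_le hμ ht m) (norm_nonneg _)
        ContinuousLinearMap.norm_id_le) a).hasSum
  exact this

lemma hasDerivAt_expSeries {μ : Fin N → ℝ} (hμ : ∀ j, 0 < μ j) (a : SumFamily (Fin N → ℕ) E)
    {t : ℂ} (ht : t.re < 0) :
    HasDerivAt (expSeries μ a) (∑' m, ((freq μ m : ℂ) * expWeight μ t m) • a m) t ∧
      Summable fun m => ((freq μ m : ℂ) * expWeight μ t m) • a m := by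
  set s := -t.re / 2 with hs
  have hs0 : 0 < s := by rw [hs]; linarith
  have hsum : Summable fun m => 1 / s * ‖a m‖ := a.hasSum_norm.summable.mul_left _
  have hb : ∀ m, ∀ z ∈ {z : ℂ | z.re < -s}, ‖((freq μ m : ℂ) * expWeight μ z m) • a m‖ ≤
      1 / s * ‖a m‖ := fun m z hz => by
    rw [norm_smul]
    gcongr
    exact norm_freq_mul_expWeight_le hμ hs0 hz m
  have htm : t ∈ {z : ℂ | z.re < -s} := by
    change t.re < -s
    rw [hs]; linarith
  refine ⟨?_, Summable.of_norm_bounded hsum fun m => hb m t htm⟩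
  exact hasDerivAt_tsum_of_isPreconnected hsum
    (isOpen_lt Complex.continuous_re continuous_const)
    (convex_halfSpace_re_lt (-s)).isPreconnected
    (fun m z _ => (hasDerivAt_expWeight μ z m).smul_const (a m)) hb htm
    (hasSum_expSeries hμ a ht.le).summable htm

lemma norm_expSeries_le {μ : Fin N → ℝ} (hμ : ∀ j, 0 < μ j) (a : SumFamily (Fin N → ℕ) E) {t : ℂ}
    (ht : t.re ≤ 0) : ‖expSeries μ a t‖ ≤ ‖a‖ :=
  norm_weightedSum_le (norm_expWeight_le hμ ht) a

/-- The difference is at most `∑ min 2 (deg m * η) * ‖a m‖`, which tends to zero with `η` by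
dominated convergence. The bound does not involve `t`. -/
lemma expSeries_almostPeriodic {μ : Fin N → ℝ} (hμ : ∀ j, 0 < μ j) (a : SumFamily (Fin N → ℕ) E)
    {ε : ℝ} (hε : 0 < ε) : ∃ η > 0, ∀ σ : ℝ, (∀ j, ‖Complex.exp (μ j * (σ * Complex.I)) - 1‖ ≤ η) →
      ∀ t : ℂ, t.re ≤ 0 → ‖expSeries μ a (t + σ * Complex.I) - expSeries μ a t‖ ≤ ε := by
  have hlim : Tendsto (fun η : ℝ => ∑' m, min 2 (multiDeg N m * η) * ‖a m‖) (𝓝[>] 0) (𝓝 0) := by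
    have := tendsto_tsum_of_dominated_convergence (𝓕 := 𝓝[>] (0 : ℝ))
      (f := fun η m => min 2 ((multiDeg N m : ℝ) * η) * ‖a m‖) (g := fun _ => (0 : ℝ))
      (bound := fun m => 2 * ‖a m‖) (a.hasSum_norm.summable.mul_left 2) (fun m => by
        have h : Continuous fun η : ℝ => min 2 ((multiDeg N m : ℝ) * η) * ‖a m‖ := by fun_prop
        have := (h.tendsto 0).mono_left (nhdsWithin_le_nhds : 𝓝[>] (0 : ℝ) ≤ 𝓝 0)
        simpa using this) (by
        filter_upwards [self_mem_nhdsWithin] with η hη m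
        have h0 : (0 : ℝ) ≤ multiDeg N m * η := mul_nonneg (Nat.cast_nonneg _) (le_of_lt hη)
        rw [norm_mul, norm_norm, Real.norm_of_nonneg (le_min (by norm_num) h0)]
        gcongr
        exact min_le_left _ _)
    simpa using this
  obtain ⟨η, hη1, hη2⟩ := ((hlim.eventually (gt_mem_nhds hε)).and self_mem_nhdsWithin).exists
  refine ⟨η, hη2, fun σ hσ t ht => ?_⟩
  have ht' : (t + σ * Complex.I).re ≤ 0 := by simpa using ht
  have h1 := (hasSum_expSeries hμ a ht').sub (hasSum_expSeries hμ a ht)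
  have hs : Summable fun m => min 2 ((multiDeg N m : ℝ) * η) * ‖a m‖ := by
    refine Summable.of_nonneg_of_le (fun m => ?_) (fun m => ?_) (a.hasSum_norm.summable.mul_left 2)
    · have h0 : (0 : ℝ) ≤ multiDeg N m * η := mul_nonneg (Nat.cast_nonneg _) (le_of_lt hη2)
      positivity
    · gcongr
      exact min_le_left _ _
  refine le_trans ?_ hη1.le
  rw [← h1.tsum_eq]
  refine tsum_of_norm_bounded hs.hasSum fun m => ?_
  rw [← sub_smul, norm_smul]
  gcongr
  have e : expWeight μ (t + σ * Complex.I) m - expWeight μ t m =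
      expWeight μ t m * (expWeight μ (σ * Complex.I) m - 1) := by
    rw [expWeight, mul_add, Complex.exp_add, expWeight, expWeight]
    ring
  have hle : ‖expWeight μ t m‖ ≤ 1 := norm_expWeight_le hμ ht m
  rw [e, norm_mul]
  refine (mul_le_of_le_one_left (norm_nonneg _) hle).trans (le_min ?_ ?_)
  · refine (norm_sub_le _ _).trans ?_
    have : ‖expWeight μ (σ * Complex.I) m‖ ≤ 1 := norm_expWeight_le hμ (by simp) m
    rw [norm_one]
    linarith
  · exact norm_expWeight_sub_one_le μ hσ m

end

end

/-! ### The unstable manifold, solved for in the space of coefficients -/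

section

section

universe u

variable {X Y : Type u} [NormedAddCommGroup X] [NormedSpace ℂ X] [CompleteSpace X]
  [NormedAddCommGroup Y] [NormedSpace ℂ Y] [CompleteSpace Y]
  {J : Y →L[ℂ] X} {R₀ : X →L[ℂ] Y} {N : ℕ} {μ : Fin N → ℝ} {b : Fin N → Y}
  {ℓ : Fin N → X →L[ℂ] ℂ} {Q : ℂ → X →L[ℂ] Y} {k γ M : ℝ}

/-- The inverse of `freq μ m - A` as an operator given by a spectral splitting of `A`. -/
def splitInv (μ : Fin N → ℝ) (b : Fin N → Y) (ℓ : Fin N → X →L[ℂ] ℂ) (Q : ℂ → X →L[ℂ] Y)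
    (m : Fin N → ℕ) : X →L[ℂ] Y :=
  Q (freq μ m) + ∑ j, ((freq μ m : ℂ) - μ j)⁻¹ • (ℓ j).smulRight (b j)

lemma splitInv_apply (m : Fin N → ℕ) (y : X) : splitInv μ b ℓ Q m y =
    Q (freq μ m) y + ∑ j, ((freq μ m : ℂ) - μ j)⁻¹ • ℓ j y • b j := by
  simp [splitInv]

/-- With `R₀ = -A⁻¹` the identity says `(freq μ m - A) x = y`. The stable component is inverted by
`Q`, and each mode is divided by `freq μ m - μ j`, nonzero in degree at least two by non-resonance.
-/
lemma UnstableSplitting.splitInv_eq (hU : UnstableSplitting J R₀ μ b ℓ Q k γ M)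
    (hμ : IsNonResonant μ) {m : Fin N → ℕ} (hm : 2 ≤ multiDeg N m) (y : X) :
    R₀ (-(freq μ m : ℂ) • J (splitInv μ b ℓ Q m y) + y) = splitInv μ b ℓ Q m y := by
  have hz : (freq μ m : ℂ) ∈ region k :=
    mem_region_of_re_nonneg hU.decay.pos (by simpa using freq_nonneg hU.mu_pos m)
  have h1 := hU.right _ hz y
  have hne : ∀ j, (freq μ m : ℂ) - μ j ≠ 0 := fun j h => by
    rw [sub_eq_zero, Complex.ofReal_inj] at h
    exact hμ j m hm h.symm
  rw [splitInv_apply]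
  conv_rhs => rw [h1]
  have h2 : ∑ j, ((freq μ m : ℂ) - μ j)⁻¹ • ℓ j y • b j =
      R₀ (∑ j, ((freq μ m : ℂ) - μ j)⁻¹ • ℓ j y • (-(μ j : ℂ) • J (b j))) := by
    rw [map_sum]
    refine Finset.sum_congr rfl fun j _ => ?_
    rw [map_smul, map_smul, hU.eig]
  conv_rhs => rw [h2]
  rw [← map_add]
  congr 1
  have h3 : ∑ j, ((freq μ m : ℂ) - μ j)⁻¹ • ℓ j y • (-(μ j : ℂ) • J (b j)) =
      ∑ j, ℓ j y • J (b j) - (freq μ m : ℂ) • ∑ j, ((freq μ m : ℂ) - μ j)⁻¹ • ℓ j y • J (b j) := by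
    rw [Finset.smul_sum, ← Finset.sum_sub_distrib]
    refine Finset.sum_congr rfl fun j _ => ?_
    simp only [smul_smul]
    rw [← sub_smul]
    congr 1
    have := hne j
    field_simp
    ring
  rw [h3, map_add, map_sum]
  simp only [map_smul, smul_add, neg_smul]
  abel

lemma UnstableSplitting.exists_norm_splitInv_le (hU : UnstableSplitting J R₀ μ b ℓ Q k γ M) :
    ∃ C : ℝ, ∀ m, ‖splitInv μ b ℓ Q m‖ ≤ C := by
  choose C hC using exists_inv_freq_sub_le hU.mu_pos
  refine ⟨M + ∑ j, C j * ‖(ℓ j).smulRight (b j)‖, fun m => ?_⟩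
  refine (norm_add_le _ _).trans (add_le_add ?_ ?_)
  · have hz : (freq μ m : ℂ) ∈ region k :=
      mem_region_of_re_nonneg hU.decay.pos (by simpa using freq_nonneg hU.mu_pos m)
    refine (hU.decay.bound _ hz).trans (mul_le_of_le_one_right hU.decay.nonneg ?_)
    exact Real.rpow_le_one_of_one_le_of_nonpos (by linarith [norm_nonneg (freq μ m : ℂ)])
      (by linarith [hU.decay.rate_pos])
  · refine (norm_sum_le _ _).trans (Finset.sum_le_sum fun j _ => ?_)
    rw [norm_smul]
    exact mul_le_mul_of_nonneg_right (hC j m) (norm_nonneg _)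

/-- The families supported on the unit multi-indices, with multiples of the eigenvectors there,
normalized at time `-1`. -/
def modeL (μ : Fin N → ℝ) (b : Fin N → Y) : (Fin N → ℂ) →L[ℂ] SumFamily (Fin N → ℕ) Y :=
  ∑ j, Complex.exp (μ j) • (singleL (Pi.single j 1) ∘L
    (ContinuousLinearMap.proj (R := ℂ) (φ := fun _ : Fin N => ℂ) j).smulRight (b j))

lemma modeL_apply (v : Fin N → ℂ) : modeL μ b v =
    ∑ j, Complex.exp (μ j) • singleL (Pi.single j 1) (v j • b j) := by
  simp [modeL]

lemma modeL_apply_apply (v : Fin N → ℂ) (m : Fin N → ℕ) : modeL μ b v m =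
    ∑ j, Complex.exp (μ j) • if m = Pi.single j 1 then v j • b j else 0 := by
  rw [← coordL_apply, modeL_apply, map_sum]
  refine Finset.sum_congr rfl fun j _ => ?_
  rw [map_smul, coordL_apply, singleL_apply]

lemma modeL_zero_apply (v : Fin N → ℂ) : modeL μ b v 0 = 0 := by
  rw [modeL_apply_apply]
  refine Finset.sum_eq_zero fun j _ => ?_
  rw [if_neg, smul_zero]
  intro h
  have := multiDeg_single j
  rw [← h, map_zero] at this
  exact zero_ne_one this

lemma UnstableSplitting.modeL_eq (hU : UnstableSplitting J R₀ μ b ℓ Q k γ M) (v : Fin N → ℂ)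
    (m : Fin N → ℕ) : R₀ (-(freq μ m : ℂ) • J (modeL μ b v m)) = modeL μ b v m := by
  rw [modeL_apply_apply, map_sum, Finset.smul_sum, map_sum]
  refine Finset.sum_congr rfl fun j _ => ?_
  split_ifs with h
  · have e := hU.eig j
    rw [map_smul] at e
    rw [h, freq_single]
    conv_rhs => rw [← e]
    simp only [map_smul, smul_smul]
    congr 1
    ring
  · simp

lemma UnstableSplitting.coord_modeL (hU : UnstableSplitting J R₀ μ b ℓ Q k γ M)
    (hw : ∀ m, ‖expWeight μ (-1) m‖ ≤ 1) (v : Fin N → ℂ) (i : Fin N) :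
    ℓ i (J (weightedSum (expWeight μ (-1)) hw (modeL μ b v))) = v i := by
  rw [modeL_apply, map_sum, map_sum, map_sum, Finset.sum_eq_single i]
  · rw [map_smul, weightedSum_singleL, expWeight_single, smul_smul, ← Complex.exp_add]
    simp [hU.dual]
  · intro j _ hj
    simp [weightedSum_singleL, hU.dual, hj.symm]
  · simp

/-- The unstable manifold of the origin for the nonlinearity `g`: small orbits on the left half
plane, parametrized by their unstable coordinates at time `-1`, with almost periodicity in the
imaginary direction. -/
theorem UnstableSplitting.exists_expSeries_orbit (hU : UnstableSplitting J R₀ μ b ℓ Q k γ M)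
    (hμ : IsNonResonant μ) {g : Y → X} (hg : IsEntire g) (h0 : g 0 = 0) (h1 : fderiv ℂ g 0 = 0)
    {r : ℝ} (hr : 0 < r) :
    ∃ δ > 0, ∀ u : Fin N → ℂ, ‖u‖ < δ → ∃ a : SumFamily (Fin N → ℕ) Y, ‖a‖ ≤ r ∧
      (∀ i, ℓ i (J (expSeries μ a (-1))) = u i) ∧
      ∀ t : ℂ, t.re < 0 → expSeries μ a t =
        R₀ (-(J (deriv (expSeries μ a) t)) + g (expSeries μ a t)) := by
  obtain ⟨G, G0, G1, Gsum, Gdeg⟩ := hg.exists_lift h0 h1 (multiDeg N)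
  obtain ⟨C, hC⟩ := hU.exists_norm_splitInv_le
  have hC0 : 0 ≤ C := (norm_nonneg _).trans (hC 0)
  have hw1 : ∀ m, ‖expWeight μ (-1) m‖ ≤ 1 := norm_expWeight_le hU.mu_pos (by simp)
  have hS : ∀ m, ‖if 2 ≤ multiDeg N m then
      singleL m ∘L splitInv μ b ℓ Q m else (0 : X →L[ℂ] SumFamily (Fin N → ℕ) Y)‖ ≤ C := by
    intro m
    split_ifs
    · refine (ContinuousLinearMap.opNorm_comp_le _ _).trans ?_
      exact (mul_le_of_le_one_left (norm_nonneg _) (norm_singleL_le m)).trans (hC m)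
    · simpa using hC0
  set K : SumFamily (Fin N → ℕ) X →L[ℂ] SumFamily (Fin N → ℕ) Y := sumMap _ C hS with hK
  -- `K` inverts the linear part coefficient by coefficient. Degree one stays free for the modes,
  -- and degree zero is left at zero.
  have hKm : ∀ (y : SumFamily (Fin N → ℕ) X) (m : Fin N → ℕ), K y m =
      if 2 ≤ multiDeg N m then splitInv μ b ℓ Q m (y m) else 0 := by
    intro y m
    have h2 := (coordL m).hasSum (SumFamily.summable_apply hS y).hasSum
    rw [← sumMap_apply hS, coordL_apply] at h2
    refine h2.unique ?_
    convert hasSum_single m ?_ using 1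
    · split_ifs
      · rw [coordL_apply, ContinuousLinearMap.comp_apply, singleL_apply, if_pos rfl]
      · simp
    · intro m' hm'
      rw [coordL_apply]
      split_ifs
      · rw [ContinuousLinearMap.comp_apply, singleL_apply, if_neg hm'.symm]
      · rfl
  set coords : SumFamily (Fin N → ℕ) Y →L[ℂ] (Fin N → ℂ) := ContinuousLinearMap.pi fun i =>
    (ℓ i ∘L J) ∘L weightedSum (expWeight μ (-1)) hw1 with hcoords
  have hcm : ∀ v, coords (modeL μ b v) = v := fun v => funext fun i => hU.coord_modeL hw1 v i
  -- The correction by `modeL μ b ∘L coords` makes the unstable coordinates of `T` vanish at time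
  -- `-1`. Thus a solution of `a - T (G a) = modeL μ b u` has coordinates exactly `u`.
  set T : SumFamily (Fin N → ℕ) X →L[ℂ] SumFamily (Fin N → ℕ) Y :=
    K - (modeL μ b ∘L coords) ∘L K with hT
  have hF : HasStrictFDerivAt (fun a => a - T (G a))
      ((ContinuousLinearEquiv.refl ℂ (SumFamily (Fin N → ℕ) Y) :
        SumFamily (Fin N → ℕ) Y ≃L[ℂ] _) : SumFamily (Fin N → ℕ) Y →L[ℂ] _) 0 := by
    have h2 := (hasStrictFDerivAt_id (𝕜 := ℂ) (0 : SumFamily (Fin N → ℕ) Y)).sub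
      (T.hasStrictFDerivAt.comp 0 G1)
    rw [ContinuousLinearMap.comp_zero, sub_zero] at h2
    exact h2
  -- Local surjectivity at the origin: `G` has zero derivative there, so the map has the identity as
  -- derivative. The radius `1 / 8` below keeps `a` in the ball of radius `1 / 4` where the lift
  -- represents `g`.
  have hmap := hF.map_nhds_eq_of_equiv
  rw [G0, map_zero, sub_zero] at hmap
  have hr' : 0 < min r (1 / 8) := lt_min hr (by norm_num)
  have himg := image_mem_map (m := fun a => a - T (G a))
    (Metric.closedBall_mem_nhds (0 : SumFamily (Fin N → ℕ) Y) hr')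
  rw [hmap] at himg
  have hpre : (modeL μ b) ⁻¹' _ ∈ 𝓝 (0 : Fin N → ℂ) :=
    (modeL μ b).continuous.continuousAt.preimage_mem_nhds (by rw [map_zero]; exact himg)
  obtain ⟨δ, hδ, hball⟩ := Metric.mem_nhds_iff.1 hpre
  refine ⟨δ, hδ, fun u hu => ?_⟩
  obtain ⟨a, ha, hau⟩ := hball (mem_ball_zero_iff.2 hu)
  rw [mem_closedBall_zero_iff] at ha
  have har : ‖a‖ ≤ r := ha.trans (min_le_left _ _)
  have ha4 : ‖a‖ < 1 / 4 := (ha.trans (min_le_right _ _)).trans_lt (by norm_num)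
  replace hau : a - T (G a) = modeL μ b u := hau
  set v : Fin N → ℂ := u - coords (K (G a)) with hv
  have hav : a = K (G a) + modeL μ b v := by
    rw [sub_eq_iff_eq_add] at hau
    rw [hv, map_sub]
    conv_lhs => rw [hau]
    rw [hT]
    simp only [sub_apply, ContinuousLinearMap.comp_apply]
    abel
  have hcoord : coords a = u := by
    rw [hav, map_add, hcm, hv]
    abel
  have ha1 : OrderGE (multiDeg N) 1 a := by
    intro m hm
    have hm0 : m = 0 := multiDeg_eq_zero m (by omega)
    rw [hav, SumFamily.add_apply, hKm, if_neg (by omega), hm0, modeL_zero_apply, add_zero]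
  have hG2 := Gdeg a ha4 ha1
  -- The differential equation for each coefficient. In degrees zero and one the nonlinearity
  -- contributes nothing, because `G a` has order two.
  have hrel : ∀ m, R₀ (-(freq μ m : ℂ) • J (a m) + G a m) = a m := by
    intro m
    have e1 : R₀ (-(freq μ m : ℂ) • J (K (G a) m) + G a m) = K (G a) m := by
      rw [hKm]
      split_ifs with h
      · exact hU.splitInv_eq hμ h _
      · rw [hG2 m (by omega)]; simp
    have e2 := hU.modeL_eq v m
    have e3 : a m = K (G a) m + modeL μ b v m := by
      rw [← SumFamily.add_apply, ← hav]
    rw [e3]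
    conv_rhs => rw [← e1, ← e2]
    rw [← map_add, map_add J, smul_add, add_right_comm]
  refine ⟨a, har, fun i => congrFun hcoord i, fun t ht => ?_⟩
  obtain ⟨hd, hds⟩ := hasDerivAt_expSeries hU.mu_pos a ht
  have hgs : HasSum (fun m => expWeight μ t m • G a m) (g (expSeries μ a t)) := by
    have := Gsum a ha4 (expWeight μ t) (norm_expWeight_le hU.mu_pos ht.le) (expWeight_add μ t)
      (expWeight_zero μ t)
    have e : weightedSum (expWeight μ t) (norm_expWeight_le hU.mu_pos ht.le) a =
      expSeries μ a t := rfl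
    rw [e] at this
    rw [← this]
    exact hasSum_expSeries hU.mu_pos (G a) ht.le
  have hs := R₀.hasSum ((J.hasSum hds.hasSum).neg.add hgs)
  rw [hd.deriv]
  refine (hasSum_expSeries hU.mu_pos a ht.le).unique ?_
  convert hs using 2 with m
  rw [← hrel m]
  conv_lhs => rw [← map_smul]
  conv_rhs => rw [hrel m]
  congr 1
  rw [smul_add, map_smul, ← neg_smul, smul_smul]
  congr 2
  ring

end

end

section

/-! ### Uniqueness of small orbits in backward time -/

section

universe u

lemma hasDerivAt_comp_real_line {E : Type*} [NormedAddCommGroup E] [NormedSpace ℂ E] {D : ℂ → E}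
    {z w : ℂ} {s : ℝ} (h : DifferentiableAt ℂ D (z + w * s)) :
    HasDerivAt (fun s : ℝ => D (z + w * s)) (w • deriv D (z + w * s)) s := by
  have h1 : HasDerivAt (fun s : ℝ => z + w * s) w s := by
    simpa using ((Complex.ofRealCLM.hasDerivAt (x := s)).const_mul w).const_add z
  exact h.hasDerivAt.scomp s h1

/-- Identity theorem from a real segment. -/
lemma eqOn_of_eq_on_real {E : Type*} [NormedAddCommGroup E] [NormedSpace ℂ E] [CompleteSpace E]
    {U : Set ℂ} (hU : IsOpen U) (hc : IsPreconnected U) {f g : ℂ → E} (hf : DifferentiableOn ℂ f U)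
    (hg : DifferentiableOn ℂ g U) {x : ℝ} (hx : (x : ℂ) ∈ U)
    (h : ∀ s : ℝ, s ≤ x → f s = g s) : Set.EqOn f g U := by
  refine (hf.analyticOnNhd hU).eqOn_of_preconnected_of_frequently_eq (hg.analyticOnNhd hU) hc hx ?_
  have ht : Tendsto (fun s : ℝ => (s : ℂ)) (𝓝[<] x) (𝓝[≠] (x : ℂ)) := by
    refine tendsto_nhdsWithin_iff.2 ⟨(Complex.continuous_ofReal.tendsto x).mono_left
      nhdsWithin_le_nhds, ?_⟩
    filter_upwards [self_mem_nhdsWithin] with s hs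
    simpa using ne_of_lt hs
  refine ht.frequently (Eventually.frequently ?_)
  filter_upwards [self_mem_nhdsWithin] with s hs
  exact h s (le_of_lt hs)

/-- Backward in time the growing mode is damped. With `τ = -1 - s` and the integrating factor `exp
(μ τ)`, the norm is compared with `H (exp (μ τ) - 1) / μ`. -/
lemma norm_le_of_backward_ode {c q : ℝ → ℂ} {μ H : ℝ} (hμ : 0 < μ)
    (hc : ∀ s ≤ -1, HasDerivAt c (μ * c s + q s) s) (hq : ∀ s ≤ -1, ‖q s‖ ≤ H) (h0 : c (-1) = 0)
    {s : ℝ} (hs : s ≤ -1) : ‖c s‖ ≤ H / μ := by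
  have hH : 0 ≤ H := (norm_nonneg _).trans (hq (-1) le_rfl)
  have hd : ∀ τ : ℝ, 0 ≤ τ → HasDerivAt (fun τ : ℝ => Complex.exp (μ * τ) * c (-1 - τ))
      (-(Complex.exp (μ * τ) * q (-1 - τ))) τ := by
    intro τ hτ
    have h1 : HasDerivAt (fun τ : ℝ => c (-1 - τ)) (-(μ * c (-1 - τ) + q (-1 - τ))) τ := by
      have := (hc (-1 - τ) (by linarith)).scomp τ ((hasDerivAt_id τ).const_sub (-1))
      simpa [Function.comp_def, add_comm] using this
    have h2 : HasDerivAt (fun τ : ℝ => Complex.exp (μ * τ)) (Complex.exp (μ * τ) * μ) τ := by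
      have := ((Complex.ofRealCLM.hasDerivAt (x := τ)).const_mul (μ : ℂ)).cexp
      simpa using this
    refine (h2.mul h1).congr_deriv ?_
    ring
  have hB : ∀ τ : ℝ, HasDerivAt (fun τ : ℝ => H * (Real.exp (μ * τ) - 1) / μ)
      (H * Real.exp (μ * τ)) τ := by
    intro τ
    have := (((((hasDerivAt_id τ).const_mul μ).exp).sub_const 1).const_mul H).div_const μ
    refine this.congr_deriv ?_
    simp only [id]
    field_simp
  have hn : ∀ τ : ℝ, ‖Complex.exp (μ * τ)‖ = Real.exp (μ * τ) := fun τ => by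
    rw [Complex.norm_exp]; simp
  have hmain := image_norm_le_of_norm_deriv_right_le_deriv_boundary (a := 0) (b := -1 - s)
    (f := fun τ : ℝ => Complex.exp (μ * τ) * c (-1 - τ))
    (f' := fun τ => -(Complex.exp (μ * τ) * q (-1 - τ)))
    (fun τ hτ => (hd τ hτ.1).continuousAt.continuousWithinAt)
    (fun τ hτ => (hd τ hτ.1).hasDerivWithinAt) (by simp [h0]) hB (fun τ hτ => by
      rw [norm_neg, norm_mul, hn, mul_comm]
      exact mul_le_mul_of_nonneg_right (hq _ (by linarith [hτ.1])) (Real.exp_pos _).le)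
    (x := -1 - s) ⟨by linarith, le_rfl⟩
  simp only [sub_sub_cancel] at hmain
  rw [norm_mul, hn] at hmain
  have he := Real.exp_pos (μ * (-1 - s))
  refine le_of_mul_le_mul_left (hmain.trans ?_) he
  rw [mul_div_assoc', mul_comm]
  gcongr
  linarith

variable {X Y : Type u} [NormedAddCommGroup X] [NormedSpace ℂ X] [CompleteSpace X]
  [NormedAddCommGroup Y] [NormedSpace ℂ Y] [CompleteSpace Y]

lemma IsEntire.exists_lipschitz_near_zero {g : Y → X} (hg : IsEntire g)
    (h1 : _root_.fderiv ℂ g 0 = 0) {η : ℝ} (hη : 0 < η) :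
    ∃ r > 0, ∀ x y, ‖x‖ ≤ r → ‖y‖ ≤ r → ‖g x - g y‖ ≤ η * ‖x - y‖ := by
  have hs : HasStrictFDerivAt g (0 : Y →L[ℂ] X) 0 := by
    rw [← h1]
    exact hg.contDiff.contDiffAt.hasStrictFDerivAt (by simp)
  have h2 := hs.isLittleO.def hη
  rw [show ((0 : Y), (0 : Y)) = (0 : Y × Y) from rfl] at h2
  obtain ⟨r, hr, hb⟩ := Metric.eventually_nhds_iff.1 h2
  refine ⟨r / 2, by positivity, fun x y hx hy => ?_⟩
  have := @hb (x, y) (by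
    rw [dist_zero_right, Prod.norm_def]
    exact max_lt (by simp; linarith) (by simp; linarith))
  simpa using this

variable {J : Y →L[ℂ] X} {R₀ : X →L[ℂ] Y} {N : ℕ} {μ : Fin N → ℝ} {b : Fin N → Y}
  {ℓ : Fin N → X →L[ℂ] ℂ} {Q : ℂ → X →L[ℂ] Y} {k γ M : ℝ}

/-- Bounded backward solutions of the inhomogeneous equation with vanishing unstable coordinates
at time `-1` are controlled by the inhomogeneity. -/
lemma UnstableSplitting.norm_le_of_backward (hU : UnstableSplitting J R₀ μ b ℓ Q k γ M)
    {d d' : ℝ → Y} {h : ℝ → X} {S H : ℝ} (hd : ∀ s ≤ -1, HasDerivAt d (d' s) s)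
    (hd' : ContinuousOn d' (Set.Iic (-1))) (hh : ContinuousOn h (Set.Iic (-1)))
    (hrel : ∀ s ≤ -1, R₀ (-J (d' s) + h s) = d s) (h0 : ∀ i, ℓ i (J (d (-1))) = 0)
    (hS : ∀ s ≤ -1, ‖d s‖ ≤ S) (hH : ∀ s ≤ -1, ‖h s‖ ≤ H) {τ : ℝ} (hτ : τ ≤ -1) :
    ‖d τ‖ ≤ (convConst k γ * M + ∑ j, ‖ℓ j‖ / μ j * ‖b j‖) * H := by
  set P : Y →L[ℂ] Y := ContinuousLinearMap.id ℂ Y - ∑ j, (ℓ j ∘L J).smulRight (b j) with hP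
  have hPa : ∀ y, P y = y - ∑ j, ℓ j (J y) • b j := fun y => by simp [hP]
  have hJd : ∀ s ≤ -1, HasDerivAt (fun s => J (d s)) (J (d' s)) s := fun s hs =>
    (J.restrictScalars ℝ).hasFDerivAt.comp_hasDerivAt s (hd s hs)
  have hPd : ∀ s ≤ -1, HasDerivAt (fun s => P (d s)) (P (d' s)) s := fun s hs =>
    (P.restrictScalars ℝ).hasFDerivAt.comp_hasDerivAt s (hd s hs)
  -- The stable component is computed from the initial time `τ - t`. As `t → ∞` the bounded initial
  -- value contributes at most `A / t ^ 2`, which disappears.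
  have hstab : ‖P (d τ)‖ ≤ convConst k γ * M * H := by
    set A := (64 / k ^ 2 * ∫ y : ℝ, ((1 + |y|) ^ 2)⁻¹) * M * (‖J‖ * S)
    have hA : ∀ t : ℝ, 0 < t → ‖P (d τ)‖ ≤ A / t ^ 2 + convConst k γ * M * H := by
      intro t ht
      have hmap : ∀ s ∈ Set.Icc 0 t, τ - t + s ≤ -1 := fun s hs => by linarith [hs.2]
      have hcont : ContinuousOn (fun s : ℝ => τ - t + s) (Set.Icc 0 t) := by fun_prop
      have hmaps : Set.MapsTo (fun s : ℝ => τ - t + s) (Set.Icc 0 t) (Set.Iic (-1)) := hmap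
      have := hU.decay.norm_le ht (d := fun s => J (d (τ - t + s)))
        (d' := fun s => J (d' (τ - t + s))) (h := fun s => h (τ - t + s))
        (p := fun s => P (d (τ - t + s))) (p' := fun s => P (d' (τ - t + s))) (H := H)
        (fun s hs => (hJd _ (hmap s hs)).comp_const_add (τ - t) s)
        (J.continuous.comp_continuousOn (hd'.comp hcont hmaps))
        (hh.comp hcont hmaps) (fun s hs => hH _ (hmap s hs))
        (fun s hs => (hPd _ (hmap s hs)).comp_const_add (τ - t) s)
        (P.continuous.comp_continuousOn (hd'.comp hcont hmaps))
        (fun z hz s hs => by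
          have := hU.left z hz (-J (d' (τ - t + s)) + h (τ - t + s))
          rw [hrel _ (hmap s hs), ← hPa] at this
          rw [← this]
          congr 1
          abel)
      simp only [sub_add_cancel, add_zero] at this
      refine this.trans ?_
      have hle : ‖J (d (τ - t))‖ ≤ ‖J‖ * S :=
        (J.le_opNorm _).trans (by gcongr; exact hS _ (by linarith))
      have h1 := mul_le_mul_of_nonneg_left hle (mul_nonneg (mul_nonneg
        (by positivity : 0 ≤ 64 / k ^ 2) (integral_nonneg fun y => by positivity :
          0 ≤ ∫ y : ℝ, ((1 + |y|) ^ 2)⁻¹)) hU.decay.nonneg)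
      linarith [div_le_div_of_nonneg_right h1 (sq_nonneg t)]
    have hlim : Tendsto (fun t : ℝ => A / t ^ 2 + convConst k γ * M * H) atTop
        (𝓝 (0 + convConst k γ * M * H)) :=
      (tendsto_const_nhds.div_atTop (tendsto_pow_atTop two_ne_zero)).add_const _
    rw [zero_add] at hlim
    refine ge_of_tendsto hlim ?_
    filter_upwards [eventually_gt_atTop 0] with t ht using hA t ht
  -- The unstable coordinates are instead integrated backward from time `-1`, where they vanish.
  have hcoord : ∀ j, ‖ℓ j (J (d τ))‖ ≤ ‖ℓ j‖ * H / μ j := by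
    intro j
    refine norm_le_of_backward_ode (c := fun s => ℓ j (J (d s))) (q := fun s => ℓ j (h s))
      (hU.mu_pos j) (fun s hs => ?_) (fun s hs => ?_) (h0 j) hτ
    · refine (((ℓ j).restrictScalars ℝ).hasFDerivAt.comp_hasDerivAt s (hJd s hs)).congr_deriv ?_
      have := hU.coord j (-J (d' s) + h s)
      rw [hrel s hs, map_add, map_neg] at this
      change ℓ j (J (d' s)) = _
      linear_combination -this
    · exact ((ℓ j).le_opNorm _).trans (by gcongr; exact hH s hs)
  have e : d τ = P (d τ) + ∑ j, ℓ j (J (d τ)) • b j := by rw [hPa]; abel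
  rw [e, add_mul, Finset.sum_mul]
  refine (norm_add_le _ _).trans (add_le_add hstab ((norm_sum_le _ _).trans
    (Finset.sum_le_sum fun j _ => ?_)))
  rw [norm_smul]
  calc _ ≤ ‖ℓ j‖ * H / μ j * ‖b j‖ := by gcongr; exact hcoord j
    _ = _ := by ring

/-- Small backward orbits are determined by their unstable coordinates at time `-1`. -/
lemma UnstableSplitting.exists_unique_radius (hU : UnstableSplitting J R₀ μ b ℓ Q k γ M)
    {g : Y → X} (hg : IsEntire g) (h1 : fderiv ℂ g 0 = 0) :
    ∃ r > 0, ∀ p p' q q' : ℝ → Y, (∀ s ≤ -1, HasDerivAt p (p' s) s) →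
      (∀ s ≤ -1, HasDerivAt q (q' s) s) → ContinuousOn p' (Set.Iic (-1)) →
      ContinuousOn q' (Set.Iic (-1)) → (∀ s ≤ -1, R₀ (-J (p' s) + g (p s)) = p s) →
      (∀ s ≤ -1, R₀ (-J (q' s) + g (q s)) = q s) → (∀ s ≤ -1, ‖p s‖ ≤ r) →
      (∀ s ≤ -1, ‖q s‖ ≤ r) → (∀ i, ℓ i (J (p (-1))) = ℓ i (J (q (-1)))) →
      ∀ s ≤ -1, p s = q s := by
  set K := convConst k γ * M + ∑ j, ‖ℓ j‖ / μ j * ‖b j‖ with hK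
  have hK0 : 0 ≤ K := add_nonneg (mul_nonneg (convConst_nonneg hU.decay.pos) hU.decay.nonneg)
    (Finset.sum_nonneg fun j _ => mul_nonneg (div_nonneg (norm_nonneg _) (hU.mu_pos j).le)
      (norm_nonneg _))
  obtain ⟨r, hr, hlip⟩ := hg.exists_lipschitz_near_zero h1 (η := 1 / (2 * (K + 1))) (by positivity)
  refine ⟨r, hr, fun p p' q q' hp hq hp' hq' hpr hqr hpb hqb h0 => ?_⟩
  have hpc : ContinuousOn p (Set.Iic (-1)) := fun s hs => (hp s hs).continuousAt.continuousWithinAt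
  have hqc : ContinuousOn q (Set.Iic (-1)) := fun s hs => (hq s hs).continuousAt.continuousWithinAt
  -- The Lipschitz constant `1 / (2 (K + 1))` of `g` near the origin makes the linear estimate a
  -- contraction; iterating the halving forces the difference to vanish.
  have hstep : ∀ S, (∀ s ≤ -1, ‖p s - q s‖ ≤ S) → ∀ s ≤ -1, ‖p s - q s‖ ≤ S / 2 := by
    intro S hS s hs
    have hS0 : 0 ≤ S := (norm_nonneg _).trans (hS s hs)
    have := hU.norm_le_of_backward (d := fun s => p s - q s) (d' := fun s => p' s - q' s)
      (h := fun s => g (p s) - g (q s)) (S := S) (H := 1 / (2 * (K + 1)) * S)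
      (fun s hs => (hp s hs).sub (hq s hs)) (hp'.sub hq')
      ((hg.diff.continuous.comp_continuousOn hpc).sub (hg.diff.continuous.comp_continuousOn hqc))
      (fun s hs => by
        conv_rhs => rw [← hpr s hs, ← hqr s hs]
        rw [← map_sub, map_sub J]
        congr 1
        abel)
      (fun i => by rw [map_sub, map_sub, h0, sub_self]) hS
      (fun s hs => (hlip _ _ (hpb s hs) (hqb s hs)).trans (by gcongr; exact hS s hs)) hs
    refine this.trans ?_
    rw [← hK]
    have : K * (1 / (2 * (K + 1)) * S) = (K / (K + 1)) * (S / 2) := by field_simp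
    rw [this]
    exact mul_le_of_le_one_left (by positivity) ((div_le_one (by positivity)).2 (by linarith))
  have hall : ∀ n : ℕ, ∀ s ≤ -1, ‖p s - q s‖ ≤ 2 * r / 2 ^ n := by
    intro n
    induction n with
    | zero =>
      intro s hs
      have := norm_sub_le (p s) (q s)
      have := hpb s hs
      have := hqb s hs
      simp only [pow_zero, div_one]
      linarith
    | succ n ih =>
      intro s hs
      rw [pow_succ, ← div_div]
      exact hstep _ ih s hs
  intro s hs
  have hlim : Tendsto (fun n : ℕ => 2 * r / 2 ^ n) atTop (𝓝 0) :=
    tendsto_const_nhds.div_atTop (tendsto_pow_atTop_atTop_of_one_lt one_lt_two)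
  have := ge_of_tendsto' hlim fun n => hall n s hs
  exact sub_eq_zero.1 (norm_le_zero_iff.1 this)

/-- An entire solution that tends to the origin in backward real time is bounded on a left half
plane and almost periodic there in the imaginary direction. -/
theorem UnstableSplitting.almostPeriodic_of_tendsto (hU : UnstableSplitting J R₀ μ b ℓ Q k γ M)
    (hμ : IsNonResonant μ) {g : Y → X} (hg : IsEntire g) (h0 : g 0 = 0) (h1 : fderiv ℂ g 0 = 0)
    {D : ℂ → Y} (hD : Differentiable ℂ D) (hrel : ∀ z, R₀ (-J (deriv D z) + g (D z)) = D z)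
    (hlim : Tendsto (fun s : ℝ => D s) atBot (𝓝 0)) :
    ∃ S : ℝ, (∃ C, ∀ z : ℂ, z.re ≤ S → ‖D z‖ ≤ C) ∧ ∀ ε > 0, ∃ η > 0, ∀ σ : ℝ,
      (∀ j, ‖Complex.exp (μ j * (σ * Complex.I)) - 1‖ ≤ η) →
      ∀ z : ℂ, z.re ≤ S → ‖D (z + σ * Complex.I) - D z‖ ≤ ε := by
  obtain ⟨r, hr, huniq⟩ := hU.exists_unique_radius hg h1
  obtain ⟨δ, hδ, horb⟩ := hU.exists_expSeries_orbit hμ hg h0 h1 hr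
  have hcoord : Tendsto (fun s : ℝ => fun i => ℓ i (J (D s))) atBot (𝓝 0) := by
    rw [tendsto_pi_nhds]
    intro i
    have := ((ℓ i ∘L J).continuous.tendsto 0).comp hlim
    simpa [Function.comp_def, add_comm] using this
  have hev := (hlim.eventually (Metric.closedBall_mem_nhds 0 hr)).and
    (hcoord.eventually (Metric.ball_mem_nhds 0 hδ))
  -- The series is built with the unstable coordinates of `D S`. It has them at time `-1`, so `D` is
  -- compared after a translation by `S + 1`.
  obtain ⟨S, hS⟩ := eventually_atBot.1 hev
  obtain ⟨a, har, hau, harel⟩ := horb _ (mem_ball_zero_iff.1 (hS S le_rfl).2)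
  set H : Set ℂ := {z | z.re < 0} with hH
  have hHo : IsOpen H := isOpen_lt Complex.continuous_re continuous_const
  have hed : DifferentiableOn ℂ (expSeries μ a) H := fun z hz =>
    (hasDerivAt_expSeries hU.mu_pos a hz).1.differentiableAt.differentiableWithinAt
  have hsh : Differentiable ℂ fun z => D (z + (S + 1 : ℝ)) := hD.comp (by fun_prop)
  have hmem : ∀ s : ℝ, s ≤ -1 → (s : ℂ) ∈ H := fun s hs => by
    change (s : ℂ).re < 0
    rw [Complex.ofReal_re]
    linarith
  have hreal : ∀ s : ℝ, s ≤ -1 → D ((s : ℂ) + (S + 1 : ℝ)) = expSeries μ a s := by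
    refine huniq (fun s => D ((s : ℂ) + (S + 1 : ℝ))) (fun s => deriv D ((s : ℂ) + (S + 1 : ℝ)))
      (fun s => expSeries μ a s) (fun s => deriv (expSeries μ a) s) (fun s _ => ?_)
      (fun s hs => ?_) ?_ ?_ (fun s _ => hrel _) (fun s hs => (harel _ (hmem s hs)).symm)
      (fun s hs => ?_) (fun s hs => ?_) (fun i => ?_)
    · have := hasDerivAt_comp_real_line (z := (S + 1 : ℝ)) (w := 1) (s := s) (hD _)
      simpa [add_comm] using this
    · have := hasDerivAt_comp_real_line (z := 0) (w := 1) (s := s) (D := expSeries μ a)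
        (hed.differentiableAt (hHo.mem_nhds (by simpa using hmem s hs)))
      simpa using this
    · have : Continuous (deriv D) := hD.contDiff.continuous_deriv (n := 1) le_rfl
      exact (this.comp (by fun_prop)).continuousOn
    · have : ContinuousOn (deriv (expSeries μ a)) H := (hed.deriv hHo).continuousOn
      exact this.comp Complex.continuous_ofReal.continuousOn hmem
    · have := (hS (s + (S + 1)) (by linarith)).1
      rw [← Complex.ofReal_add]
      simpa using this
    · exact (norm_expSeries_le hU.mu_pos a (hmem s hs).le).trans har
    · have h2 := hau i
      push_cast
      rw [h2, show (-1 : ℂ) + (S + 1) = S by ring]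
  -- Uniqueness gives equality on a real half line, and the identity theorem extends it to the left
  -- half plane.
  have heq : Set.EqOn (fun z => D (z + (S + 1 : ℝ))) (expSeries μ a) H :=
    eqOn_of_eq_on_real hHo (convex_halfSpace_re_lt 0).isPreconnected hsh.differentiableOn hed
      (x := -1) (hmem (-1) le_rfl) hreal
  have hval : ∀ z : ℂ, z.re ≤ S → D z = expSeries μ a (z - (S + 1 : ℝ)) ∧
      (z - (S + 1 : ℝ) : ℂ).re < 0 := fun z hz => by
    have hz' : (z - (S + 1 : ℝ) : ℂ).re < 0 := by
      rw [Complex.sub_re, Complex.ofReal_re]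
      linarith
    refine ⟨?_, hz'⟩
    have := heq hz'
    simpa using this
  refine ⟨S, ⟨‖a‖, fun z hz => ?_⟩, fun ε hε => ?_⟩
  · obtain ⟨e, hz'⟩ := hval z hz
    rw [e]
    exact norm_expSeries_le hU.mu_pos a hz'.le
  · obtain ⟨η, hη, hap⟩ := expSeries_almostPeriodic hU.mu_pos a hε
    refine ⟨η, hη, fun σ hσ z hz => ?_⟩
    obtain ⟨e, hz'⟩ := hval z hz
    obtain ⟨e2, -⟩ := hval (z + σ * Complex.I) (by simpa using hz)
    rw [e, e2, add_sub_right_comm]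
    exact hap σ hσ _ hz'.le

end

end

section

/-! ### Boundedness of entire orbits -/

section

universe u

/-- Common almost periods of finitely many exponentials are relatively dense. -/
lemma exists_almostPeriods {N : ℕ} (μ : Fin N → ℝ) {η : ℝ} (hη : 0 < η) :
    ∃ l : ℝ, 0 ≤ l ∧ ∀ x : ℝ, ∃ σ ∈ Set.Icc x (x + l),
      ∀ j, ‖Complex.exp (μ j * (σ * Complex.I)) - 1‖ ≤ η := by
  set e : ℝ → Fin N → ℂ := fun s j => Complex.exp (μ j * (s * Complex.I)) with he
  have hn : ∀ s j, ‖e s j‖ = 1 := fun s j => by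
    simp only [he]
    rw [Complex.norm_exp]
    simp
  -- The curve of exponentials lies in a compact set. A finite net of its points, attained at times
  -- bounded by `|B|`, approximates every point, and a difference of times is then an almost period.
  have htb : TotallyBounded (Set.range e) := by
    refine (isCompact_closedBall (0 : Fin N → ℂ) 1).totallyBounded.subset ?_
    rintro _ ⟨s, rfl⟩
    rw [mem_closedBall_zero_iff, pi_norm_le_iff_of_nonneg zero_le_one]
    exact fun j => (hn s j).le
  obtain ⟨t, hts, htf, hcov⟩ := Metric.finite_approx_of_totallyBounded htb η hη
  have hch : ∀ y ∈ t, ∃ s, e s = y := fun y hy => hts hy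
  choose! q hq using hch
  obtain ⟨B, hB⟩ := (htf.image fun y => |q y|).bddAbove
  refine ⟨2 * |B|, by positivity, fun x => ?_⟩
  obtain ⟨y, hy, hxy⟩ := Set.mem_iUnion₂.1 (hcov ⟨x + |B|, rfl⟩)
  have hqB : |q y| ≤ |B| := (hB ⟨y, hy, rfl⟩).trans (le_abs_self B)
  refine ⟨x + |B| - q y, ⟨?_, ?_⟩, fun j => ?_⟩
  · linarith [le_abs_self (q y)]
  · linarith [neg_abs_le (q y)]
  · have h1 : e (x + |B| - q y) j * e (q y) j = e (x + |B|) j := by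
      simp only [he]
      rw [← Complex.exp_add]
      congr 1
      push_cast
      ring
    have h2 : ‖(e (x + |B| - q y) j - 1) * e (q y) j‖ ≤ η := by
      rw [sub_mul, h1, one_mul, hq y hy, ← Pi.sub_apply]
      refine (norm_le_pi_norm _ j).trans ?_
      rw [← dist_eq_norm]
      exact (Metric.mem_ball.1 hxy).le
    rwa [norm_mul, hn, mul_one] at h2

variable {X Y : Type u} [NormedAddCommGroup X] [NormedSpace ℂ X] [CompleteSpace X]
  [NormedAddCommGroup Y] [NormedSpace ℂ Y] [CompleteSpace Y]

variable {J : Y →L[ℂ] X} {L : X →ₗ.[ℂ] X} {R : ℂ → X →L[ℂ] Y} {k r B γ : ℝ}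

/-- Continuous dependence of entire orbits on their initial value, along a real segment. -/
lemma SectorLift.exists_continuous_dependence (hR : SectorLift J L R k r B γ) {f : Y → X}
    (hf : IsEntire f) {G : ℂ → Y} (hG : Differentiable ℂ G)
    (hrel : ∀ z ∈ resolventSet L, ∀ ζ, R z (z • J (G ζ) - J (deriv G ζ) + f (G ζ)) = G ζ)
    (a T : ℝ) {ε : ℝ} (hε : 0 < ε) :
    ∃ δ > 0, ∀ σ : ℝ, ‖G (a + σ * Complex.I) - G a‖ < δ →
      ∀ s ∈ Set.Icc 0 T, ‖G (a + σ * Complex.I + s) - G (a + s)‖ ≤ ε := by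
  obtain ⟨k', M₀, hk', hshift⟩ := hR.exists_decayFamily_shift
  obtain ⟨ρ, hρ⟩ := (isCompact_Icc (a := (0 : ℝ)) (b := T)).exists_bound_of_continuousOn
    (f := fun s : ℝ => G (a + s)) (hG.continuous.comp (by fun_prop)).continuousOn
  obtain ⟨C, hC, hlip⟩ := hf.exists_norm_sub_le ρ
  have hc0 : 0 ≤ convConst k' (γ / 2) := convConst_nonneg hk'
  -- The shift `lam` makes the resolvent so small that the Lipschitz constant `C` of `f` is
  -- admissible in `DecayFamily.stable`, although nothing is small about `f`.
  obtain ⟨lam, hlam, hQ, hres, hQJ⟩ :=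
    hshift (1 / (2 * (convConst k' (γ / 2) * C + 1))) (by positivity)
  -- The shift by `lam` means working with `exp (-(lam * s)) • q s`; the factor `exp (-(lam * T))`
  -- undoes this weight. The minimum with `1` keeps `q` in the range of the Lipschitz bound.
  set δ₀ := Real.exp (-(lam * T)) * min 1 ε with hδ₀
  have hδ₀p : 0 < δ₀ := by positivity
  refine ⟨δ₀ / (1 + |2 * (initConst k' * M₀)|), by positivity, fun σ hσ s hs => ?_⟩
  have hT : 0 ≤ T := hs.1.trans hs.2
  set q : ℝ → Y := fun s => G (a + σ * Complex.I + s) - G (a + s) with hq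
  set q' : ℝ → Y := fun s => deriv G (a + σ * Complex.I + s) - deriv G (a + s) with hq'
  have hdG : Continuous (deriv G) := hG.contDiff.continuous_deriv (n := 1) le_rfl
  have hqd : ∀ s, HasDerivAt q (q' s) s := fun s => by
    have h1 := hasDerivAt_comp_real_line (z := a + σ * Complex.I) (w := 1) (s := s) (hG _)
    have h2 := hasDerivAt_comp_real_line (z := a) (w := 1) (s := s) (hG _)
    simp only [one_mul, one_smul] at h1 h2
    exact h1.sub h2
  set e : ℝ → ℂ := fun s => Complex.exp (-(lam * s)) with he
  have hen : ∀ s, ‖e s‖ = Real.exp (-(lam * s)) := fun s => by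
    simp only [he]
    rw [Complex.norm_exp]
    simp
  have hed : ∀ s, HasDerivAt e (-lam * e s) s := fun s => by
    have := ((Complex.ofRealCLM.hasDerivAt (x := s)).const_mul (-(lam : ℂ))).cexp
    simpa [he, mul_comm] using this
  have hec : Continuous e := by fun_prop
  have hqc : Continuous q := by
    have := hG.continuous
    fun_prop
  have hq'c : Continuous q' := by fun_prop
  have hsmall : ∀ s ∈ Set.Icc 0 T, ‖e s • q s‖ ≤ δ₀ → ‖q s‖ ≤ min 1 ε := by
    intro s hs h
    rw [norm_smul, hen, hδ₀] at h
    have h1 : Real.exp (-(lam * T)) ≤ Real.exp (-(lam * s)) := by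
      rw [Real.exp_le_exp]
      nlinarith [hs.2]
    exact le_of_mul_le_mul_left ((mul_le_mul_of_nonneg_right h1 (norm_nonneg _)).trans h)
      (Real.exp_pos _)
  have hmain := hQ.stable (J := J) hQJ (T := T) (η := C) (δ := δ₀) hC (by
      rw [mul_one_div, div_mul_eq_mul_div, div_le_iff₀ (by positivity)]
      linarith)
    (h := fun s => e s • (f (G (a + σ * Complex.I + s)) - f (G (a + s))))
    (p := fun s => e s • q s) (p' := fun s => e s • q' s + (-lam * e s) • q s) (by
      have := hf.diff.continuous
      have := hG.continuous
      exact Continuous.continuousOn (by fun_prop))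
    (fun s hs h => by
      have hl := hlip (G (a + s)) (q s) (hρ s hs) ((hsmall s hs h).trans (min_le_left _ _))
      rw [hq, add_sub_cancel] at hl
      simp only [norm_smul]
      rw [mul_left_comm]
      gcongr)
    (fun s _ => (hed s).smul (hqd s))
    (by
      exact Continuous.continuousOn (by fun_prop))
    (fun z hz s _ => by
      have h1 := hrel _ (hres z hz) (a + σ * Complex.I + s)
      have h2 := hrel _ (hres z hz) (a + s)
      have h3 : e s • q s = R (z + lam) (e s • (((z + lam) • J (G (a + σ * Complex.I + s)) -
          J (deriv G (a + σ * Complex.I + s)) + f (G (a + σ * Complex.I + s))) -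
          ((z + lam) • J (G (a + s)) - J (deriv G (a + s)) + f (G (a + s))))) := by
        rw [map_smul, map_sub, h1, h2]
      refine Eq.trans ?_ h3.symm
      congr 1
      simp only [hq, hq', map_smul, map_sub, map_add, map_neg, smul_add, smul_sub, add_smul, smul_smul,
        neg_mul, neg_smul]
      module)
  have hq0 : ‖e 0 • q 0‖ < δ₀ / (1 + |2 * (initConst k' * M₀)|) := by
    simpa [he, hq] using hσ
  rw [lt_div_iff₀ (by positivity)] at hq0
  have hn0 := norm_nonneg (e 0 • q 0)
  have hab := le_abs_self (2 * (initConst k' * M₀))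
  have hab0 := abs_nonneg (2 * (initConst k' * M₀))
  have ha : ‖e 0 • q 0‖ < δ₀ := by nlinarith
  have hb : 2 * (initConst k' * M₀ * ‖e 0 • q 0‖) < δ₀ := by nlinarith
  exact (hsmall s hs ((hmain ha hb s hs).trans (max_lt ha hb).le)).trans (min_le_right _ _)

/-- Near a stable equilibrium, entire orbits stay small in a sector. -/
lemma SectorLift.exists_sector_bound (hR : SectorLift J L R k r B γ)
    (hs : ∀ z : ℂ, 0 ≤ z.re → z ∈ resolventSet L) {g : Y → X} (hg : IsEntire g) (h0 : g 0 = 0)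
    (h1 : fderiv ℂ g 0 = 0) {D : ℂ → Y} (hD : Differentiable ℂ D)
    (hrel : ∀ z ∈ resolventSet L, ∀ ζ, R z (z • J (D ζ) - J (deriv D ζ) + g (D ζ)) = D ζ) :
    ∃ C δ θ₀ : ℝ, 0 < δ ∧ 0 < θ₀ ∧ ∀ ζ, ‖D ζ‖ < δ → ∀ θ : ℝ, |θ| ≤ θ₀ → ∀ s : ℝ, 0 ≤ s →
      ‖D (ζ + Complex.exp (θ * Complex.I) * s)‖ ≤ C := by
  obtain ⟨k', M, M₀, hk', hrot⟩ := hR.exists_decayFamily_rotate hs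
  have hM : 0 ≤ M := (hrot 0 (by simpa using hk'.le)).1.nonneg
  have hc0 : 0 ≤ convConst k' γ := convConst_nonneg hk'
  obtain ⟨ρ, hρ, hlip⟩ := hg.exists_lipschitz_near_zero h1
    (η := 1 / (2 * (convConst k' γ * M + 1))) (by positivity)
  refine ⟨ρ, ρ / (1 + |2 * (initConst k' * M₀)|), k', by positivity, hk',
    fun ζ hζ θ hθ s hs => ?_⟩
  obtain ⟨hQ, hres, hQJ⟩ := hrot θ hθ
  set w := Complex.exp (θ * Complex.I) with hw
  have hwn : ‖w‖ = 1 := Complex.norm_exp_ofReal_mul_I θ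
  -- Along the ray with direction `w` the solution obeys the equation with linear part and
  -- nonlinearity multiplied by `w`. The resolvent of the rotated operator is the rotated family of
  -- `SectorLift.exists_decayFamily_rotate`.
  have hwi : Complex.exp (-(θ * Complex.I)) * w = 1 := by
    rw [hw, ← Complex.exp_add]; simp
  have hdD : Continuous (deriv D) := hD.contDiff.continuous_deriv (n := 1) le_rfl
  have hDc := hD.continuous
  have hgc := hg.diff.continuous
  have hmain := hQ.stable (J := J) hQJ (T := s) (η := 1 / (2 * (convConst k' γ * M + 1)))
    (δ := ρ) (by positivity) (by
      rw [mul_one_div, div_le_iff₀ (by positivity)]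
      linarith)
    (h := fun s => w • g (D (ζ + w * s))) (p := fun s => D (ζ + w * s))
    (p' := fun s => w • deriv D (ζ + w * s)) (Continuous.continuousOn (by fun_prop))
    (fun s _ h => by
      have := hlip (D (ζ + w * s)) 0 h (by simpa using hρ.le)
      rw [h0, sub_zero, sub_zero] at this
      rwa [norm_smul, hwn, one_mul])
    (fun s _ => hasDerivAt_comp_real_line (hD _)) (Continuous.continuousOn (by fun_prop))
    (fun z hz s _ => by
      have h2 := hrel _ (hres z hz) (ζ + w * s)
      conv_rhs => rw [← h2]
      rw [smul_apply, ← map_smul]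
      congr 1
      simp only [smul_add, smul_sub, smul_smul, map_smul]
      rw [hwi, one_smul, one_smul])
  have hq0 : ‖D ζ‖ < ρ / (1 + |2 * (initConst k' * M₀)|) := hζ
  rw [lt_div_iff₀ (by positivity)] at hq0
  have hn0 := norm_nonneg (D ζ)
  have hab := le_abs_self (2 * (initConst k' * M₀))
  have hab0 := abs_nonneg (2 * (initConst k' * M₀))
  have ha : ‖D ζ‖ < ρ := by nlinarith
  have hb : 2 * (initConst k' * M₀ * ‖D ζ‖) < ρ := by nlinarith
  have := hmain (by simpa using ha) (by simpa using hb) s ⟨hs, le_rfl⟩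
  simp only [Complex.ofReal_zero, mul_zero, add_zero] at this
  exact this.trans (max_lt ha hb).le

/-- An entire map that is bounded on a left and a right half plane and on relatively dense
horizontal segments between them is constant. -/
lemma eq_of_bounded_on_ladder {E : Type*} [NormedAddCommGroup E] [NormedSpace ℂ E] {G : ℂ → E}
    (hG : Differentiable ℂ G) {a b l C : ℝ} (P : ℝ → Prop)
    (hP : ∀ x, ∃ σ ∈ Set.Icc x (x + l), P σ) (ha : ∀ z : ℂ, z.re ≤ a → ‖G z‖ ≤ C)
    (hb : ∀ z : ℂ, b ≤ z.re → ‖G z‖ ≤ C)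
    (hl : ∀ z : ℂ, a ≤ z.re → z.re ≤ b → P z.im → ‖G z‖ ≤ C) (z w : ℂ) : G z = G w := by
  refine hG.apply_eq_apply_of_bounded (isBounded_iff_forall_norm_le.2 ⟨C, ?_⟩) z w
  rintro _ ⟨ζ, rfl⟩
  rcases le_or_gt ζ.re a with h1 | h1
  · exact ha ζ h1
  rcases le_or_gt b ζ.re with h2 | h2
  · exact hb ζ h2
  -- One rung strictly below and one strictly above `ζ` enclose it in a rectangle, on whose boundary
  -- the bound is known.
  obtain ⟨σ₁, hσ₁, hP₁⟩ := hP (ζ.im - l - 1)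
  obtain ⟨σ₂, hσ₂, hP₂⟩ := hP (ζ.im + 1)
  have hl1 : σ₁ < ζ.im := by linarith [hσ₁.2]
  have hl2 : ζ.im < σ₂ := by linarith [hσ₂.1]
  have hab : a < b := h1.trans h2
  refine Complex.norm_le_of_forall_mem_frontier_norm_le
    (U := Set.Ioo a b ×ℂ Set.Ioo σ₁ σ₂)
    ((Metric.isBounded_Ioo a b).reProdIm (Metric.isBounded_Ioo σ₁ σ₂)) hG.diffContOnCl ?_
    (subset_closure ⟨⟨h1, h2⟩, hl1, hl2⟩)
  intro z hz
  rw [Complex.frontier_reProdIm, closure_Ioo hab.ne, closure_Ioo (hl1.trans hl2).ne,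
    frontier_Ioo hab, frontier_Ioo (hl1.trans hl2)] at hz
  rcases hz with ⟨hre, him⟩ | ⟨hre, him⟩
  · refine hl z hre.1 hre.2 ?_
    rcases him with h | h
    · rw [h]; exact hP₁
    · rw [h]; exact hP₂
  · rcases hre with h | h
    · exact ha z (le_of_eq h)
    · exact hb z (le_of_eq (Eq.symm h))

/-- Far points of a horizontal strip lie in a given sector. -/
lemma exists_polar_of_strip (l : ℝ) {θ₀ : ℝ} (hθ₀ : 0 < θ₀) : ∃ x₀ : ℝ, 0 < x₀ ∧
    ∀ w : ℂ, x₀ ≤ w.re → |w.im| ≤ l → ∃ θ s : ℝ, |θ| ≤ θ₀ ∧ 0 ≤ s ∧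
      w = Complex.exp (θ * Complex.I) * s := by
  have hc : ContinuousAt Complex.arg 1 := Complex.continuousAt_arg (by simp)
  obtain ⟨ε, hε, hε'⟩ := Metric.continuousAt_iff.1 hc θ₀ hθ₀
  refine ⟨|l| / ε + 1, by positivity, fun w hw hl => ⟨Complex.arg w, ‖w‖, ?_, norm_nonneg _, ?_⟩⟩
  · have hl0 : 0 ≤ |l| / ε := by positivity
    have hre : 0 < w.re := by linarith
    -- Dividing by the real part does not change the argument and brings the point close to `1`.
    have h1 : Complex.arg w = Complex.arg (((w.re⁻¹ : ℝ) : ℂ) * w) :=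
      (Complex.arg_real_mul _ (inv_pos.2 hre)).symm
    have h2 : ((w.re⁻¹ : ℝ) : ℂ) * w - 1 = ((w.im / w.re : ℝ) : ℂ) * Complex.I := by
      apply Complex.ext
      · simp [hre.ne']
      · simp [div_eq_inv_mul]
    have h3 := @hε' (((w.re⁻¹ : ℝ) : ℂ) * w) (by
      rw [dist_eq_norm, h2, norm_mul, Complex.norm_I, mul_one, Complex.norm_real,
        Real.norm_eq_abs, abs_div, abs_of_pos hre, div_lt_iff₀ hre]
      have : |l| < ε * w.re := by
        rw [← div_lt_iff₀' hε]
        linarith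
      linarith [le_abs_self l])
    rw [Complex.arg_one, dist_zero_right, Real.norm_eq_abs, ← h1] at h3
    exact h3.le
  · rw [mul_comm, Complex.norm_mul_exp_arg_mul_I]

end

end

section

/-! ### Entire extensions of heteroclinic orbits -/

open FracSpace

section

universe u

section

variable {X Y : Type u} [NormedAddCommGroup X] [NormedSpace ℂ X]
  [NormedAddCommGroup Y] [NormedSpace ℂ Y]

lemma isEntire_of_fderiv_bound {f : Y → X} (hf : Differentiable ℂ f)
    (hf' : ∀ R : ℝ, ∃ C : ℝ, ∀ w, ‖w‖ ≤ R → ‖fderiv ℂ f w‖ ≤ C) : IsEntire f := by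
  refine ⟨hf, fun r => ?_⟩
  obtain ⟨C, hC⟩ := hf' r
  refine ⟨‖f 0‖ + |C| * |r|, by positivity, fun y hy => ?_⟩
  let _ : NormedSpace ℝ Y := NormedSpace.restrictScalars ℝ ℂ Y
  have := (convex_closedBall (0 : Y) r).norm_image_sub_le_of_norm_fderiv_le (𝕜 := ℂ) (f := f)
    (x := 0) (y := y) (fun x _ => hf x) (fun x hx => (hC x (by simpa using hx)).trans (le_abs_self C))
    (by simpa using (norm_nonneg y).trans hy) (by simpa using hy)
  rw [sub_zero] at this
  have h2 : |C| * ‖y‖ ≤ |C| * |r| :=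
    mul_le_mul_of_nonneg_left (hy.trans (le_abs_self r)) (abs_nonneg C)
  linarith [norm_le_norm_add_norm_sub' (f y) (f 0)]

/-- The nonlinear remainder of `f` at `W`. -/
def remainder (f : Y → X) (W : Y) (y : Y) : X := f (y + W) - f W - fderiv ℂ f W y

lemma remainder_zero (f : Y → X) (W : Y) : remainder f W 0 = 0 := by simp [remainder]

lemma IsEntire.remainder {f : Y → X} (hf : IsEntire f) (W : Y) :
    IsEntire (remainder f W) := by
  refine ⟨((hf.diff.comp (differentiable_id.add_const W)).sub_const _).sub
    (ContinuousLinearMap.differentiable _), fun r => ?_⟩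
  obtain ⟨C, hC, h⟩ := hf.bdd (|r| + ‖W‖)
  refine ⟨C + C + ‖_root_.fderiv ℂ f W‖ * |r|, by positivity, fun y hy => ?_⟩
  have hy' : ‖y‖ ≤ |r| := hy.trans (le_abs_self r)
  refine (norm_sub_le _ _).trans (add_le_add ((norm_sub_le _ _).trans (add_le_add ?_ ?_)) ?_)
  · exact h _ ((norm_add_le _ _).trans (by linarith))
  · exact h _ (by linarith [abs_nonneg r])
  · exact (ContinuousLinearMap.le_opNorm _ _).trans (by gcongr)

lemma fderiv_remainder_zero {f : Y → X} (hf : Differentiable ℂ f) (W : Y) :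
    fderiv ℂ (remainder f W) 0 = 0 := by
  have h1 : HasFDerivAt (fun y => f (y + W)) (fderiv ℂ f W) 0 := by
    have := (hf (0 + W)).hasFDerivAt.comp 0 ((hasFDerivAt_id (0 : Y)).add_const W)
    rw [zero_add, ContinuousLinearMap.comp_id] at this
    exact this
  have h2 := (h1.sub_const (f W)).sub (fderiv ℂ f W).hasFDerivAt
  rw [sub_self] at h2
  exact h2.fderiv

end

variable {X : Type u} [NormedAddCommGroup X] [NormedSpace ℂ X] [CompleteSpace X]
  {A : X →ₗ.[ℂ] X} {c α : ℝ}

/-- An entire extension of a real solution satisfies the equation, in resolvent form, for all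
complex times. -/
lemma IsLift.entire_relation {T : FracSpace A c α →L[ℂ] X} {R : ℂ → X →L[ℂ] FracSpace A c α}
    (hR : IsLift toBaseL (addFrac A T) R) (hd : (addFrac A T).domain = A.domain)
    {f : FracSpace A c α → X} (hf : Differentiable ℂ f) {Γ : ℝ → FracSpace A c α}
    (hΓ : IsEternalSolution f Γ) {G : ℂ → FracSpace A c α} (hG : Differentiable ℂ G)
    (hGΓ : ∀ r : ℝ, G r = Γ r) (z : ℂ) (hz : z ∈ resolventSet (addFrac A T)) (ζ : ℂ) :
    R z (z • toBaseL (G ζ) - toBaseL (deriv G ζ) + (f (G ζ) - T (G ζ))) = G ζ := by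
  have hdG : Differentiable ℂ (deriv G) := fun ζ =>
    (hG.analyticAt ζ).deriv.differentiableAt
  have hJ : ∀ H : ℂ → FracSpace A c α, Differentiable ℂ H →
      Differentiable ℂ fun ζ => toBaseL (H ζ) := fun H hH =>
    (toBaseL (A := A) (c := c) (α := α)).differentiable.comp hH
  have hl : Differentiable ℂ fun ζ =>
      R z (z • toBaseL (G ζ) - toBaseL (deriv G ζ) + (f (G ζ) - T (G ζ))) :=
    (R z).differentiable.comp ((((hJ G hG).const_smul z).sub (hJ _ hdG)).add
      ((hf.comp hG).sub (T.differentiable.comp hG)))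
  -- Both sides are entire in `ζ`, because the resolvent is bounded; the unbounded operator enters
  -- only on the real axis.
  refine eqOn_of_eq_on_real isOpen_univ isPreconnected_univ hl.differentiableOn
    hG.differentiableOn (x := 0) (Set.mem_univ _) (fun r _ => ?_) (Set.mem_univ ζ)
  obtain ⟨hA, hder⟩ := hΓ.2 r
  have h1 : HasDerivAt (fun t : ℝ => toBaseL (G t)) (toBaseL (deriv G r)) r := by
    have h2 := hasDerivAt_comp_real_line (z := 0) (w := 1) (s := r) (hG _)
    simp only [zero_add, one_mul, one_smul] at h2
    exact ((toBaseL (A := A) (c := c) (α := α)).restrictScalars ℝ).hasFDerivAt.comp_hasDerivAt r h2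
  have h3 : (fun t : ℝ => toBaseL (G t)) = fun t : ℝ => (Γ t).toBase := by
    funext t
    rw [hGΓ]; rfl
  rw [h3] at h1
  have h4 := h1.unique hder
  have hAL : toBaseL (Γ r) ∈ (addFrac A T).domain := by rw [hd]; exact hA
  rw [h4, hGΓ]
  have h5 := hR.left hz hAL
  rw [addFrac_apply T (Γ r) hAL hA] at h5
  refine Eq.trans ?_ h5
  congr 1
  change z • toBaseL (Γ r) - (A ⟨(Γ r).toBase, hA⟩ + f (Γ r)) + (f (Γ r) - T (Γ r)) =
    z • toBaseL (Γ r) - (A ⟨(Γ r).toBase, hA⟩ + T (Γ r))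
  abel

lemma IsEquilibrium.isEternalSolution {f : FracSpace A c α → X} {W : FracSpace A c α}
    (hW : IsEquilibrium f W) : IsEternalSolution f fun _ => W := by
  obtain ⟨h, hA⟩ := hW
  refine ⟨continuous_const, fun r => ⟨h, ?_⟩⟩
  change HasDerivAt _ (A ⟨W.toBase, h⟩ + f W) r
  rw [hA]
  exact hasDerivAt_const _ _

/-- The relation for the constant solution `W` is subtracted from that for `G`, both taken with `T =
f'(W)`. What remains of the nonlinearity is quadratic at the origin. -/
lemma IsLift.entire_relation_sub {f : FracSpace A c α → X} (hf : Differentiable ℂ f)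
    {W : FracSpace A c α} {R : ℂ → X →L[ℂ] FracSpace A c α}
    (hR : IsLift toBaseL (linearization f W) R) (hd : (linearization f W).domain = A.domain)
    (hW : IsEquilibrium f W) {Γ : ℝ → FracSpace A c α} (hΓ : IsEternalSolution f Γ)
    {G : ℂ → FracSpace A c α} (hG : Differentiable ℂ G) (hGΓ : ∀ r : ℝ, G r = Γ r) (z : ℂ)
    (hz : z ∈ resolventSet (linearization f W)) (ζ : ℂ) :
    R z (z • toBaseL (G ζ - W) - toBaseL (deriv (fun ζ => G ζ - W) ζ) +
      remainder f W (G ζ - W)) = G ζ - W := by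
  have h1 := hR.entire_relation hd hf hΓ hG hGΓ z hz ζ
  have h2 := hR.entire_relation hd hf hW.isEternalSolution (G := fun _ => W)
    (differentiable_const W) (fun _ => rfl) z hz ζ
  rw [deriv_const, map_zero] at h2
  rw [deriv_sub_const_fun]
  refine Eq.trans ?_ (congrArg₂ (· - ·) h1 h2)
  rw [← map_sub]
  congr 1
  simp only [remainder, sub_add_cancel, map_sub, smul_sub]
  abel

/-- The order of choices matters: `S` comes from the unstable manifold at `Wm`, `δ` and `θ₀` from
stability at `Wp`, `T` from the convergence to `Wp`, `δ₃` from continuous dependence over the fixed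
time `T - S`, and only then `η` and `l` from almost periodicity. -/
theorem IsHeteroclinic.not_exists_entire {ω : ℝ} (hA : IsSectorial A ω) (hc : ω < c) (hα₀ : 0 ≤ α)
    (hα₁ : α < 1) {f : FracSpace A c α → X} (hf : IsEntire f) {Wm Wp : FracSpace A c α}
    {Γ : ℝ → FracSpace A c α} (hWm : IsHyperbolicEquilibrium f Wm) (hWp : IsEquilibrium f Wp)
    (hΓ : IsHeteroclinic f Γ Wm Wp) (hstable : IsLinearlyAsymptoticallyStable f Wp)
    (hdiag : HasDiagonalRealNonResonantUnstablePart (linearization f Wm)) {G : ℂ → FracSpace A c α}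
    (hG : Differentiable ℂ G) (hGΓ : ∀ r : ℝ, G r = Γ r) : False := by
  obtain ⟨hsol, hbot, htop, r₁, r₂, hne⟩ := hΓ
  -- Three linear parts are used: `A` itself over the finite time interval, and the linearizations
  -- at the two equilibria.
  obtain ⟨hd0, R, k, r, B, hR⟩ := hA.exists_sectorLift hc hα₀ hα₁ (0 : FracSpace A c α →L[ℂ] X)
  obtain ⟨hdm, Rm, km, rm, Bm, hRm⟩ := hA.exists_sectorLift hc hα₀ hα₁ (fderiv ℂ f Wm)
  obtain ⟨hdp, Rp, kp, rp, Bp, hRp⟩ := hA.exists_sectorLift hc hα₀ hα₁ (fderiv ℂ f Wp)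
  have him : ∀ z : ℂ, z.re = 0 → z ∈ resolventSet (linearization f Wm) := fun z hz =>
    by_contra fun h => hWm.2 z h hz
  have hip : ∀ z : ℂ, 0 ≤ z.re → z ∈ resolventSet (linearization f Wp) := fun z hz =>
    by_contra fun h => (hstable z h).not_ge hz
  obtain ⟨N, μ, b, ℓ, Q, k', M, hU, hμ⟩ := hRm.exists_unstableSplitting him hdiag
  have hrelm := hRm.lift.entire_relation_sub hf.diff hdm hWm.1 hsol hG hGΓ
  obtain ⟨S, ⟨C₁, hC₁⟩, hap⟩ := hU.almostPeriodic_of_tendsto hμ (hf.remainder Wm)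
    (remainder_zero f Wm) (fderiv_remainder_zero hf.diff Wm) (D := fun ζ => G ζ - Wm)
    (hG.sub_const Wm) (fun z => by
      have := hrelm 0 (him 0 rfl) z
      rwa [zero_smul, zero_sub] at this)
    (by
      simp only [hGΓ]
      simpa using hbot.sub_const Wm)
  obtain ⟨C₂, δ, θ₀, hδ, hθ₀, hsec⟩ := hRp.exists_sector_bound hip (hf.remainder Wp)
    (remainder_zero f Wp) (fderiv_remainder_zero hf.diff Wp) (D := fun ζ => G ζ - Wp)
    (hG.sub_const Wp) (hRp.lift.entire_relation_sub hf.diff hdp hWp hsol hG hGΓ)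
  obtain ⟨T, hT, hTS⟩ := ((htop.eventually (Metric.ball_mem_nhds Wp (half_pos hδ))).and
    (eventually_ge_atTop S)).exists
  rw [dist_eq_norm] at hT
  obtain ⟨δ₃, hδ₃, hdep⟩ := hR.exists_continuous_dependence hf hG (fun z hz ζ => by
    have := hR.lift.entire_relation hd0 hf.diff hsol hG hGΓ z hz ζ
    rwa [zero_apply, sub_zero] at this) S (T - S) (ε := min (δ / 2) 1) (by positivity)
  obtain ⟨η, hη, hapη⟩ := hap (δ₃ / 2) (half_pos hδ₃)
  obtain ⟨l, hl, hdense⟩ := exists_almostPeriods μ hη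
  obtain ⟨x₀, hx₀, hstrip⟩ := exists_polar_of_strip l hθ₀
  obtain ⟨ρ, hρ⟩ := (isCompact_Icc (a := (0 : ℝ)) (b := T - S)).exists_bound_of_continuousOn
    (f := fun s : ℝ => G (S + s)) (hG.continuous.comp (by fun_prop)).continuousOn
  set P : ℝ → Prop := fun σ => ∀ j, ‖Complex.exp (μ j * (σ * Complex.I)) - 1‖ ≤ η with hP
  -- At height `σ` the orbit starts close to `Γ S` and follows `Γ` up to time `T`. The tolerance `δ
  -- / 2` leads into the stability ball of `Wp`, and the tolerance `1` bounds `G` on the way.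
  have hmid : ∀ σ, P σ → ∀ s ∈ Set.Icc 0 (T - S),
      ‖G (S + σ * Complex.I + s) - G (S + s)‖ ≤ min (δ / 2) 1 := by
    intro σ hσ
    refine hdep σ ?_
    have := hapη σ hσ S (by simp)
    rw [sub_sub_sub_cancel_right] at this
    linarith
  have hright : ∀ σ, P σ → ∀ θ : ℝ, |θ| ≤ θ₀ → ∀ s : ℝ, 0 ≤ s →
      ‖G (T + σ * Complex.I + Complex.exp (θ * Complex.I) * s)‖ ≤ C₂ + ‖Wp‖ := by
    intro σ hσ θ hθ s hs
    have h1 := hmid σ hσ (T - S) ⟨by linarith, le_rfl⟩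
    have e1 : (S : ℂ) + σ * Complex.I + (T - S : ℝ) = T + σ * Complex.I := by push_cast; ring
    have e2 : (S : ℂ) + (T - S : ℝ) = T := by push_cast; ring
    rw [e1, e2, hGΓ] at h1
    have h2 : ‖G (T + σ * Complex.I) - Wp‖ < δ := by
      have := norm_sub_le_norm_sub_add_norm_sub (G (T + σ * Complex.I)) (Γ T) Wp
      linarith [min_le_left (δ / 2) 1]
    have h3 := hsec _ h2 θ hθ s hs
    linarith [norm_le_norm_add_norm_sub' (G (T + σ * Complex.I + Complex.exp (θ * Complex.I) * s)) Wp]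
  refine hne ?_
  rw [← hGΓ, ← hGΓ]
  refine eq_of_bounded_on_ladder hG (a := S) (b := T + x₀) (l := l)
    (C := max (C₁ + ‖Wm‖) (max (C₂ + ‖Wp‖) (ρ + 1))) P hdense (fun z hz => ?_) (fun z hz => ?_)
    (fun z hz1 hz2 hz => ?_) _ _
  · refine le_trans ?_ (le_max_left _ _)
    linarith [hC₁ z hz, norm_le_norm_add_norm_sub' (G z) Wm]
  · refine le_trans ?_ ((le_max_left _ _).trans (le_max_right _ _))
    -- A vertex `T + iσ` with `σ` within `l` above the height of `z` has `z` in its sector, since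
    -- `z` lies at least `x₀` to its right.
    obtain ⟨σ, hσ, hPσ⟩ := hdense z.im
    obtain ⟨θ, s, hθ, hs, hw⟩ := hstrip (z - (T + σ * Complex.I)) (by simp; linarith) (by
      simp only [Complex.sub_im, Complex.add_im, Complex.ofReal_im, Complex.mul_im, Complex.I_re,
        Complex.I_im, Complex.ofReal_re, mul_one, mul_zero, zero_add, add_zero]
      rw [abs_le]
      constructor <;> linarith [hσ.1, hσ.2])
    have := hright σ hPσ θ hθ s hs
    rwa [← hw, add_sub_cancel] at this
  · refine le_trans ?_ (le_max_right _ _)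
    rcases le_or_gt z.re T with h | h
    · refine le_trans ?_ (le_max_right _ _)
      have hs : z.re - S ∈ Set.Icc 0 (T - S) := ⟨by linarith, by linarith⟩
      have h1 := hmid z.im hz _ hs
      have h2 := hρ _ hs
      have e : (S : ℂ) + z.im * Complex.I + (z.re - S : ℝ) = z := by
        apply Complex.ext <;> simp
      rw [e] at h1
      linarith [norm_le_norm_add_norm_sub' (G z) (G (S + (z.re - S : ℝ))), min_le_right (δ / 2) 1]
    · refine le_trans ?_ (le_max_left _ _)
      -- On a rung to the right of `T`, the horizontal ray `θ = 0` of the sector is enough.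
      have := hright z.im hz 0 (by simpa using hθ₀.le) (z.re - T) (by linarith)
      have e : (T : ℂ) + z.im * Complex.I + Complex.exp ((0 : ℝ) * Complex.I) * (z.re - T : ℝ) = z := by
        apply Complex.ext <;> simp
      rwa [e] at this

end

end

end AnalyticSemigroup

end

theorem theorem1p1 {X : Type*} [NormedAddCommGroup X] [NormedSpace ℂ X] [CompleteSpace X]
    (A : X →ₗ.[ℂ] X) (ω c α : ℝ) (hA : IsSectorial A ω) (hc : ω < c)
    (hα₀ : 0 ≤ α) (hα₁ : α < 1)
    (f : FracSpace A c α → X) (hf : Differentiable ℂ f)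
    (hf' : ∀ R : ℝ, ∃ C : ℝ, ∀ w : FracSpace A c α, ‖w‖ ≤ R → ‖fderiv ℂ f w‖ ≤ C)
    (Wm Wp : FracSpace A c α) (Γ : ℝ → FracSpace A c α)
    (hWm : IsHyperbolicEquilibrium f Wm) (hWp : IsHyperbolicEquilibrium f Wp)
    (hΓ : IsHeteroclinic f Γ Wm Wp)
    (hstable : IsLinearlyAsymptoticallyStable f Wp)
    (hfin : FiniteDimensional ℂ (unstableSpace (linearization f Wm)))
    (hdiag : HasDiagonalRealNonResonantUnstablePart (linearization f Wm)) :
    ¬ ∃ G : ℂ → FracSpace A c α, Differentiable ℂ G ∧ ∀ r : ℝ, G (r : ℂ) = Γ r := by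
  rintro ⟨G, hG, hGΓ⟩
  exact hΓ.not_exists_entire hA hc hα₀ hα₁ (isEntire_of_fderiv_bound hf hf') hWm hWp.1 hstable
    hdiag hG hGΓ
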